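/- **Setting.** Let $\nu\in\mathbb R$ and let $u_0$ be a real Schwartz function with a single negative hump: for some $x_M$, $u_0'<0$ on $(-\infty,x_M)$ and $u_0'>0$ on $(x_M,\infty)$. Let $f_-$ be the inverse of the decreasing part $u_0|_{(-\infty,x_M]}$. For $-\nu<\beta_3<\beta_2<\beta_1$, $\boldsymbol\beta=(\beta_1,\beta_2,\beta_3)$, put $$s^2=\frac{(\beta_1+\nu)(\beta_2-\beta_3)}{(\beta_2+\nu)(\beta_1-\beta_3)},\qquad \rho=\frac{\beta_2-\beta_3}{\beta_2+\nu},\qquad c=\beta_1+\beta_2+\beta_3+2\nu,$$ $$K(s)=\int_0^1\!\frac{dz}{\sqrt{(1-z^2)(1-s^2z^2)}},\qquad \Lambda(s,\rho)=\int_0^1\!\frac{dz}{(1-\rho z^2)\sqrt{(1-z^2)(1-s^2z^2)}},$$ $$I_0=\frac{4K(s)}{\sqrt{(\beta_2+\nu)(\beta_1-\beta_3)}},\quad p=\frac1{2K(s)}\int_0^{\sqrt{\frac{\beta_2+\nu}{\beta_1+\nu}}}\!\!\frac{dz}{\sqrt{(1-z^2)(1-s^2z^2)}},\quad \tau=i\,\frac{K(\sqrt{1-s^2})}{K(s)},$$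 $$k=\frac{\pi\sqrt{(\beta_2+\nu)(\beta_1-\beta_3)}}{2(\beta_3+\nu)\Lambda(s,\rho)},\quad \omega=ck,\quad \vartheta_3(z,\tau)=\sum_{n\in\mathbb Z}e^{i\pi n^2\tau+2\pi i nz},$$ $$q(\boldsymbol\beta)=\frac1{2\sqrt2\,\pi}\int_{-1}^1\!\int_{-1}^1\frac{f_-\!\left(\frac{1+\mu}2\left(\frac{1+\lambda}2\beta_3+\frac{1-\lambda}2\beta_2\right)+\frac{1-\mu}2\beta_1\right)}{\sqrt{1-\mu}\,\sqrt{1-\lambda^2}}\,d\lambda\,d\mu .$$ The hodograph (Whitham) equations are $$x=C_i(\boldsymbol\beta)\,t+w_i(\boldsymbol\beta),\quad C_i=\frac{\partial_{\beta_i}\omega}{\partial_{\beta_i}k},\quad w_i=q+(C_i-c)\,\partial_{\beta_i}q,\qquad i=1,2,3.$$ For $\epsilon>0$, the one-phase solution of the Camassa--Holm equation $u_t+(3u+2\nu)u_x-\epsilon^2(u_{xxt}+2u_xu_{xx}+uu_{xxx})=0$, with modulated parameters $\boldsymbol\beta$, is defined implicitly (through the real parameter $z$) by $$u(x,t,\epsilon)=c-2(\beta_3+\nu)\frac{\Lambda(s,\rho)}{K(s)}+\frac2{I_0}\frac{d}{dz}\log\frac{\vartheta_3(z-p,\tau)}{\vartheta_3(z+p,\tau)},\qquad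 \frac{k}{\epsilon}\,(x-ct-q)=2\pi z-k\log\frac{\vartheta_3(z-p,\tau)}{\vartheta_3(z+p,\tau)}.$$ Let $\xi=k(x-ct-q)$ be its phase. Let $Q(u,v)=q(u,v,v)=\frac{\sqrt2}4\int_{-1}^1 f_-\!\left(\frac{1+\mu}2v+\frac{1-\mu}2u\right)\frac{d\mu}{\sqrt{1-\mu}}$ and $\Phi=\partial_uQ+\partial_vQ$. Fix $t$ and let $x^-=x^-(t)$, $u=u(t)$, $v=v(t)$, with $-\nu<v$ and $u_0(x_M)<v<u<0$, solve the leading edge system $$x^-=(3u+2\nu)t+f_-(u),\qquad (u-v)(t+\partial_uQ)+(v+\nu)(3t+\Phi)=0,$$ $$(u-2v-\nu)(\Phi+3t)+2(v+\nu)(u-v)\,\partial_v\Phi=0,$$ and assume that the edge is nondegenerate: $3t+f_-'(u)\ne0$ and $$4(v+\nu)^2(u-v)^2\,\partial_{vv}\Phi-(3t+\Phi)(8v\nu+3u^2-8uv-2u\nu+3\nu^2+8v^2)\neq0$$ (with $Q$, $\Phi$ and their derivatives evaluated at $(u,v)$). **Theorem.** For $x>x^-$ near $x^-$ let $\boldsymbol\beta(x)$,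 with $-\nu<\beta_3<\beta_2<\beta_1$, solve the hodograph equations at $(x,t)$, and suppose that $\beta_1\to u$ and $\beta_2,\beta_3\to v$ as $x\downarrow x^-$. Put $\delta=\frac{\beta_2-\beta_3}2$ and $\Delta=\beta_1-u$, so that $\delta,\Delta\to0$. Then, as $x\downarrow x^-$, $$\xi=-2\sqrt{(u-v)(v+\nu)}\,\bigl(\Phi(u,v)+3t\bigr)+\sqrt{\frac{u-v}{v+\nu}}\,(x-x^-)+O\bigl((x-x^-)^2\bigr),$$ and, for all $x>x^-$ close enough to $x^-$ and every $\epsilon>0$, the equation for $z$ has exactly one real solution, and the one-phase solution so defined satisfies $$u(x,t,\epsilon)=u+\frac{x-x^-}{3t+f_-'(u)}+2\delta\cos\frac{\xi}{\epsilon}-\frac{\delta^2}2\,\frac{u+\nu}{(u-v)(v+\nu)}\left(1-\cos\frac{2\xi}\epsilon\right)+O(\delta^3),$$ with the constant in $O(\delta^3)$ and the range of $x$ independent of $\epsilon$. -/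

import Mathlib

open Filter Topology

noncomputable section

namespace CHOnePhase

/-- The Schwartz function `u₀` has a single negative hump with minimum at `xM`: it strictly
decreases to the left of `xM` and strictly increases to the right of it (with nonzero slope).
Since `u₀` decays at infinity, it is then negative. -/
structure IsSingleNegativeHump (u₀ : SchwartzMap ℝ ℝ) (xM : ℝ) : Prop where
  deriv_neg : ∀ x < xM, deriv u₀ x < 0
  deriv_pos : ∀ x > xM, 0 < deriv u₀ x

/-- `f₋`, the inverse of the decreasing part `u₀ : (-∞, xM] → [u₀ xM, 0)` of the initial datum. -/
def fMinus (u₀ : SchwartzMap ℝ ℝ) (xM : ℝ) : ℝ → ℝ :=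
  Function.invFunOn u₀ (Set.Iic xM)

theorem fMinus_apply {u₀ : SchwartzMap ℝ ℝ} {xM : ℝ} (h : IsSingleNegativeHump u₀ xM)
    {x : ℝ} (hx : x ≤ xM) : fMinus u₀ xM (u₀ x) = x := by
  have hanti : StrictAntiOn u₀ (Set.Iic xM) := by
    refine strictAntiOn_of_deriv_neg (convex_Iic xM) u₀.continuous.continuousOn ?_
    intro y hy
    rw [interior_Iic] at hy
    exact h.deriv_neg y hy
  exact hanti.injOn.leftInvOn_invFunOn hx

/-! ### Complete elliptic integrals and the theta function -/

/-- The complete elliptic integral of the first kind, of modulus `s`. -/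
def ellipticK (s : ℝ) : ℝ :=
  ∫ z in (0 : ℝ)..1, 1 / √((1 - z ^ 2) * (1 - s ^ 2 * z ^ 2))

/-- The complete elliptic integral of the third kind `Λ(s, ρ)`, of modulus `s`. -/
def ellipticLambda (s ρ : ℝ) : ℝ :=
  ∫ z in (0 : ℝ)..1, 1 / ((1 - ρ * z ^ 2) * √((1 - z ^ 2) * (1 - s ^ 2 * z ^ 2)))

/-- The third Jacobi theta function `ϑ₃(z, τ)` at a real argument `z` and at `τ = i y`, where
it takes real values. -/
def theta3 (z y : ℝ) : ℝ := (jacobiTheta₂ (z : ℂ) (y * Complex.I)).re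

theorem ofReal_theta3 (z y : ℝ) :
    (theta3 z y : ℂ) = jacobiTheta₂ (z : ℂ) (y * Complex.I) := by
  have h : (starRingEnd ℂ) (jacobiTheta₂ (z : ℂ) (y * Complex.I)) =
      jacobiTheta₂ (z : ℂ) (y * Complex.I) := by
    rw [jacobiTheta₂_conj]
    simp
  exact Complex.conj_eq_iff_re.mp h

/-! ### The one-phase solution

The branch points `β₁ > β₂ > β₃ > -ν` are `β 0`, `β 1`, `β 2`. -/

/-- The modulus `s` of the elliptic curve. -/
def modulus (ν : ℝ) (β : Fin 3 → ℝ) : ℝ :=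
  √(((β 0 + ν) * (β 1 - β 2)) / ((β 1 + ν) * (β 0 - β 2)))

def rho (ν : ℝ) (β : Fin 3 → ℝ) : ℝ := (β 1 - β 2) / (β 1 + ν)

/-- The `a`-period `I₀` of `dξ / w`. -/
def periodI0 (ν : ℝ) (β : Fin 3 → ℝ) : ℝ :=
  4 * ellipticK (modulus ν β) / √((β 1 + ν) * (β 0 - β 2))

/-- The abelian integral `p`. -/
def shiftP (ν : ℝ) (β : Fin 3 → ℝ) : ℝ :=
  1 / (2 * ellipticK (modulus ν β)) *
    ∫ z in (0 : ℝ)..√((β 1 + ν) / (β 0 + ν)),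
      1 / √((1 - z ^ 2) * (1 - modulus ν β ^ 2 * z ^ 2))

/-- The imaginary part `K(√(1 - s²)) / K(s)` of `τ`. -/
def tauIm (ν : ℝ) (β : Fin 3 → ℝ) : ℝ :=
  ellipticK (√(1 - modulus ν β ^ 2)) / ellipticK (modulus ν β)

/-- The wave number `k`. -/
def waveNumber (ν : ℝ) (β : Fin 3 → ℝ) : ℝ :=
  Real.pi * √((β 1 + ν) * (β 0 - β 2)) /
    (2 * (β 2 + ν) * ellipticLambda (modulus ν β) (rho ν β))

/-- The phase velocity `c = β₁ + β₂ + β₃ + 2ν`. -/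
def phaseVelocity (ν : ℝ) (β : Fin 3 → ℝ) : ℝ := β 0 + β 1 + β 2 + 2 * ν

/-- The frequency `ω`. -/
def frequency (ν : ℝ) (β : Fin 3 → ℝ) : ℝ := phaseVelocity ν β * waveNumber ν β

/-- `log (ϑ₃(z - p, τ) / ϑ₃(z + p, τ))`. -/
def logTheta (ν : ℝ) (β : Fin 3 → ℝ) (z : ℝ) : ℝ :=
  Real.log (theta3 (z - shiftP ν β) (tauIm ν β) / theta3 (z + shiftP ν β) (tauIm ν β))

/-- The value of the one-phase solution at the uniformizing parameter `z`. -/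
def onePhaseU (ν : ℝ) (β : Fin 3 → ℝ) (z : ℝ) : ℝ :=
  phaseVelocity ν β
    - 2 * (β 2 + ν) * (ellipticLambda (modulus ν β) (rho ν β) / ellipticK (modulus ν β))
    + 2 / periodI0 ν β * deriv (logTheta ν β) z

/-- The variable `ζ` of the one-phase solution as a function of the parameter `z`. -/
def onePhaseZeta (ν : ℝ) (β : Fin 3 → ℝ) (z : ℝ) : ℝ :=
  2 * Real.pi * z - waveNumber ν β * logTheta ν β z

/-! ### Modulation equations in hodograph form -/

/-- Partial derivative with respect to the `i`-th of the three variables. -/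
def partialD (i : Fin 3) (F : (Fin 3 → ℝ) → ℝ) (β : Fin 3 → ℝ) : ℝ :=
  deriv (fun b => F (Function.update β i b)) (β i)

/-- The characteristic speeds `C_i = ∂_{β_i} ω / ∂_{β_i} k` of the modulation equations. -/
def speed (ν : ℝ) (i : Fin 3) (β : Fin 3 → ℝ) : ℝ :=
  partialD i (frequency ν) β / partialD i (waveNumber ν) β

/-- The phase shift `q(β)` determined by `f = f₋`. It is normalized so that `q(β) = f(y)` when
`β₁ = β₂ = β₃ = y`. -/
def qShift (f : ℝ → ℝ) (β : Fin 3 → ℝ) : ℝ :=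
  1 / (2 * √2 * Real.pi) *
    ∫ μ in (-1 : ℝ)..1, ∫ l in (-1 : ℝ)..1,
      f ((1 + μ) / 2 * ((1 + l) / 2 * β 2 + (1 - l) / 2 * β 1) + (1 - μ) / 2 * β 0) /
        (√(1 - μ) * √(1 - l ^ 2))

/-- `w_i = q + (C_i - (β₁ + β₂ + β₃ + 2ν)) ∂_{β_i} q`. -/
def wFun (ν : ℝ) (f : ℝ → ℝ) (i : Fin 3) (β : Fin 3 → ℝ) : ℝ :=
  qShift f β + (speed ν i β - phaseVelocity ν β) * partialD i (qShift f) β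

/-- The hodograph system `x = C_i t + w_i`, `i = 1, 2, 3`. -/
def SolvesHodograph (ν : ℝ) (f : ℝ → ℝ) (x t : ℝ) (β : Fin 3 → ℝ) : Prop :=
  ∀ i, x = speed ν i β * t + wFun ν f i β

/-- The phase `ξ = k (x - (β₁ + β₂ + β₃ + 2ν) t - q)`, that is, `ξ = ε ζ`. -/
def phaseXi (ν : ℝ) (f : ℝ → ℝ) (x t : ℝ) (β : Fin 3 → ℝ) : ℝ :=
  waveNumber ν β * (x - phaseVelocity ν β * t - qShift f β)

/-- `z` is a value of the parameter which belongs to the point `(x, t)`: the second of the two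
equations which implicitly define the one-phase solution. -/
def IsParameter (ν : ℝ) (f : ℝ → ℝ) (β : Fin 3 → ℝ) (x t ε z : ℝ) : Prop :=
  waveNumber ν β / ε * (x - phaseVelocity ν β * t - qShift f β) = onePhaseZeta ν β z

/-! ### The leading edge -/

/-- `Q(u, v) = q(u, v, v)`. -/
def QFun (f : ℝ → ℝ) (u v : ℝ) : ℝ :=
  √2 / 4 * ∫ μ in (-1 : ℝ)..1, f ((1 + μ) / 2 * v + (1 - μ) / 2 * u) / √(1 - μ)

/-- `Φ = ∂_u Q + ∂_v Q`. -/
def PhiFun (f : ℝ → ℝ) (u v : ℝ) : ℝ :=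
  deriv (fun a => QFun f a v) u + deriv (fun b => QFun f u b) v

/-- The system which determines the leading edge `x = x⁻(t)` and the values `u = u(t)`,
`v = v(t)` at which `β₁ = u`, `β₂ = β₃ = v`. -/
structure IsLeadingEdge (ν : ℝ) (f : ℝ → ℝ) (t xm u v : ℝ) : Prop where
  position : 0 = (3 * u + 2 * ν) * t + f u - xm
  critical : 0 = (u - v) * (t + deriv (fun a => QFun f a v) u) + (v + ν) * (3 * t + PhiFun f u v)
  double : 0 = (u - 2 * v - ν) * (PhiFun f u v + 3 * t) +
    2 * (v + ν) * (u - v) * deriv (fun b => PhiFun f u b) v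

/-- The quantity `V`, whose nonvanishing expresses that the leading edge is nondegenerate. -/
def VFun (ν : ℝ) (f : ℝ → ℝ) (t u v : ℝ) : ℝ :=
  4 * (v + ν) ^ 2 * (u - v) ^ 2 * iteratedDeriv 2 (fun b => PhiFun f u b) v -
    (3 * t + PhiFun f u v) *
      (8 * v * ν + 3 * u ^ 2 - 8 * u * v - 2 * u * ν + 3 * ν ^ 2 + 8 * v ^ 2)

end CHOnePhase

end

noncomputable section

namespace CHOnePhase

open MeasureTheory Set Asymptotics
open scoped ContDiff

/-! ### Integrals depending smoothly on parameters -/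

/-! The gap [β₃, β₂] is parametrised by b = m + δ cos θ, where m = (β₂+β₃)/2. A substitution in the
elliptic integrals then turns every ingredient into an average over θ ∈ [0, π] of a function of (β₁,
b) that stays smooth when the gap closes. With g = √((b+ν)/(β₁-b)), the wave length L = 1/k is the
average of g (`waveNumber_eq`), I₀/2π is that of 1/√((b+ν)(β₁-b)) (`periodI0_eq`), and q is that of
Q(β₁, b) (`qShift_eq_cosMean`). Odd powers of cos θ average out, so these averages and their
β-derivatives have clean expansions in δ (`cosMean_sub_isBigO`, `cosMoment_sub_isBigO`).

Hodograph system. Since C_i = c - L/∂_iL, the i-th equation says that ξ, at fixed x and t, is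
critical in β_i (`hodograph_critical`). Let σ be the expected edge value of ξ, X = x - x⁻, and let D
= x⁻ - ct - Q - σg at double points, with average ⟨D⟩. Then L(ξ - σ) = ⟨D⟩ + X. At (u, v) the
leading edge system makes D, D_a, D_b, D_ab, D_bb and D_abb vanish, whereas D_aa ≠ 0 by the slope
condition and D_bbb ≠ 0 by nondegeneracy (`edgeDerivatives_defect`). The critical equations
therefore control β₁-u through D_aa, δ² through D_bbb, and then m-v through D_bbb again, all by
O(X); conversely X = O(δ²) (`edge_asymptotics`). It follows that β₁-u = X/(3t+f'(u)) + O(δ⁴), that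
⟨D⟩ = O(X²), and hence that ξ = σ + X/g(u,v) + O(X²) (`hodograph_asymptotics`).

One-phase solution. The squared modulus is of order δ. The nome is s²/16 + s⁴/32 + O(s⁶)
(`abs_nome_sub_le`, by Landen transformations and a logarithmic estimate), the theta function is one
plus a first harmonic up to the fourth power of the nome, and 2πp is known up to O(s⁴). So the
solution is a mean value plus two harmonics in 2πz up to O(δ³). With κ = (β₁-2m-ν)/(2(m+ν)(β₁-m)),
the mean is β₁ + κδ² (`EdgeFamily.mean_isBigOPow`), and the amplitudes are 2δ and -κδ²
(`EdgeFamily.amplitude_isBigOPow`, `EdgeFamily.second_amplitude_isBigOPow`). The phase relation is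
2πz = ζ + δ sin ζ/(m+ν) + O(δ²), and κ - 1/(m+ν) = -(β₁+ν)/(2(m+ν)(β₁-m)) produces the coefficient
of 1 - cos 2ζ.

The phase map z ↦ ζ is 2πz plus a small bounded perturbation with small derivative, hence bijective.
The parameter ε enters only through ζ = ξ/ε, so estimates uniform in z are uniform in ε
(`EdgeFamily.exists_uniform_bound`). -/

theorem eventually_forall_Icc {E : Type*} [TopologicalSpace E] {P : E × ℝ → Prop} {x₀ : E}
    {a b : ℝ} (h : ∀ θ ∈ Icc a b, ∀ᶠ p in 𝓝 (x₀, θ), P p) :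
    ∀ᶠ x in 𝓝 x₀, ∀ θ ∈ Icc a b, P (x, θ) := by
  refine isCompact_Icc.eventually_forall_of_forall_eventually fun θ hθ => ?_
  exact h θ hθ

theorem continuousOn_slice {E G : Type*} [TopologicalSpace E] [TopologicalSpace G]
    {F : E × ℝ → G} {x : E} {a b : ℝ} (h : ∀ θ ∈ Icc a b, ContinuousAt F (x, θ)) :
    ContinuousOn (fun θ => F (x, θ)) (Icc a b) := fun θ hθ =>
  (ContinuousAt.comp (f := fun θ => (x, θ)) (h θ hθ) (by fun_prop)).continuousWithinAt

theorem exists_norm_bound_Icc {E G : Type*} [TopologicalSpace E] [NormedAddCommGroup G]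
    {F : E × ℝ → G} {x₀ : E} {a b : ℝ} (hF : ∀ θ ∈ Icc a b, ContinuousAt F (x₀, θ)) :
    ∃ C, ∀ᶠ x in 𝓝 x₀, ∀ θ ∈ Icc a b, ‖F (x, θ)‖ ≤ C := by
  obtain ⟨C, hC⟩ := isCompact_Icc.exists_bound_of_continuousOn (continuousOn_slice hF)
  refine ⟨C + 1, eventually_forall_Icc (P := fun p => ‖F p‖ ≤ C + 1) fun θ hθ => ?_⟩
  have h1 : ‖F (x₀, θ)‖ < C + 1 := by linarith [hC θ hθ]
  exact ((hF θ hθ).norm.eventually (gt_mem_nhds h1)).mono fun p hp => hp.le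

theorem continuousAt_integral_param {E G : Type*} [NormedAddCommGroup E]
    [NormedAddCommGroup G] [NormedSpace ℝ G] {F : E × ℝ → G} {x₀ : E} {a b : ℝ} (hab : a ≤ b)
    (hF : ∀ θ ∈ Icc a b, ∀ᶠ p in 𝓝 (x₀, θ), ContinuousAt F p) :
    ContinuousAt (fun x => ∫ θ in a..b, F (x, θ)) x₀ := by
  obtain ⟨C, hC⟩ := exists_norm_bound_Icc fun θ hθ => (hF θ hθ).self_of_nhds
  have h1 := eventually_forall_Icc hF
  refine intervalIntegral.continuousAt_of_dominated_interval (bound := fun _ => C) ?_ ?_ ?_ ?_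
  · filter_upwards [h1] with x hx
    rw [uIoc_of_le hab]
    exact ((continuousOn_slice hx).mono Ioc_subset_Icc_self).aestronglyMeasurable
      measurableSet_Ioc
  · filter_upwards [hC] with x hx
    refine Eventually.of_forall fun θ hθ => hx θ ?_
    rw [uIoc_of_le hab] at hθ
    exact Ioc_subset_Icc_self hθ
  · exact intervalIntegrable_const
  · refine Eventually.of_forall fun θ hθ => ?_
    rw [uIoc_of_le hab] at hθ
    exact ContinuousAt.comp (f := fun x => (x, θ))
      (hF θ (Ioc_subset_Icc_self hθ)).self_of_nhds (by fun_prop)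

theorem hasFDerivAt_integral_param {E G : Type*} [NormedAddCommGroup E] [NormedSpace ℝ E]
    [NormedAddCommGroup G] [NormedSpace ℝ G] {F : E × ℝ → G} {x₀ : E} {a b : ℝ} (hab : a ≤ b)
    (hF : ∀ θ ∈ Icc a b, ContDiffAt ℝ 1 F (x₀, θ)) :
    HasFDerivAt (fun x => ∫ θ in a..b, F (x, θ))
      (∫ θ in a..b, (fderiv ℝ F (x₀, θ)).comp (ContinuousLinearMap.inl ℝ E ℝ)) x₀ := by
  have hev : ∀ θ ∈ Icc a b, ∀ᶠ p in 𝓝 (x₀, θ), ContDiffAt ℝ 1 F p := fun θ hθ =>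
    (hF θ hθ).eventually (by simp)
  have hcont : ∀ p, ContDiffAt ℝ 1 F p →
      ContinuousAt (fun p => (fderiv ℝ F p).comp (ContinuousLinearMap.inl ℝ E ℝ)) p := by
    intro p hp
    have : ContinuousAt (fderiv ℝ F) p := (hp.fderiv_right (m := 0) (by simp)).continuousAt
    fun_prop
  obtain ⟨C, hC⟩ := exists_norm_bound_Icc fun θ hθ => hcont _ (hF θ hθ)
  have h1 := eventually_forall_Icc hev
  have hsub : ∀ {θ : ℝ}, θ ∈ uIoc a b → θ ∈ Icc a b := fun hθ => by
    rw [uIoc_of_le hab] at hθ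
    exact Ioc_subset_Icc_self hθ
  refine intervalIntegral.hasFDerivAt_integral_of_dominated_of_fderiv_le
    (F' := fun x θ => (fderiv ℝ F (x, θ)).comp (ContinuousLinearMap.inl ℝ E ℝ))
    (bound := fun _ => C) (hC.and h1) ?_ ?_ ?_ ?_ intervalIntegrable_const ?_
  · filter_upwards [h1] with x hx
    rw [uIoc_of_le hab]
    exact ((continuousOn_slice fun θ hθ => (hx θ hθ).continuousAt).mono
      Ioc_subset_Icc_self).aestronglyMeasurable measurableSet_Ioc
  · exact (continuousOn_slice fun θ hθ => (hF θ hθ).continuousAt).intervalIntegrable_of_Icc hab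
  · rw [uIoc_of_le hab]
    exact ((continuousOn_slice fun θ hθ => hcont _ (hF θ hθ)).mono
      Ioc_subset_Icc_self).aestronglyMeasurable measurableSet_Ioc
  · exact Eventually.of_forall fun θ hθ x hx => hx.1 θ (hsub hθ)
  · refine Eventually.of_forall fun θ hθ x hx => ?_
    have h2 : HasFDerivAt F (fderiv ℝ F (x, θ)) (x, θ) :=
      ((hx.2 θ (hsub hθ)).differentiableAt (by simp)).hasFDerivAt
    exact h2.comp x (hasFDerivAt_prodMk_left x θ)

/-- Differentiation under the integral and induction on the order. The codomain is quantified inside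
the induction because the derivative takes values in `E →L[ℝ] G`; both spaces lie in `Type` so that
this space does too. -/
theorem contDiffAt_integral_param {E : Type} [NormedAddCommGroup E] [NormedSpace ℝ E] (n : ℕ) :
    ∀ {G : Type} [NormedAddCommGroup G] [NormedSpace ℝ G] {F : E × ℝ → G} {x₀ : E} {a b : ℝ},
      a ≤ b → (∀ θ ∈ Icc a b, ContDiffAt ℝ n F (x₀, θ)) →
      ContDiffAt ℝ n (fun x => ∫ θ in a..b, F (x, θ)) x₀ := by
  induction n with
  | zero =>
    intro G _ _ F x₀ a b hab hF
    have hev : ∀ θ ∈ Icc a b, ∀ᶠ p in 𝓝 (x₀, θ), ∀ᶠ p' in 𝓝 p, ContinuousAt F p' := by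
      intro θ hθ
      have h2 : ∀ᶠ p in 𝓝 (x₀, θ), ContDiffAt ℝ (0 : ℕ) F p :=
        (hF θ hθ).eventually (by simp)
      exact (h2.mono fun p hp => hp.continuousAt).eventually_nhds
    refine contDiffAt_zero.2 ⟨_, eventually_forall_Icc hev, fun x hx => ?_⟩
    exact (continuousAt_integral_param hab hx).continuousWithinAt
  | succ n ih =>
    intro G _ _ F x₀ a b hab hF
    have hev := eventually_forall_Icc fun θ hθ =>
      (hF θ hθ).eventually (by simp)
    push_cast
    refine contDiffAt_succ_iff_hasFDerivAt.2
      ⟨fun x => ∫ θ in a..b, (fderiv ℝ F (x, θ)).comp (ContinuousLinearMap.inl ℝ E ℝ),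
        ⟨_, hev, fun x hx => hasFDerivAt_integral_param hab fun θ hθ =>
          (hx θ hθ).of_le (by norm_cast; omega)⟩, ?_⟩
    refine ih (F := fun p => (fderiv ℝ F p).comp (ContinuousLinearMap.inl ℝ E ℝ)) hab
      fun θ hθ => ?_
    have h3 : ContDiffAt ℝ n (fderiv ℝ F) (x₀, θ) := (hF θ hθ).fderiv_right (by norm_cast)
    exact h3.clm_comp contDiffAt_const

theorem hasDerivAt_integral_param {F : ℝ × ℝ → ℝ} {x₀ a b : ℝ} {F' : ℝ → ℝ} (hab : a ≤ b)
    (hF : ∀ θ ∈ Icc a b, ContDiffAt ℝ 1 F (x₀, θ))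
    (hF' : ∀ θ ∈ Icc a b, HasDerivAt (fun x => F (x, θ)) (F' θ) x₀) :
    HasDerivAt (fun x => ∫ θ in a..b, F (x, θ)) (∫ θ in a..b, F' θ) x₀ := by
  have h := (hasFDerivAt_integral_param hab hF).hasDerivAt
  suffices hs : ∫ θ in a..b, F' θ =
      (∫ θ in a..b, (fderiv ℝ F (x₀, θ)).comp (ContinuousLinearMap.inl ℝ ℝ ℝ)) 1 by
    rw [hs]
    exact h
  rw [ContinuousLinearMap.intervalIntegral_apply]
  · refine intervalIntegral.integral_congr fun θ hθ => ?_
    rw [uIcc_of_le hab] at hθ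
    have h2 : HasFDerivAt F (fderiv ℝ F (x₀, θ)) (x₀, θ) :=
      ((hF θ hθ).differentiableAt (by simp)).hasFDerivAt
    have h3 := (h2.comp x₀ (hasFDerivAt_prodMk_left x₀ θ)).hasDerivAt
    exact (hF' θ hθ).unique h3
  · refine ContinuousOn.intervalIntegrable_of_Icc hab ?_
    refine continuousOn_slice (F := fun p => (fderiv ℝ F p).comp (ContinuousLinearMap.inl ℝ ℝ ℝ))
      fun θ hθ => ?_
    have : ContinuousAt (fderiv ℝ F) (x₀, θ) :=
      ((hF θ hθ).fderiv_right (m := 0) (by simp)).continuousAt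
    fun_prop

/-! ### Changes of variables -/

/-- Change of variables on open intervals, without integrability assumptions. -/
theorem integral_Ioo_eq_integral_Ioo {a b c d : ℝ} (φ φ' : ℝ → ℝ)
    (himg : φ '' Ioo a b = Ioo c d) (hφ : ∀ x ∈ Ioo a b, HasDerivAt φ (φ' x) x)
    (hinj : InjOn φ (Ioo a b)) (hab : a ≤ b) (hcd : c ≤ d) (g k : ℝ → ℝ)
    (hk : ∀ x ∈ Ioo a b, |φ' x| * g (φ x) = k x) :
    ∫ y in c..d, g y = ∫ x in a..b, k x := by
  rw [intervalIntegral.integral_of_le hcd, intervalIntegral.integral_of_le hab,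
    integral_Ioc_eq_integral_Ioo, integral_Ioc_eq_integral_Ioo, ← himg,
    integral_image_eq_integral_abs_deriv_smul measurableSet_Ioo
      (fun x hx => (hφ x hx).hasDerivWithinAt) hinj]
  exact setIntegral_congr_fun measurableSet_Ioo fun x hx => by simpa using hk x hx

theorem image_Ioo_of_strictMonoOn {φ : ℝ → ℝ} {a b : ℝ} (hab : a ≤ b)
    (hc : ContinuousOn φ (Icc a b)) (hm : StrictMonoOn φ (Icc a b)) :
    φ '' Ioo a b = Ioo (φ a) (φ b) := by
  apply Subset.antisymm
  · rintro _ ⟨x, hx, rfl⟩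
    exact ⟨hm (left_mem_Icc.2 hab) (Ioo_subset_Icc_self hx) hx.1,
      hm (Ioo_subset_Icc_self hx) (right_mem_Icc.2 hab) hx.2⟩
  · exact intermediate_value_Ioo hab hc

theorem image_Ioo_of_strictAntiOn {φ : ℝ → ℝ} {a b : ℝ} (hab : a ≤ b)
    (hc : ContinuousOn φ (Icc a b)) (hm : StrictAntiOn φ (Icc a b)) :
    φ '' Ioo a b = Ioo (φ b) (φ a) := by
  apply Subset.antisymm
  · rintro _ ⟨x, hx, rfl⟩
    exact ⟨hm (Ioo_subset_Icc_self hx) (right_mem_Icc.2 hab) hx.2,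
      hm (left_mem_Icc.2 hab) (Ioo_subset_Icc_self hx) hx.1⟩
  · exact intermediate_value_Ioo' hab hc

/-- Decreasing change of variables. -/
theorem integral_eq_of_antitone_substitution {a b c d : ℝ} (φ φ' : ℝ → ℝ) (hab : a ≤ b)
    (ha : φ a = d) (hb : φ b = c) (hc : ContinuousOn φ (Icc a b))
    (hφ : ∀ x ∈ Ioo a b, HasDerivAt φ (φ' x) x) (hneg : ∀ x ∈ Ioo a b, φ' x < 0)
    (g k : ℝ → ℝ) (hk : ∀ x ∈ Ioo a b, -φ' x * g (φ x) = k x) :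
    ∫ y in c..d, g y = ∫ x in a..b, k x := by
  have hanti : StrictAntiOn φ (Icc a b) := by
    refine strictAntiOn_of_deriv_neg (convex_Icc a b) hc fun x hx => ?_
    rw [interior_Icc] at hx
    rw [(hφ x hx).deriv]
    exact hneg x hx
  have hcd : c ≤ d := by
    rw [← ha, ← hb]
    exact hanti.antitoneOn (left_mem_Icc.2 hab) (right_mem_Icc.2 hab) hab
  refine integral_Ioo_eq_integral_Ioo φ φ' ?_ hφ (hanti.injOn.mono Ioo_subset_Icc_self) hab hcd
    g k fun x hx => ?_
  · rw [image_Ioo_of_strictAntiOn hab hc hanti, ha, hb]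
  · rw [abs_of_neg (hneg x hx), hk x hx]

/-! ### Elliptic periods as averages over the circle -/

/-- The average of `F a (m + δ cos θ)` over `θ`. -/
def cosMean (F : ℝ × ℝ → ℝ) (a m δ : ℝ) : ℝ :=
  1 / Real.pi * ∫ θ in (0 : ℝ)..Real.pi, F (a, m + δ * Real.cos θ)

def center (β : Fin 3 → ℝ) : ℝ := (β 1 + β 2) / 2

def halfGap (β : Fin 3 → ℝ) : ℝ := (β 1 - β 2) / 2

/-- The density whose average is the wave length `1 / k`. -/
def lengthDensity (ν : ℝ) (p : ℝ × ℝ) : ℝ := √((p.2 + ν) / (p.1 - p.2))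

/-- The density whose average is `I₀ / 2π`. -/
def periodDensity (ν : ℝ) (p : ℝ × ℝ) : ℝ := 1 / √((p.2 + ν) * (p.1 - p.2))

/-- The ordering `-ν < β₃ < β₂ < β₁` of the branch points. -/
def Ordered (ν : ℝ) (β : Fin 3 → ℝ) : Prop := -ν < β 2 ∧ β 2 < β 1 ∧ β 1 < β 0

/-- The substitution is z² = b(ξ - c)/((b - c)ξ) with ξ = (b+c)/2 + (b-c)/2 · cos θ, which carries
[0, 1] to the gap [c, b]. Under it 1 - (b-c)z²/b = c/ξ, the factor by which the third-kind integral
differs from the first-kind one; the free `H` serves both. -/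
theorem elliptic_substitution {A b c : ℝ} (hc : 0 < c) (hcb : c < b) (hbA : b < A) (H : ℝ → ℝ) :
    ∫ z in (0 : ℝ)..1, H (1 / (1 - (b - c) / b * z ^ 2)) /
        √((1 - z ^ 2) * (1 - A * (b - c) / (b * (A - c)) * z ^ 2)) =
      √(b * (A - c)) / 2 * ∫ θ in (0 : ℝ)..Real.pi,
        H (((b + c) / 2 + (b - c) / 2 * Real.cos θ) / c) /
          √(((b + c) / 2 + (b - c) / 2 * Real.cos θ) *
            (A - ((b + c) / 2 + (b - c) / 2 * Real.cos θ))) := by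
  have hb : 0 < b := hc.trans hcb
  set ξ : ℝ → ℝ := fun θ => (b + c) / 2 + (b - c) / 2 * Real.cos θ with hξ
  have hξpos : ∀ θ, c ≤ ξ θ := fun θ => by
    have := Real.neg_one_le_cos θ
    simp only [hξ]
    nlinarith
  have hξle : ∀ θ, ξ θ ≤ b := fun θ => by
    have := Real.cos_le_one θ
    simp only [hξ]
    nlinarith
  have hξd : ∀ θ, HasDerivAt ξ ((b - c) / 2 * -Real.sin θ) θ := fun θ =>
    ((Real.hasDerivAt_cos θ).const_mul _).const_add _
  have hhalf : ∀ θ, ξ θ = b * Real.cos (θ / 2) ^ 2 + c * Real.sin (θ / 2) ^ 2 := fun θ => by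
    have h1 : Real.cos θ = 2 * Real.cos (θ / 2) ^ 2 - 1 := by
      rw [← Real.cos_two_mul]
      ring_nf
    have h2 := Real.sin_sq_add_cos_sq (θ / 2)
    simp only [hξ, h1]
    linear_combination (-c) * h2
  rw [← intervalIntegral.integral_const_mul]
  refine integral_eq_of_antitone_substitution
    (fun θ => √b * Real.cos (θ / 2) / √(ξ θ))
    (fun θ => -(√b * c * Real.sin (θ / 2) / (2 * ξ θ * √(ξ θ)))) Real.pi_pos.le ?_ ?_ ?_ ?_ ?_ _ _ ?_
  · have : ξ 0 = b := by simp [hξ]; ring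
    have hsb : √b ≠ 0 := (Real.sqrt_pos.2 hb).ne'
    simp [this, hsb]
  · simp
  · have hc' : ∀ θ, √(ξ θ) ≠ 0 := fun θ => (Real.sqrt_pos.2 (hc.trans_le (hξpos θ))).ne'
    have : Continuous ξ := by fun_prop
    exact (Continuous.div (by fun_prop) (by fun_prop) hc').continuousOn
  · intro θ _
    have hp : 0 < ξ θ := hc.trans_le (hξpos θ)
    have hs : 0 < √(ξ θ) := Real.sqrt_pos.2 hp
    have h1 : HasDerivAt (fun θ => √b * Real.cos (θ / 2))
        (√b * (-Real.sin (θ / 2) * (1 / 2))) θ :=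
      ((Real.hasDerivAt_cos (θ / 2)).comp θ ((hasDerivAt_id θ).div_const 2)).const_mul _
    have h2 := h1.div ((hξd θ).sqrt hp.ne') hs.ne'
    refine h2.congr_deriv ?_
    have h3 : Real.sin θ = 2 * Real.sin (θ / 2) * Real.cos (θ / 2) := by
      rw [← Real.sin_two_mul]
      ring_nf
    have h4 : ξ θ = √(ξ θ) ^ 2 := (Real.sq_sqrt hp.le).symm
    have h5 := hhalf θ
    have h6 := Real.sin_sq_add_cos_sq (θ / 2)
    rw [h3]
    field_simp
    rw [Real.sq_sqrt hp.le, h5]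
    linear_combination (-c * Real.sin (θ / 2) *
      (b * Real.cos (θ / 2) ^ 2 + c * Real.sin (θ / 2) ^ 2)) * h6
  · intro θ hθ
    have hp : 0 < ξ θ := hc.trans_le (hξpos θ)
    have hsin : 0 < Real.sin (θ / 2) :=
      Real.sin_pos_of_pos_of_lt_pi (by linarith [hθ.1]) (by linarith [hθ.2, Real.pi_pos])
    have : 0 < √b * c * Real.sin (θ / 2) / (2 * ξ θ * √(ξ θ)) := by positivity
    linarith
  · intro θ hθ
    have hp : 0 < ξ θ := hc.trans_le (hξpos θ)
    have hA : 0 < A - ξ θ := by linarith [hξle θ]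
    have hAc : 0 < A - c := by linarith
    have hsin : 0 < Real.sin (θ / 2) :=
      Real.sin_pos_of_pos_of_lt_pi (by linarith [hθ.1]) (by linarith [hθ.2, Real.pi_pos])
    have h6 := Real.sin_sq_add_cos_sq (θ / 2)
    have h5 := hhalf θ
    have hz : (√b * Real.cos (θ / 2) / √(ξ θ)) ^ 2 = b * Real.cos (θ / 2) ^ 2 / ξ θ := by
      rw [div_pow, mul_pow, Real.sq_sqrt hb.le, Real.sq_sqrt hp.le]
    have e1 : 1 - (b - c) / b * (b * Real.cos (θ / 2) ^ 2 / ξ θ) = c / ξ θ := by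
      field_simp
      rw [h5]
      linear_combination c * h6
    have e2 : (1 - b * Real.cos (θ / 2) ^ 2 / ξ θ) *
        (1 - A * (b - c) / (b * (A - c)) * (b * Real.cos (θ / 2) ^ 2 / ξ θ)) =
        (c * Real.sin (θ / 2) / ξ θ) ^ 2 * ((A - ξ θ) / (A - c)) := by
      have e3 : 1 - b * Real.cos (θ / 2) ^ 2 / ξ θ = c * Real.sin (θ / 2) ^ 2 / ξ θ := by
        field_simp
        rw [h5]
        ring
      have e4 : 1 - A * (b - c) / (b * (A - c)) * (b * Real.cos (θ / 2) ^ 2 / ξ θ) =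
          c * (A - ξ θ) / (ξ θ * (A - c)) := by
        field_simp
        rw [h5]
        linear_combination (A * c) * h6
      rw [e3, e4]
      field_simp
    have e5 : √((c * Real.sin (θ / 2) / ξ θ) ^ 2 * ((A - ξ θ) / (A - c))) =
        c * Real.sin (θ / 2) / ξ θ * (√(A - ξ θ) / √(A - c)) := by
      rw [Real.sqrt_mul (by positivity), Real.sqrt_sq (by positivity), Real.sqrt_div hA.le]
    simp only [neg_neg]
    change _ = √(b * (A - c)) / 2 * (H (ξ θ / c) / √(ξ θ * (A - ξ θ)))
    rw [hz, e1, e2, e5, Real.sqrt_mul hb.le, Real.sqrt_mul hp.le]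
    have : (1 : ℝ) / (c / ξ θ) = ξ θ / c := by field_simp
    rw [this]
    have h7 : 0 < √(ξ θ) := Real.sqrt_pos.2 hp
    have h8 : 0 < √(A - ξ θ) := Real.sqrt_pos.2 hA
    have h9 : 0 < √(A - c) := Real.sqrt_pos.2 hAc
    field_simp

section Periods
variable {ν : ℝ} {β : Fin 3 → ℝ}

theorem modulus_sq (h : Ordered ν β) : modulus ν β ^ 2 =
    (β 0 + ν) * ((β 1 + ν) - (β 2 + ν)) / ((β 1 + ν) * ((β 0 + ν) - (β 2 + ν))) := by
  obtain ⟨h1, h2, h3⟩ := h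
  have : 0 ≤ ((β 0 + ν) * (β 1 - β 2)) / ((β 1 + ν) * (β 0 - β 2)) :=
    div_nonneg (mul_nonneg (by linarith) (by linarith)) (mul_nonneg (by linarith) (by linarith))
  rw [modulus, Real.sq_sqrt this]
  ring_nf

theorem ellipticK_eq_cosMean (h : Ordered ν β) :
    ellipticK (modulus ν β) = Real.pi * √((β 1 + ν) * (β 0 - β 2)) / 2 *
      cosMean (periodDensity ν) (β 0) (center β) (halfGap β) := by
  have hs := elliptic_substitution (c := β 2 + ν) (b := β 1 + ν) (A := β 0 + ν)
    (by linarith [h.1]) (by linarith [h.2.1]) (by linarith [h.2.2]) (fun _ => 1)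
  rw [← modulus_sq h] at hs
  rw [ellipticK, hs, cosMean]
  have hpi := Real.pi_ne_zero
  have e : ∀ θ, (1 : ℝ) / √(((β 1 + ν + (β 2 + ν)) / 2 + (β 1 + ν - (β 2 + ν)) / 2 * Real.cos θ) *
      (β 0 + ν - ((β 1 + ν + (β 2 + ν)) / 2 + (β 1 + ν - (β 2 + ν)) / 2 * Real.cos θ))) =
      periodDensity ν (β 0, center β + halfGap β * Real.cos θ) := fun θ => by
    simp only [periodDensity, center, halfGap]
    ring_nf
  simp only [e]
  rw [show β 0 + ν - (β 2 + ν) = β 0 - β 2 by ring]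
  field_simp

/-- Here `H` is the identity: the extra factor ξ turns the period density into the length density.
The prefactor equals the one for K, so it drops out of Λ/K. -/
theorem ellipticLambda_eq_cosMean (h : Ordered ν β) :
    (β 2 + ν) * ellipticLambda (modulus ν β) (rho ν β) =
      Real.pi * √((β 1 + ν) * (β 0 - β 2)) / 2 *
      cosMean (lengthDensity ν) (β 0) (center β) (halfGap β) := by
  have hc : 0 < β 2 + ν := by linarith [h.1]
  have hcb : β 2 < β 1 := h.2.1
  have hba : β 1 < β 0 := h.2.2
  have hs := elliptic_substitution (c := β 2 + ν) (b := β 1 + ν) (A := β 0 + ν)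
    hc (by linarith) (by linarith) (fun y => y)
  rw [← modulus_sq h] at hs
  rw [ellipticLambda, cosMean]
  have e0 : ∀ z : ℝ, 1 / ((1 - rho ν β * z ^ 2) *
      √((1 - z ^ 2) * (1 - modulus ν β ^ 2 * z ^ 2))) =
      (1 / (1 - (β 1 + ν - (β 2 + ν)) / (β 1 + ν) * z ^ 2)) /
      √((1 - z ^ 2) * (1 - modulus ν β ^ 2 * z ^ 2)) := fun z => by
    rw [rho, show β 1 + ν - (β 2 + ν) = β 1 - β 2 by ring, div_div]
  simp only [e0]
  rw [hs]
  have hpi := Real.pi_ne_zero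
  have e : ∀ θ, ((β 1 + ν + (β 2 + ν)) / 2 + (β 1 + ν - (β 2 + ν)) / 2 * Real.cos θ) / (β 2 + ν) /
      √(((β 1 + ν + (β 2 + ν)) / 2 + (β 1 + ν - (β 2 + ν)) / 2 * Real.cos θ) *
      (β 0 + ν - ((β 1 + ν + (β 2 + ν)) / 2 + (β 1 + ν - (β 2 + ν)) / 2 * Real.cos θ))) =
      1 / (β 2 + ν) * lengthDensity ν (β 0, center β + halfGap β * Real.cos θ) := fun θ => by
    have h1 := Real.neg_one_le_cos θ
    have h2 := Real.cos_le_one θ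
    set y := (β 1 + ν + (β 2 + ν)) / 2 + (β 1 + ν - (β 2 + ν)) / 2 * Real.cos θ with hy
    have hy1 : 0 < y := by rw [hy]; nlinarith
    have hy2 : 0 < β 0 + ν - y := by rw [hy]; nlinarith
    have e1 : center β + halfGap β * Real.cos θ + ν = y := by
      simp only [center, halfGap, hy]
      ring
    have e2 : β 0 - (center β + halfGap β * Real.cos θ) = β 0 + ν - y := by
      simp only [center, halfGap, hy]
      ring
    simp only [lengthDensity, e1, e2]
    rw [Real.sqrt_mul hy1.le, Real.sqrt_div hy1.le]
    have h3 : 0 < √y := Real.sqrt_pos.2 hy1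
    have h4 : 0 < √(β 0 + ν - y) := Real.sqrt_pos.2 hy2
    field_simp
    exact (Real.sq_sqrt hy1.le).symm
  simp only [e]
  rw [show β 0 + ν - (β 2 + ν) = β 0 - β 2 by ring, intervalIntegral.integral_const_mul]
  field_simp

theorem waveNumber_eq (h : Ordered ν β) : waveNumber ν β =
    1 / cosMean (lengthDensity ν) (β 0) (center β) (halfGap β) := by
  have h1 : 0 < √((β 1 + ν) * (β 0 - β 2)) :=
    Real.sqrt_pos.2 (mul_pos (by linarith [h.1, h.2.1]) (by linarith [h.2.1, h.2.2]))
  rw [waveNumber, show 2 * (β 2 + ν) * ellipticLambda (modulus ν β) (rho ν β) =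
    2 * ((β 2 + ν) * ellipticLambda (modulus ν β) (rho ν β)) by ring, ellipticLambda_eq_cosMean h]
  have hpi := Real.pi_ne_zero
  field_simp

theorem periodI0_eq (h : Ordered ν β) : periodI0 ν β =
    2 * Real.pi * cosMean (periodDensity ν) (β 0) (center β) (halfGap β) := by
  have h1 : 0 < √((β 1 + ν) * (β 0 - β 2)) :=
    Real.sqrt_pos.2 (mul_pos (by linarith [h.1, h.2.1]) (by linarith [h.2.1, h.2.2]))
  rw [periodI0, ellipticK_eq_cosMean h]
  field_simp
  ring

theorem lambda_div_K_eq (h : Ordered ν β) :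
    (β 2 + ν) * (ellipticLambda (modulus ν β) (rho ν β) / ellipticK (modulus ν β)) =
      cosMean (lengthDensity ν) (β 0) (center β) (halfGap β) /
        cosMean (periodDensity ν) (β 0) (center β) (halfGap β) := by
  have h1 : 0 < √((β 1 + ν) * (β 0 - β 2)) :=
    Real.sqrt_pos.2 (mul_pos (by linarith [h.1, h.2.1]) (by linarith [h.2.1, h.2.2]))
  rw [← mul_div_assoc, ellipticLambda_eq_cosMean h, ellipticK_eq_cosMean h]
  exact mul_div_mul_left _ _ (by have := Real.pi_pos; positivity)

end Periods

/-! ### The phase shift as an average -/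

theorem integral_div_sqrt_one_sub_sq (F : ℝ → ℝ) :
    ∫ l in (-1 : ℝ)..1, F l / √(1 - l ^ 2) = ∫ θ in (0 : ℝ)..Real.pi, F (Real.cos θ) := by
  refine integral_eq_of_antitone_substitution Real.cos (fun θ => -Real.sin θ) Real.pi_pos.le
    Real.cos_zero Real.cos_pi Real.continuous_cos.continuousOn
    (fun θ _ => Real.hasDerivAt_cos θ)
    (fun θ hθ => by linarith [Real.sin_pos_of_pos_of_lt_pi hθ.1 hθ.2]) _ _ fun θ hθ => ?_
  have hs := Real.sin_pos_of_pos_of_lt_pi hθ.1 hθ.2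
  rw [← Real.sin_sq, Real.sqrt_sq hs.le]
  field_simp

/-- Setting μ = 1 - 2w² absorbs the endpoint singularity. -/
theorem integral_div_sqrt_one_sub (F : ℝ → ℝ) :
    ∫ l in (-1 : ℝ)..1, F l / √(1 - l) = 2 * √2 * ∫ w in (0 : ℝ)..1, F (1 - 2 * w ^ 2) := by
  rw [← intervalIntegral.integral_const_mul]
  refine integral_eq_of_antitone_substitution (fun w => 1 - 2 * w ^ 2) (fun w => -(4 * w))
    zero_le_one (by norm_num) (by norm_num) (by fun_prop) (fun w _ => ?_)
    (fun w hw => by linarith [hw.1]) _ _ fun w hw => ?_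
  · refine (((hasDerivAt_id w).pow 2).const_mul 2).const_sub 1 |>.congr_deriv ?_
    simp
    ring
  · have h2 : (0 : ℝ) < √2 := by positivity
    have h3 := Real.sq_sqrt (zero_le_two (α := ℝ))
    have hw0 : 0 < w := hw.1
    rw [show 1 - (1 - 2 * w ^ 2) = 2 * w ^ 2 by ring, Real.sqrt_mul zero_le_two,
      Real.sqrt_sq hw0.le]
    generalize F (1 - 2 * w ^ 2) = y
    field_simp
    linear_combination (-2 * y) * h3

/-- The weight-free form of Q, from which both its smoothness and `QPair_identity` are read off. -/
theorem QFun_eq_integral (f : ℝ → ℝ) (a b : ℝ) :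
    QFun f a b = ∫ w in (0 : ℝ)..1, f (b + w ^ 2 * (a - b)) := by
  rw [QFun, integral_div_sqrt_one_sub
    (fun μ => f ((1 + μ) / 2 * b + (1 - μ) / 2 * a)), ← mul_assoc]
  have h3 := Real.sq_sqrt (zero_le_two (α := ℝ))
  rw [show √2 / 4 * (2 * √2) = √2 ^ 2 / 2 by ring, h3]
  norm_num
  refine intervalIntegral.integral_congr fun w _ => ?_
  ring_nf

theorem segment_mem_Icc {c d a b w : ℝ} (ha : a ∈ Icc c d) (hb : b ∈ Icc c d)
    (hw : w ∈ Icc (0 : ℝ) 1) : b + w ^ 2 * (a - b) ∈ Icc c d := by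
  have hw2 : w ^ 2 ≤ 1 := by nlinarith [hw.1, hw.2]
  have hw0 : 0 ≤ w ^ 2 := sq_nonneg w
  have := ha.1; have := ha.2; have := hb.1; have := hb.2
  constructor <;> nlinarith

theorem center_add_mem_Icc {β : Fin 3 → ℝ} {c d : ℝ} (h1 : β 1 ∈ Icc c d) (h2 : β 2 ∈ Icc c d)
    (θ : ℝ) : center β + halfGap β * Real.cos θ ∈ Icc c d := by
  have := Real.neg_one_le_cos θ
  have := Real.cos_le_one θ
  have := h1.1; have := h1.2; have := h2.1; have := h2.2
  simp only [center, halfGap]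
  constructor <;> nlinarith

theorem qShift_eq_cosMean {f : ℝ → ℝ} {β : Fin 3 → ℝ} {c d : ℝ} (hf : ContinuousOn f (Icc c d))
    (h0 : β 0 ∈ Icc c d) (h1 : β 1 ∈ Icc c d) (h2 : β 2 ∈ Icc c d) :
    qShift f β = cosMean (fun p => QFun f p.1 p.2) (β 0) (center β) (halfGap β) := by
  have e1 : ∀ μ : ℝ, (∫ l in (-1 : ℝ)..1,
      f ((1 + μ) / 2 * ((1 + l) / 2 * β 2 + (1 - l) / 2 * β 1) + (1 - μ) / 2 * β 0) /
        (√(1 - μ) * √(1 - l ^ 2))) = (∫ θ in (0 : ℝ)..Real.pi,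
      f ((1 + μ) / 2 * (center β + halfGap β * Real.cos θ) + (1 - μ) / 2 * β 0)) / √(1 - μ) := by
    intro μ
    -- The reflection θ ↦ π - θ is needed because λ = 1 corresponds to β₃ but cos θ = 1 to β₂.
    have hflip := intervalIntegral.integral_comp_sub_left (a := 0) (b := Real.pi) (fun θ =>
      f ((1 + μ) / 2 * (center β + halfGap β * Real.cos θ) + (1 - μ) / 2 * β 0)) Real.pi
    rw [sub_zero, sub_self] at hflip
    rw [← hflip, ← intervalIntegral.integral_div]
    have := integral_div_sqrt_one_sub_sq (fun l =>
      f ((1 + μ) / 2 * ((1 + l) / 2 * β 2 + (1 - l) / 2 * β 1) + (1 - μ) / 2 * β 0) / √(1 - μ))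
    simp only [div_div] at this ⊢
    rw [this]
    refine intervalIntegral.integral_congr fun θ _ => ?_
    simp only [Real.cos_pi_sub, center, halfGap]
    ring_nf
  rw [qShift]
  simp only [e1]
  rw [integral_div_sqrt_one_sub (fun μ => ∫ θ in (0 : ℝ)..Real.pi,
      f ((1 + μ) / 2 * (center β + halfGap β * Real.cos θ) + (1 - μ) / 2 * β 0))]
  simp only [cosMean, QFun_eq_integral]
  have e2 : ∀ w θ : ℝ, (1 + (1 - 2 * w ^ 2)) / 2 * (center β + halfGap β * Real.cos θ) +
      (1 - (1 - 2 * w ^ 2)) / 2 * β 0 = (center β + halfGap β * Real.cos θ) +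
        w ^ 2 * (β 0 - (center β + halfGap β * Real.cos θ)) := fun w θ => by ring
  simp only [e2]
  have h22 : (0 : ℝ) < √2 := by positivity
  rw [← mul_assoc]
  congr 1
  · field_simp
  · simp only [intervalIntegral.integral_of_le Real.pi_pos.le,
      intervalIntegral.integral_of_le (zero_le_one (α := ℝ))]
    -- After the substitutions the integrand is continuous on a compact rectangle, so Fubini
    -- applies.
    refine integral_integral_swap ?_
    rw [Measure.prod_restrict]
    refine IntegrableOn.mono_set (t := Icc 0 1 ×ˢ Icc 0 Real.pi) ?_
      (prod_mono Ioc_subset_Icc_self Ioc_subset_Icc_self)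
    refine ContinuousOn.integrableOn_compact (isCompact_Icc.prod isCompact_Icc) ?_
    refine hf.comp (by fun_prop) fun p hp => ?_
    exact segment_mem_Icc h0 (center_add_mem_Icc h1 h2 _) hp.1

/-! ### Smoothness of the inverse of the initial datum -/

/-- Since u₀ → 0 at -∞, the value y is attained at some x < xM, where the slope is negative. The
inverse function theorem gives a smooth local inverse, and `fMinus` coincides with it near y because
it inverts u₀ to the left of xM. -/
theorem contDiffAt_fMinus {u₀ : SchwartzMap ℝ ℝ} {xM : ℝ} (h : IsSingleNegativeHump u₀ xM)
    {y : ℝ} (hy : y ∈ Ioo (u₀ xM) 0) : ContDiffAt ℝ ∞ (fMinus u₀ xM) y := by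
  have hlim : Tendsto u₀ atBot (𝓝 0) := (zero_at_infty u₀).mono_left atBot_le_cocompact
  obtain ⟨x₁, hx₁, hx₁M⟩ := ((hlim.eventually (lt_mem_nhds hy.2)).and
    (eventually_le_atBot xM)).exists
  obtain ⟨x, hx, rfl⟩ := intermediate_value_Ioo' hx₁M u₀.continuous.continuousOn ⟨hy.1, hx₁⟩
  have hd : HasDerivAt u₀ (deriv u₀ x) x := u₀.differentiable.differentiableAt.hasDerivAt
  have hne : deriv u₀ x ≠ 0 := (h.deriv_neg x hx.2).ne
  have hs : ContDiffAt ℝ ∞ u₀ x := u₀.smooth'.contDiffAt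
  have hd' := hd.hasFDerivAt_equiv hne
  have hinv := hs.to_localInverse hd' (by simp)
  have huniq := (hs.hasStrictFDerivAt' hd' (by simp)).localInverse_unique
    (g := fMinus u₀ xM) ((eventually_lt_nhds hx.2).mono fun z hz => fMinus_apply h hz.le)
  exact hinv.congr_of_eventuallyEq (huniq.mono fun z hz => hz)

/-! ### Partial derivatives of smooth functions of two variables -/

def partialA (F : ℝ × ℝ → ℝ) (p : ℝ × ℝ) : ℝ := fderiv ℝ F p (1, 0)

def partialB (F : ℝ × ℝ → ℝ) (p : ℝ × ℝ) : ℝ := fderiv ℝ F p (0, 1)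

/-- Pointwise `ContDiffAt` of order ∞ allows the neighbourhood to shrink with the order of
differentiation, so a common neighbourhood is built in. -/
def SmoothNear (F : ℝ × ℝ → ℝ) (p : ℝ × ℝ) : Prop := ∀ᶠ q in 𝓝 p, ContDiffAt ℝ ∞ F q

theorem _root_.ContDiffAt.partialA {F : ℝ × ℝ → ℝ} {p : ℝ × ℝ} (h : ContDiffAt ℝ ∞ F p) :
    ContDiffAt ℝ ∞ (partialA F) p :=
  (h.fderiv_right (m := ∞) (by simp)).clm_apply contDiffAt_const

theorem _root_.ContDiffAt.partialB {F : ℝ × ℝ → ℝ} {p : ℝ × ℝ} (h : ContDiffAt ℝ ∞ F p) :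
    ContDiffAt ℝ ∞ (partialB F) p :=
  (h.fderiv_right (m := ∞) (by simp)).clm_apply contDiffAt_const

namespace SmoothNear

variable {F : ℝ × ℝ → ℝ} {p : ℝ × ℝ}

theorem contDiffAt (h : SmoothNear F p) : ContDiffAt ℝ ∞ F p := h.self_of_nhds

theorem partialA (h : SmoothNear F p) : SmoothNear (partialA F) p := h.mono fun _ hq => hq.partialA

theorem partialB (h : SmoothNear F p) : SmoothNear (partialB F) p := h.mono fun _ hq => hq.partialB

theorem continuousAt (h : SmoothNear F p) : ContinuousAt F p := h.contDiffAt.continuousAt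

end SmoothNear

section Partial
variable {F : ℝ × ℝ → ℝ} {p : ℝ × ℝ}

theorem _root_.ContDiffAt.hasFDerivAt_two (h : ContDiffAt ℝ ∞ F p) :
    HasFDerivAt F (fderiv ℝ F p) p := (h.differentiableAt (by simp)).hasFDerivAt

theorem fderiv_apply_eq (F : ℝ × ℝ → ℝ) (p : ℝ × ℝ) (x y : ℝ) :
    fderiv ℝ F p (x, y) = x * partialA F p + y * partialB F p := by
  have : (x, y) = x • ((1, 0) : ℝ × ℝ) + y • ((0, 1) : ℝ × ℝ) := by simp
  rw [this, map_add, map_smul, map_smul]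
  rfl

theorem hasDerivAt_partialA (h : ContDiffAt ℝ ∞ F p) :
    HasDerivAt (fun a => F (a, p.2)) (partialA F p) p.1 := by
  have := h.hasFDerivAt_two.comp_hasDerivAt (f := fun a => (a, p.2)) p.1
    ((hasDerivAt_id p.1).prodMk (hasDerivAt_const p.1 p.2))
  exact this

theorem hasDerivAt_partialB (h : ContDiffAt ℝ ∞ F p) :
    HasDerivAt (fun b => F (p.1, b)) (partialB F p) p.2 := by
  have := h.hasFDerivAt_two.comp_hasDerivAt (f := fun b => (p.1, b)) p.2
    ((hasDerivAt_const p.2 p.1).prodMk (hasDerivAt_id p.2))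
  exact this

theorem partial_comm (h : ContDiffAt ℝ ∞ F p) :
    partialA (partialB F) p = partialB (partialA F) p := by
  have hd : DifferentiableAt ℝ (fderiv ℝ F) p :=
    (h.fderiv_right (m := ∞) (by simp)).differentiableAt (by simp)
  have hsymm := (contDiffAt_infty.1 h 2).isSymmSndFDerivAt (by simp)
  have e : ∀ v w : ℝ × ℝ, fderiv ℝ (fun q => fderiv ℝ F q w) p v =
      fderiv ℝ (fderiv ℝ F) p v w := fun v w => by
    have := hd.hasFDerivAt.clm_apply (hasFDerivAt_const w p)
    rw [this.fderiv]
    simp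
  change fderiv ℝ (fun q => fderiv ℝ F q (0, 1)) p (1, 0) =
    fderiv ℝ (fun q => fderiv ℝ F q (1, 0)) p (0, 1)
  rw [e, e]
  exact hsymm _ _

end Partial

/-! ### The function `Q` -/

section Q
variable {f : ℝ → ℝ} {c d : ℝ}

/-- `Q` as a function of a pair. -/
def QPair (f : ℝ → ℝ) (p : ℝ × ℝ) : ℝ := QFun f p.1 p.2

theorem segment_mem_Ioo {a b w : ℝ} (ha : a ∈ Ioo c d) (hb : b ∈ Ioo c d)
    (hw : w ∈ Icc (0 : ℝ) 1) : b + w ^ 2 * (a - b) ∈ Ioo c d := by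
  have hw2 : w ^ 2 ≤ 1 := by nlinarith [hw.1, hw.2]
  have hw0 : 0 ≤ w ^ 2 := sq_nonneg w
  have := ha.1; have := ha.2; have := hb.1; have := hb.2
  constructor
  · rcases le_total a b with h | h <;> nlinarith
  · rcases le_total a b with h | h <;> nlinarith

theorem contDiffAt_QPair (hf : ∀ y ∈ Ioo c d, ContDiffAt ℝ ∞ f y) {p : ℝ × ℝ}
    (h1 : p.1 ∈ Ioo c d) (h2 : p.2 ∈ Ioo c d) : ContDiffAt ℝ ∞ (QPair f) p := by
  refine contDiffAt_infty.2 fun n => ?_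
  have e : QPair f = fun p => ∫ w in (0 : ℝ)..1,
      (fun q : (ℝ × ℝ) × ℝ => f (q.1.2 + q.2 ^ 2 * (q.1.1 - q.1.2))) (p, w) := by
    funext p
    exact QFun_eq_integral f p.1 p.2
  rw [e]
  refine contDiffAt_integral_param n
    (F := fun q : (ℝ × ℝ) × ℝ => f (q.1.2 + q.2 ^ 2 * (q.1.1 - q.1.2))) zero_le_one
    fun w hw => ?_
  have hfw : ContDiffAt ℝ n f (p.2 + w ^ 2 * (p.1 - p.2)) :=
    (hf _ (segment_mem_Ioo h1 h2 hw)).of_le (by exact_mod_cast le_top)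
  exact ContDiffAt.comp (f := fun q : (ℝ × ℝ) × ℝ => q.1.2 + q.2 ^ 2 * (q.1.1 - q.1.2))
    (p, w) hfw (by fun_prop)

theorem smoothNear_QPair (hf : ∀ y ∈ Ioo c d, ContDiffAt ℝ ∞ f y) {p : ℝ × ℝ}
    (h1 : p.1 ∈ Ioo c d) (h2 : p.2 ∈ Ioo c d) : SmoothNear (QPair f) p := by
  have : Ioo c d ×ˢ Ioo c d ∈ 𝓝 p := (isOpen_Ioo.prod isOpen_Ioo).mem_nhds ⟨h1, h2⟩
  filter_upwards [this] with q hq using contDiffAt_QPair hf hq.1 hq.2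

/-- `Q + 2 (a - b) ∂ₐ Q = f(a)`. -/
theorem QPair_identity (hf : ∀ y ∈ Ioo c d, ContDiffAt ℝ ∞ f y) {p : ℝ × ℝ}
    (h1 : p.1 ∈ Ioo c d) (h2 : p.2 ∈ Ioo c d) :
    QPair f p + 2 * (p.1 - p.2) * partialA (QPair f) p = f p.1 := by
  have hdf : ∀ y ∈ Ioo c d, HasDerivAt f (deriv f y) y := fun y hy =>
    ((hf y hy).differentiableAt (by simp)).hasDerivAt
  have hcont : ∀ y ∈ Ioo c d, ContinuousAt (deriv f) y := fun y hy => by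
    have : ContDiffAt ℝ ∞ (fderiv ℝ f) y := (hf y hy).fderiv_right (m := ∞) (by simp)
    exact (this.clm_apply (contDiffAt_const (c := (1 : ℝ)))).continuousAt
  have hA : partialA (QPair f) p =
      ∫ w in (0 : ℝ)..1, w ^ 2 * deriv f (p.2 + w ^ 2 * (p.1 - p.2)) := by
    refine (hasDerivAt_partialA (contDiffAt_QPair hf h1 h2)).unique ?_
    simp only [QPair, QFun_eq_integral]
    refine hasDerivAt_integral_param
      (F := fun q : ℝ × ℝ => f (p.2 + q.2 ^ 2 * (q.1 - p.2))) zero_le_one (fun w hw => ?_)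
      fun w hw => ?_
    · exact ContDiffAt.comp (f := fun q : ℝ × ℝ => p.2 + q.2 ^ 2 * (q.1 - p.2)) (p.1, w)
        ((hf _ (segment_mem_Ioo h1 h2 hw)).of_le (by exact_mod_cast le_top)) (by fun_prop)
    · have h3 : HasDerivAt (fun a => p.2 + w ^ 2 * (a - p.2)) (w ^ 2) p.1 := by
        simpa using (((hasDerivAt_id p.1).sub_const p.2).const_mul (w ^ 2)).const_add p.2
      have := (hdf _ (segment_mem_Ioo h1 h2 hw)).comp p.1 h3
      exact this.congr_deriv (mul_comm _ _)
  have hcont1 : ContinuousOn (fun w : ℝ => f (p.2 + w ^ 2 * (p.1 - p.2))) (Icc 0 1) :=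
    fun w hw => (ContinuousAt.comp (f := fun w : ℝ => p.2 + w ^ 2 * (p.1 - p.2))
      (hf _ (segment_mem_Ioo h1 h2 hw)).continuousAt (by fun_prop)).continuousWithinAt
  have hcont2 : ContinuousOn (fun w : ℝ => deriv f (p.2 + w ^ 2 * (p.1 - p.2))) (Icc 0 1) :=
    fun w hw => (ContinuousAt.comp (f := fun w : ℝ => p.2 + w ^ 2 * (p.1 - p.2))
      (hcont _ (segment_mem_Ioo h1 h2 hw)) (by fun_prop)).continuousWithinAt
  have hint1 := hcont1.intervalIntegrable_of_Icc (μ := volume) zero_le_one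
  have hint2 : IntervalIntegrable (fun w : ℝ => w ^ 2 * deriv f (p.2 + w ^ 2 * (p.1 - p.2)))
      volume 0 1 :=
    ContinuousOn.intervalIntegrable_of_Icc zero_le_one
      ((continuous_id.pow 2).continuousOn.mul hcont2)
  -- The derivative of w f(b + w²(a-b)) is the integrand of Q plus 2(a-b) times that of ∂ₐQ, and the
  -- boundary value at w = 1 is f(a).
  have hftc := intervalIntegral.integral_eq_sub_of_hasDerivAt
    (f := fun w => w * f (p.2 + w ^ 2 * (p.1 - p.2)))
    (f' := fun w => f (p.2 + w ^ 2 * (p.1 - p.2)) +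
      2 * (p.1 - p.2) * (w ^ 2 * deriv f (p.2 + w ^ 2 * (p.1 - p.2)))) (a := 0) (b := 1)
    (fun w hw => by
      rw [uIcc_of_le zero_le_one] at hw
      have h3 : HasDerivAt (fun w : ℝ => p.2 + w ^ 2 * (p.1 - p.2)) (2 * w * (p.1 - p.2)) w := by
        simpa using (((hasDerivAt_id w).pow 2).mul_const (p.1 - p.2)).const_add p.2
      have := (hasDerivAt_id w).mul ((hdf _ (segment_mem_Ioo h1 h2 hw)).comp w h3)
      refine this.congr_deriv ?_
      simp
      ring)
    (hint1.add (hint2.const_mul _))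
  rw [intervalIntegral.integral_add hint1 (hint2.const_mul _),
    intervalIntegral.integral_const_mul] at hftc
  rw [hA, QPair, QFun_eq_integral, hftc]
  simp

end Q

/-! ### Averages: derivatives with respect to the branch points -/

/-- The first cosine moment of `F a (m + δ cos θ)`. -/
def cosMoment (F : ℝ × ℝ → ℝ) (a m δ : ℝ) : ℝ :=
  1 / Real.pi * ∫ θ in (0 : ℝ)..Real.pi, Real.cos θ * F (a, m + δ * Real.cos θ)

/-- The average of `F` over the band `[β₃, β₂]`. -/
def bandMean (F : ℝ × ℝ → ℝ) (β : Fin 3 → ℝ) : ℝ := cosMean F (β 0) (center β) (halfGap β)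

def SmoothOnBand (F : ℝ × ℝ → ℝ) (β : Fin 3 → ℝ) : Prop :=
  ∀ θ : ℝ, ContDiffAt ℝ ∞ F (β 0, center β + halfGap β * Real.cos θ)

section Derivatives
variable {F : ℝ × ℝ → ℝ} {β : Fin 3 → ℝ}

theorem continuous_band (h : SmoothOnBand F β) :
    Continuous fun θ => F (β 0, center β + halfGap β * Real.cos θ) :=
  continuous_iff_continuousAt.2 fun θ =>
    ContinuousAt.comp (f := fun θ => (β 0, center β + halfGap β * Real.cos θ))
      (h θ).continuousAt (by fun_prop)

theorem SmoothOnBand.partialB (h : SmoothOnBand F β) : SmoothOnBand (partialB F) β :=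
  fun θ => (h θ).partialB

theorem hasDerivAt_bandMean_zero (h : SmoothOnBand F β) :
    HasDerivAt (fun b => bandMean F (Function.update β 0 b)) (bandMean (partialA F) β) (β 0) := by
  have := hasDerivAt_integral_param (x₀ := β 0)
    (F := fun q : ℝ × ℝ => F (q.1, center β + halfGap β * Real.cos q.2))
    (F' := fun θ => partialA F (β 0, center β + halfGap β * Real.cos θ)) Real.pi_pos.le
    (fun θ _ => ContDiffAt.comp
      (f := fun q : ℝ × ℝ => (q.1, center β + halfGap β * Real.cos q.2)) (β 0, θ)
      (contDiffAt_infty.1 (h θ) 1) (by fun_prop))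
    (fun θ _ => hasDerivAt_partialA (h θ))
  refine (this.const_mul (1 / Real.pi)).congr_of_eventuallyEq (Eventually.of_forall fun b => ?_)
  simp [bandMean, cosMean, center, halfGap]

/-- Moving β₂ or β₃ moves both the centre and the half-gap; `e` and `k` are their rates, 1/2 and
±1/2. The centre contributes the average of ∂_b F, the half-gap its first cosine moment. -/
theorem hasDerivAt_bandMean_aux (h : SmoothOnBand F β) {e k : ℝ} {M G : ℝ → ℝ} {b : ℝ}
    (hM : ∀ b', HasDerivAt M e b') (hG : ∀ b', HasDerivAt G k b') (hMs : ContDiff ℝ 1 M)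
    (hGs : ContDiff ℝ 1 G) (hMb : M b = center β) (hGb : G b = halfGap β) :
    HasDerivAt (fun b => cosMean F (β 0) (M b) (G b))
      (e * bandMean (partialB F) β + k * cosMoment (partialB F) (β 0) (center β) (halfGap β)) b := by
  have := hasDerivAt_integral_param (x₀ := b)
    (F := fun q : ℝ × ℝ => F (β 0, M q.1 + G q.1 * Real.cos q.2))
    (F' := fun θ => e * partialB F (β 0, center β + halfGap β * Real.cos θ) +
      k * (Real.cos θ * partialB F (β 0, center β + halfGap β * Real.cos θ))) Real.pi_pos.le
    (fun θ _ => by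
      have h1 := contDiffAt_infty.1 (h θ) 1
      rw [← hMb, ← hGb] at h1
      exact ContDiffAt.comp (f := fun q : ℝ × ℝ => (β 0, M q.1 + G q.1 * Real.cos q.2)) (b, θ)
        h1 (by fun_prop))
    (fun θ _ => by
      have h1 := hasDerivAt_partialB (h θ)
      dsimp only at h1
      rw [← hMb, ← hGb] at h1
      have h2 := h1.comp b ((hM b).add ((hG b).mul_const (Real.cos θ)))
      rw [hMb, hGb] at h2
      exact h2.congr_deriv (by ring))
  refine (this.const_mul (1 / Real.pi)).congr_deriv ?_
  have hc := continuous_band h.partialB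
  have hi1 := (hc.intervalIntegrable (μ := volume) 0 Real.pi).const_mul e
  have hc2 : Continuous fun θ => Real.cos θ *
      partialB F (β 0, center β + halfGap β * Real.cos θ) := Real.continuous_cos.mul hc
  have hi2 := (hc2.intervalIntegrable (μ := volume) 0 Real.pi).const_mul k
  rw [intervalIntegral.integral_add hi1 hi2, intervalIntegral.integral_const_mul,
    intervalIntegral.integral_const_mul, bandMean, cosMean, cosMoment]
  ring

theorem hasDerivAt_bandMean_one (h : SmoothOnBand F β) :
    HasDerivAt (fun b => bandMean F (Function.update β 1 b))
      ((bandMean (partialB F) β + cosMoment (partialB F) (β 0) (center β) (halfGap β)) / 2)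
      (β 1) := by
  refine (hasDerivAt_bandMean_aux h (M := fun b => (b + β 2) / 2) (G := fun b => (b - β 2) / 2)
    (e := 1 / 2) (k := 1 / 2) (b := β 1) (fun b => ((hasDerivAt_id b).add_const _).div_const 2)
    (fun b => ((hasDerivAt_id b).sub_const _).div_const 2) (by fun_prop) (by fun_prop)
    rfl rfl).congr_deriv (by ring) |>.congr_of_eventuallyEq (Eventually.of_forall fun b => ?_)
  simp [bandMean, center, halfGap]

theorem hasDerivAt_bandMean_two (h : SmoothOnBand F β) :
    HasDerivAt (fun b => bandMean F (Function.update β 2 b))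
      ((bandMean (partialB F) β - cosMoment (partialB F) (β 0) (center β) (halfGap β)) / 2)
      (β 2) := by
  refine (hasDerivAt_bandMean_aux h (M := fun b => (β 1 + b) / 2) (G := fun b => (β 1 - b) / 2)
    (e := 1 / 2) (k := -1 / 2) (b := β 2) (fun b => ((hasDerivAt_id b).const_add _).div_const 2)
    (fun b => ((hasDerivAt_id b).const_sub _).div_const 2) (by fun_prop) (by fun_prop)
    rfl rfl).congr_deriv (by ring) |>.congr_of_eventuallyEq (Eventually.of_forall fun b => ?_)
  simp [bandMean, center, halfGap]

end Derivatives

/-! ### Averages: expansions for small bands -/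

/-- The mean value inequality between 0 and h. The factor 1/(n+1) of an exact integration is given
up, since only orders matter. -/
theorem abs_le_of_abs_deriv_le {φ φ' : ℝ → ℝ} {C ρ : ℝ} {n : ℕ} (hC : 0 ≤ C) (h0 : φ 0 = 0)
    (hd : ∀ h, |h| < ρ → HasDerivAt φ (φ' h) h) (hb : ∀ h, |h| < ρ → |φ' h| ≤ C * |h| ^ n)
    {h : ℝ} (hh : |h| < ρ) : |φ h| ≤ C * |h| ^ (n + 1) := by
  have hsub : ∀ y ∈ uIcc 0 h, |y| ≤ |h| := fun y hy => by
    simpa using abs_sub_left_of_mem_uIcc hy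
  have := (convex_uIcc 0 h).norm_image_sub_le_of_norm_hasDerivWithin_le (f := φ) (f' := φ')
    (C := C * |h| ^ n) (fun y hy => (hd y ((hsub y hy).trans_lt hh)).hasDerivWithinAt)
    (fun y hy => by
      exact (hb y ((hsub y hy).trans_lt hh)).trans
        (mul_le_mul_of_nonneg_left (pow_le_pow_left₀ (abs_nonneg _) (hsub y hy) n) hC)) left_mem_uIcc right_mem_uIcc
  rw [h0, sub_zero, sub_zero, Real.norm_eq_abs, Real.norm_eq_abs] at this
  rw [pow_succ, ← mul_assoc]
  exact this

/-- Taylor expansion to third order in the second variable, locally uniformly. -/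
theorem exists_taylor_bound {F : ℝ × ℝ → ℝ} {u v : ℝ} (hF : SmoothNear F (u, v)) :
    ∃ C ρ : ℝ, 0 ≤ C ∧ 0 < ρ ∧ ∀ a m h : ℝ, |a - u| < ρ → |m - v| < ρ → |h| < ρ →
      ContDiffAt ℝ ∞ F (a, m + h) ∧
      |F (a, m + h) - (F (a, m) + h * partialB F (a, m) +
        h ^ 2 / 2 * partialB (partialB F) (a, m) +
        h ^ 3 / 6 * partialB (partialB (partialB F)) (a, m))| ≤ C * |h| ^ 4 := by
  have hF4 := hF.partialB.partialB.partialB.partialB.continuousAt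
  set F4 := partialB (partialB (partialB (partialB F)))
  obtain ⟨ε, hε, hball⟩ := Metric.eventually_nhds_iff_ball.1
    (hF.and (hF4.norm.eventually (gt_mem_nhds (lt_add_one ‖F4 (u, v)‖))))
  refine ⟨‖F4 (u, v)‖ + 1, ε / 2, by positivity, by positivity, fun a m h ha hm hh => ?_⟩
  have hmem : ∀ h, |h| < ε / 2 → (a, m + h) ∈ Metric.ball (u, v) ε := fun h hh => by
    rw [Metric.mem_ball, Prod.dist_eq, max_lt_iff, Real.dist_eq, Real.dist_eq]
    refine ⟨by linarith, ?_⟩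
    have : m + h - v = (m - v) + h := by ring
    rw [this]
    linarith [abs_add_le (m - v) h]
  have hs : ∀ h, |h| < ε / 2 → ContDiffAt ℝ ∞ F (a, m + h) := fun h hh =>
    (hball _ (hmem h hh)).1
  refine ⟨hs h hh, ?_⟩
  have hder : ∀ (G : ℝ × ℝ → ℝ) (h : ℝ), ContDiffAt ℝ ∞ G (a, m + h) →
      HasDerivAt (fun h => G (a, m + h)) (partialB G (a, m + h)) h := fun G h hG => by
    have := (hasDerivAt_partialB hG).comp h ((hasDerivAt_id h).const_add m)
    simpa using! this
  have hC : 0 ≤ ‖F4 (u, v)‖ + 1 := by positivity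
  -- The Taylor remainder is integrated upwards one derivative at a time, starting from the bound on
  -- the fourth derivative.
  have b1 : ∀ h, |h| < ε / 2 → |partialB (partialB (partialB F)) (a, m + h) -
      partialB (partialB (partialB F)) (a, m)| ≤ (‖F4 (u, v)‖ + 1) * |h| ^ (0 + 1) := fun h hh => by
    refine abs_le_of_abs_deriv_le (φ := fun h => partialB (partialB (partialB F)) (a, m + h) -
      partialB (partialB (partialB F)) (a, m)) (φ' := fun h => F4 (a, m + h)) hC (by simp)
      (fun h hh => (hder _ h (hs h hh).partialB.partialB.partialB).sub_const _)
      (fun h hh => ?_) hh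
    simpa using (hball _ (hmem h hh)).2.le
  have b2 : ∀ h, |h| < ε / 2 → |partialB (partialB F) (a, m + h) -
      (partialB (partialB F) (a, m) + h * partialB (partialB (partialB F)) (a, m))| ≤
      (‖F4 (u, v)‖ + 1) * |h| ^ (1 + 1) := fun h hh => by
    refine abs_le_of_abs_deriv_le (φ := fun h => partialB (partialB F) (a, m + h) -
      (partialB (partialB F) (a, m) + h * partialB (partialB (partialB F)) (a, m))) hC (by simp)
      (fun h hh => (hder _ h (hs h hh).partialB.partialB).sub
        (((hasDerivAt_id h).mul_const _).const_add _))
      (fun h hh => ?_) hh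
    simpa using b1 h hh
  have b3 : ∀ h, |h| < ε / 2 → |partialB F (a, m + h) -
      (partialB F (a, m) + h * partialB (partialB F) (a, m) +
        h ^ 2 / 2 * partialB (partialB (partialB F)) (a, m))| ≤
      (‖F4 (u, v)‖ + 1) * |h| ^ (2 + 1) := fun h hh => by
    refine abs_le_of_abs_deriv_le (φ := fun h => partialB F (a, m + h) -
      (partialB F (a, m) + h * partialB (partialB F) (a, m) +
        h ^ 2 / 2 * partialB (partialB (partialB F)) (a, m))) hC (by simp)
      (fun h hh => (hder _ h (hs h hh).partialB).sub
        ((((hasDerivAt_id h).mul_const _).const_add _).add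
          ((((hasDerivAt_id h).pow 2).div_const 2).mul_const _)))
      (fun h hh => ?_) hh
    have := b2 h hh
    simp only [id_eq]
    convert this using 2
    push_cast
    ring
  refine abs_le_of_abs_deriv_le (φ := fun h => F (a, m + h) - (F (a, m) + h * partialB F (a, m) +
        h ^ 2 / 2 * partialB (partialB F) (a, m) +
        h ^ 3 / 6 * partialB (partialB (partialB F)) (a, m))) (n := 3) hC (by simp)
      (fun h hh => (hder _ h (hs h hh)).sub
        (((((hasDerivAt_id h).mul_const _).const_add _).add
          ((((hasDerivAt_id h).pow 2).div_const 2).mul_const _)).add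
            ((((hasDerivAt_id h).pow 3).div_const 6).mul_const _)))
      (fun h hh => ?_) hh
  have := b3 h hh
  simp only [id_eq]
  convert this using 2
  push_cast
  ring

theorem integral_cos_pi : ∫ θ in (0 : ℝ)..Real.pi, Real.cos θ = 0 := by simp

theorem integral_cos_sq_pi : ∫ θ in (0 : ℝ)..Real.pi, Real.cos θ ^ 2 = Real.pi / 2 := by
  simp [integral_cos_sq]

theorem integral_cos_cube_pi : ∫ θ in (0 : ℝ)..Real.pi, Real.cos θ ^ 3 = 0 := by
  simp [integral_cos_pow (a := 0) (b := Real.pi) 1]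

theorem integral_cos_fourth_pi : ∫ θ in (0 : ℝ)..Real.pi, Real.cos θ ^ 4 = 3 * Real.pi / 8 := by
  have := integral_cos_pow (a := 0) (b := Real.pi) 2
  rw [integral_cos_sq_pi] at this
  rw [this]
  norm_num
  ring

theorem tendsto_coords (u v : ℝ) : ∀ ρ > 0, ∀ᶠ p : ℝ × ℝ × ℝ in 𝓝 (u, v, 0),
    |p.1 - u| < ρ ∧ |p.2.1 - v| < ρ ∧ |p.2.2| < ρ := by
  intro ρ hρ
  filter_upwards [Metric.ball_mem_nhds (u, v, (0 : ℝ)) hρ] with p hp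
  rw [Metric.mem_ball, Prod.dist_eq, Prod.dist_eq, max_lt_iff, max_lt_iff, Real.dist_eq,
    Real.dist_eq, Real.dist_eq, sub_zero] at hp
  exact hp

theorem abs_mean_le {w : ℝ → ℝ} {B : ℝ} (hw : ∀ θ, |w θ| ≤ B) :
    |1 / Real.pi * ∫ θ in (0 : ℝ)..Real.pi, w θ| ≤ B := by
  have h := intervalIntegral.norm_integral_le_of_norm_le_const (a := 0) (b := Real.pi) (f := w)
    (C := B) fun θ _ => hw θ
  have hp := Real.pi_pos
  rw [sub_zero, abs_of_pos hp, Real.norm_eq_abs] at h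
  rw [abs_mul, abs_of_pos (by positivity), one_div, inv_mul_le_iff₀ hp, mul_comm]
  exact h

theorem abs_mul_cos_le (δ θ : ℝ) : |δ * Real.cos θ| ≤ |δ| := by
  rw [abs_mul]
  exact mul_le_of_le_one_right (abs_nonneg _) (Real.abs_cos_le_one θ)

section Expansion
variable {F : ℝ × ℝ → ℝ} {u v : ℝ}

theorem continuous_arc {a m δ ρ : ℝ} (hδ : |δ| < ρ)
    (h : ∀ h, |h| < ρ → ContDiffAt ℝ ∞ F (a, m + h)) :
    Continuous fun θ => F (a, m + δ * Real.cos θ) :=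
  continuous_iff_continuousAt.2 fun θ =>
    ContinuousAt.comp (f := fun θ => (a, m + δ * Real.cos θ))
      (h _ ((abs_mul_cos_le δ θ).trans_lt hδ)).continuousAt (by fun_prop)

/-- Odd powers of cos θ average to zero and cos² θ to 1/2. The cubic Taylor term drops out, so the
error is already of fourth order. -/
theorem cosMean_sub_isBigO (hF : SmoothNear F (u, v)) :
    (fun p : ℝ × ℝ × ℝ => cosMean F p.1 p.2.1 p.2.2 -
      (F (p.1, p.2.1) + partialB (partialB F) (p.1, p.2.1) / 4 * p.2.2 ^ 2))
      =O[𝓝 (u, v, 0)] fun p => p.2.2 ^ 4 := by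
  obtain ⟨C, ρ, hC, hρ, hT⟩ := exists_taylor_bound hF
  refine IsBigO.of_bound C ?_
  filter_upwards [tendsto_coords u v ρ hρ] with p ⟨h1, h2, h3⟩
  obtain ⟨a, m, δ⟩ := p
  simp only at h1 h2 h3 ⊢
  have hc := continuous_arc h3 fun h hh => (hT a m h h1 h2 hh).1
  have key : cosMean F a m δ - (F (a, m) + partialB (partialB F) (a, m) / 4 * δ ^ 2) =
      1 / Real.pi * ∫ θ in (0 : ℝ)..Real.pi, (F (a, m + δ * Real.cos θ) -
        (F (a, m) + δ * partialB F (a, m) * Real.cos θ +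
        δ ^ 2 / 2 * partialB (partialB F) (a, m) * Real.cos θ ^ 2 +
        δ ^ 3 / 6 * partialB (partialB (partialB F)) (a, m) * Real.cos θ ^ 3)) := by
    have i1 : ∀ (k : ℝ) (n : ℕ),
        IntervalIntegrable (fun θ => k * Real.cos θ ^ n) volume 0 Real.pi :=
      fun k n => Continuous.intervalIntegrable (by fun_prop) _ _
    have i1' : ∀ (k : ℝ), IntervalIntegrable (fun θ => k * Real.cos θ) volume 0 Real.pi :=
      fun k => Continuous.intervalIntegrable (by fun_prop) _ _
    rw [intervalIntegral.integral_sub (hc.intervalIntegrable _ _)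
      ((((intervalIntegrable_const.add (i1' _)).add (i1 _ _)).add (i1 _ _))),
      intervalIntegral.integral_add ((intervalIntegrable_const.add (i1' _)).add (i1 _ _)) (i1 _ _),
      intervalIntegral.integral_add (intervalIntegrable_const.add (i1' _)) (i1 _ _),
      intervalIntegral.integral_add intervalIntegrable_const (i1' _)]
    simp only [intervalIntegral.integral_const_mul, intervalIntegral.integral_const,
      integral_cos_pi, integral_cos_sq_pi, integral_cos_cube_pi, cosMean, smul_eq_mul]
    have := Real.pi_ne_zero
    field_simp
    ring
  rw [key, Real.norm_eq_abs, norm_pow, Real.norm_eq_abs]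
  refine abs_mean_le fun θ => ?_
  have h4 := abs_mul_cos_le δ θ
  have := (hT a m (δ * Real.cos θ) h1 h2 (h4.trans_lt h3)).2
  refine le_trans (le_of_eq ?_) (this.trans ?_)
  · congr 1
    ring
  · gcongr

/-- With the extra cosine the even Taylor terms drop out instead; the cubic one is counted as error.
-/
theorem cosMoment_sub_isBigO (hF : SmoothNear F (u, v)) :
    (fun p : ℝ × ℝ × ℝ => cosMoment F p.1 p.2.1 p.2.2 -
      partialB F (p.1, p.2.1) / 2 * p.2.2) =O[𝓝 (u, v, 0)] fun p => p.2.2 ^ 3 := by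
  obtain ⟨C, ρ, hC, hρ, hT⟩ := exists_taylor_bound hF
  set F3 := partialB (partialB (partialB F)) with hF3def
  have hF3 := hF.partialB.partialB.partialB.continuousAt
  have hpr : Tendsto (fun p : ℝ × ℝ × ℝ => (p.1, p.2.1)) (𝓝 (u, v, 0)) (𝓝 (u, v)) :=
    Continuous.tendsto' (by fun_prop) _ _ rfl
  refine IsBigO.of_bound (C + (‖F3 (u, v)‖ + 1)) ?_
  -- A radius of at most 1 makes δ⁴ ≤ |δ|³.
  filter_upwards [tendsto_coords u v (min ρ 1) (by positivity),
    hpr.eventually (hF3.norm.eventually (gt_mem_nhds (lt_add_one ‖F3 (u, v)‖)))] with p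
    ⟨h1, h2, h3⟩ hb
  obtain ⟨a, m, δ⟩ := p
  simp only [lt_min_iff] at h1 h2 h3 hb ⊢
  have hc := continuous_arc h3.1 fun h hh => (hT a m h h1.1 h2.1 hh).1
  -- The mean of cos⁴ is 3/8, so the cubic Taylor term contributes 1/6 · 3/8 = 1/16.
  have key : cosMoment F a m δ - partialB F (a, m) / 2 * δ =
      (1 / Real.pi * ∫ θ in (0 : ℝ)..Real.pi, Real.cos θ * (F (a, m + δ * Real.cos θ) -
        (F (a, m) + δ * partialB F (a, m) * Real.cos θ +
        δ ^ 2 / 2 * partialB (partialB F) (a, m) * Real.cos θ ^ 2 +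
        δ ^ 3 / 6 * F3 (a, m) * Real.cos θ ^ 3))) + δ ^ 3 / 16 * F3 (a, m) := by
    have i1 : ∀ (k : ℝ) (n : ℕ),
        IntervalIntegrable (fun θ => k * Real.cos θ ^ n) volume 0 Real.pi :=
      fun k n => Continuous.intervalIntegrable (by fun_prop) _ _
    have e : ∀ θ, Real.cos θ * (F (a, m + δ * Real.cos θ) -
        (F (a, m) + δ * partialB F (a, m) * Real.cos θ +
        δ ^ 2 / 2 * partialB (partialB F) (a, m) * Real.cos θ ^ 2 +
        δ ^ 3 / 6 * F3 (a, m) * Real.cos θ ^ 3)) = Real.cos θ * F (a, m + δ * Real.cos θ) -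
        (F (a, m) * Real.cos θ ^ 1 + δ * partialB F (a, m) * Real.cos θ ^ 2 +
        δ ^ 2 / 2 * partialB (partialB F) (a, m) * Real.cos θ ^ 3 +
        δ ^ 3 / 6 * F3 (a, m) * Real.cos θ ^ 4) := fun θ => by ring
    have hc2 : Continuous fun θ => Real.cos θ * F (a, m + δ * Real.cos θ) :=
      Real.continuous_cos.mul hc
    simp only [e]
    rw [intervalIntegral.integral_sub (hc2.intervalIntegrable _ _)
      (((((i1 _ _).add (i1 _ _)).add (i1 _ _)).add (i1 _ _))),
      intervalIntegral.integral_add (((i1 _ _).add (i1 _ _)).add (i1 _ _)) (i1 _ _),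
      intervalIntegral.integral_add ((i1 _ _).add (i1 _ _)) (i1 _ _),
      intervalIntegral.integral_add (i1 _ _) (i1 _ _)]
    simp only [intervalIntegral.integral_const_mul, pow_one,
      integral_cos_pi, integral_cos_sq_pi, integral_cos_cube_pi, integral_cos_fourth_pi, cosMoment]
    have := Real.pi_ne_zero
    generalize (∫ θ in (0 : ℝ)..Real.pi, Real.cos θ * F (a, m + δ * Real.cos θ)) = I
    field_simp
    ring
  rw [key, Real.norm_eq_abs, norm_pow, Real.norm_eq_abs, add_mul]
  refine (abs_add_le _ _).trans (add_le_add (abs_mean_le fun θ => ?_) ?_)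
  · have h4 := abs_mul_cos_le δ θ
    have := (hT a m (δ * Real.cos θ) h1.1 h2.1 (h4.trans_lt h3.1)).2
    rw [abs_mul]
    refine (mul_le_of_le_one_left (abs_nonneg _) (Real.abs_cos_le_one θ)).trans ?_
    refine le_trans (le_of_eq ?_) (this.trans ?_)
    · congr 1
      ring
    · gcongr
      calc |δ * Real.cos θ| ^ 4 ≤ |δ| ^ 4 := by gcongr
        _ ≤ |δ| ^ 3 := pow_le_pow_of_le_one (abs_nonneg _) h3.2.le (by norm_num)
  · rw [abs_mul, abs_div, abs_pow, mul_comm]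
    rw [Real.norm_eq_abs] at hb
    have : (0 : ℝ) ≤ |δ| ^ 3 := by positivity
    have h16 : |δ| ^ 3 / |(16 : ℝ)| ≤ |δ| ^ 3 := by
      rw [abs_of_pos (by norm_num : (0 : ℝ) < 16)]
      linarith
    exact mul_le_mul hb.le h16 (by positivity) (by positivity)

/-- First-order expansion with a quadratic remainder. -/
theorem sub_linear_isBigO (hF : ContDiffAt ℝ ∞ F (u, v)) :
    (fun q : ℝ × ℝ => F q - (F (u, v) + (q.1 - u) * partialA F (u, v) +
      (q.2 - v) * partialB F (u, v))) =O[𝓝 (u, v)] fun q => (|q.1 - u| + |q.2 - v|) ^ 2 := by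
  have h1 : ContDiffAt ℝ 1 (fderiv ℝ F) (u, v) :=
    (contDiffAt_infty.1 hF 2).fderiv_right (by norm_num)
  obtain ⟨K, s, hs, hK⟩ := h1.exists_lipschitzOnWith
  have hdiff : ∀ᶠ q in 𝓝 (u, v), DifferentiableAt ℝ F q :=
    ((contDiffAt_infty.1 hF 1).eventually (by simp)).mono fun q hq => hq.differentiableAt (by simp)
  obtain ⟨ε, hε, hball⟩ := Metric.eventually_nhds_iff_ball.1 (hdiff.and hs)
  refine IsBigO.of_bound K ?_
  filter_upwards [Metric.ball_mem_nhds (u, v) hε] with q hq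
  have hsub : segment ℝ (u, v) q ⊆ Metric.ball (u, v) ε :=
    (convex_ball _ _).segment_subset (Metric.mem_ball_self hε) hq
  have hn : ‖q - (u, v)‖ ≤ |q.1 - u| + |q.2 - v| := by
    rw [Prod.norm_def]
    exact max_le (by simp [Real.norm_eq_abs]) (by simp [Real.norm_eq_abs])
  have := (convex_segment (u, v) q).norm_image_sub_le_of_norm_hasFDerivWithin_le' (f := F)
    (f' := fderiv ℝ F) (φ := fderiv ℝ F (u, v)) (C := K * ‖q - (u, v)‖)
    (fun y hy => ((hball y (hsub hy)).1).hasFDerivAt.hasFDerivWithinAt)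
    (fun y hy => by
      have h2 := hK.dist_le_mul y (hball y (hsub hy)).2 (u, v)
        (hball _ (Metric.mem_ball_self hε)).2
      rw [dist_eq_norm, dist_eq_norm] at h2
      refine h2.trans ?_
      gcongr
      exact norm_sub_le_of_mem_segment hy)
    (left_mem_segment ℝ _ _) (right_mem_segment ℝ _ _)
  have e : q - (u, v) = (q.1 - u, q.2 - v) := rfl
  rw [e, fderiv_apply_eq, ← e] at this
  have hn0 : 0 ≤ |q.1 - u| + |q.2 - v| := by positivity
  rw [Real.norm_of_nonneg (pow_nonneg hn0 2)]
  calc _ = ‖F q - F (u, v) - ((q.1 - u) * partialA F (u, v) + (q.2 - v) * partialB F (u, v))‖ := by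
        congr 1
        ring
    _ ≤ _ := this
    _ ≤ K * (|q.1 - u| + |q.2 - v|) * (|q.1 - u| + |q.2 - v|) := by gcongr
    _ = _ := by ring

end Expansion

/-! ### The hodograph system as a critical point equation -/

section Length
variable {ν : ℝ} {p : ℝ × ℝ}

theorem contDiffAt_lengthDensity (h1 : 0 < p.2 + ν) (h2 : 0 < p.1 - p.2) :
    ContDiffAt ℝ ∞ (lengthDensity ν) p := by
  have h3 : (p.2 + ν) / (p.1 - p.2) ≠ 0 := (div_pos h1 h2).ne'
  have h4 : ContDiffAt ℝ ∞ (fun p : ℝ × ℝ => (p.2 + ν) / (p.1 - p.2)) p :=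
    ContDiffAt.div (by fun_prop) (by fun_prop) h2.ne'
  exact h4.sqrt h3

theorem contDiffAt_periodDensity (h1 : 0 < p.2 + ν) (h2 : 0 < p.1 - p.2) :
    ContDiffAt ℝ ∞ (periodDensity ν) p := by
  have h3 : (p.2 + ν) * (p.1 - p.2) ≠ 0 := (mul_pos h1 h2).ne'
  have h4 : ContDiffAt ℝ ∞ (fun p : ℝ × ℝ => (p.2 + ν) * (p.1 - p.2)) p := by fun_prop
  exact contDiffAt_const.div (h4.sqrt h3)
    (Real.sqrt_pos.2 (mul_pos h1 h2)).ne'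

theorem eventually_admissible {p : ℝ × ℝ} (h1 : 0 < p.2 + ν) (h2 : 0 < p.1 - p.2) :
    ∀ᶠ q : ℝ × ℝ in 𝓝 p, 0 < q.2 + ν ∧ 0 < q.1 - q.2 :=
  ((by fun_prop : Continuous fun q : ℝ × ℝ => q.2 + ν).continuousAt.eventually
    (lt_mem_nhds h1)).and ((by fun_prop : Continuous fun q : ℝ × ℝ => q.1 - q.2).continuousAt.eventually
      (lt_mem_nhds h2))

theorem smoothNear_lengthDensity (h1 : 0 < p.2 + ν) (h2 : 0 < p.1 - p.2) :
    SmoothNear (lengthDensity ν) p :=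
  (eventually_admissible h1 h2).mono fun _ hq => contDiffAt_lengthDensity hq.1 hq.2

theorem smoothNear_periodDensity (h1 : 0 < p.2 + ν) (h2 : 0 < p.1 - p.2) :
    SmoothNear (periodDensity ν) p :=
  (eventually_admissible h1 h2).mono fun _ hq => contDiffAt_periodDensity hq.1 hq.2

/-- Equivalently g + 2(a-b) ∂ₐg = 0, which is why σ disappears from `defect_identity`. -/
theorem partialA_lengthDensity (h1 : 0 < p.2 + ν) (h2 : 0 < p.1 - p.2) :
    partialA (lengthDensity ν) p = -lengthDensity ν p / (2 * (p.1 - p.2)) := by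
  have h3 := div_pos h1 h2
  have hd : HasDerivAt (fun a => lengthDensity ν (a, p.2))
      (-(p.2 + ν) / (p.1 - p.2) ^ 2 / (2 * √((p.2 + ν) / (p.1 - p.2)))) p.1 := by
    have := (((hasDerivAt_id p.1).sub_const p.2).inv h2.ne').const_mul (p.2 + ν)
    refine (this.sqrt (f := fun a => (p.2 + ν) * (a - p.2)⁻¹) h3.ne').congr_deriv ?_
    simp only [id, div_eq_mul_inv]
    ring
  rw [(hasDerivAt_partialA (contDiffAt_lengthDensity h1 h2)).unique hd, lengthDensity]
  have h4 := Real.sqrt_pos.2 h3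
  have h5 := Real.sq_sqrt h3.le
  rw [div_div, div_eq_div_iff (by positivity) (by positivity)]
  generalize √((p.2 + ν) / (p.1 - p.2)) = s at *
  have h6 : s ^ 2 * (p.1 - p.2) = p.2 + ν := by
    rw [h5]
    field_simp
  linear_combination (2 * (p.1 - p.2)) * h6

/-- Equivalently 2(b+ν)(a-b) ∂_b g = (a+ν) g; this eliminates σg from the second identity in
`edgeDerivatives_defect`. -/
theorem partialB_lengthDensity (h1 : 0 < p.2 + ν) (h2 : 0 < p.1 - p.2) :
    partialB (lengthDensity ν) p =
      lengthDensity ν p * (p.1 + ν) / (2 * (p.2 + ν) * (p.1 - p.2)) := by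
  have h3 := div_pos h1 h2
  have hd : HasDerivAt (fun b => lengthDensity ν (p.1, b))
      ((p.1 + ν) / (p.1 - p.2) ^ 2 / (2 * √((p.2 + ν) / (p.1 - p.2)))) p.2 := by
    have := ((hasDerivAt_id p.2).add_const ν).div ((hasDerivAt_id p.2).const_sub p.1) h2.ne'
    refine (this.sqrt h3.ne').congr_deriv ?_
    simp only [id, Pi.div_apply]
    ring
  rw [(hasDerivAt_partialB (contDiffAt_lengthDensity h1 h2)).unique hd, lengthDensity]
  have h4 := Real.sqrt_pos.2 h3
  have h5 := Real.sq_sqrt h3.le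
  rw [div_div, div_eq_div_iff (by positivity) (by positivity)]
  generalize √((p.2 + ν) / (p.1 - p.2)) = s at *
  have h6 : s ^ 2 * (p.1 - p.2) = p.2 + ν := by
    rw [h5]
    field_simp
  linear_combination (-2 * (p.1 + ν) * (p.1 - p.2)) * h6

end Length

section Hodograph
variable {ν c d : ℝ} {f : ℝ → ℝ} {β : Fin 3 → ℝ}

/-- The branch points are ordered and lie in `(c, d)`. -/
def Admissible (ν c d : ℝ) (β : Fin 3 → ℝ) : Prop := Ordered ν β ∧ ∀ i, β i ∈ Ioo c d

theorem isOpen_admissible (ν c d : ℝ) : IsOpen {β | Admissible ν c d β} := by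
  have e : {β | Admissible ν c d β} = ((fun β : Fin 3 → ℝ => β 2) ⁻¹' Ioi (-ν) ∩
      (fun β : Fin 3 → ℝ => β 1 - β 2) ⁻¹' Ioi 0 ∩ (fun β : Fin 3 → ℝ => β 0 - β 1) ⁻¹' Ioi 0) ∩
      ⋂ i, (fun β : Fin 3 → ℝ => β i) ⁻¹' Ioo c d := by
    ext β
    simp [Admissible, Ordered, and_assoc]
  rw [e]
  refine IsOpen.inter (IsOpen.inter (IsOpen.inter ?_ ?_) ?_) (isOpen_iInter_of_finite fun i => ?_)
  · exact isOpen_Ioi.preimage (by fun_prop)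
  · exact isOpen_Ioi.preimage (by fun_prop)
  · exact isOpen_Ioi.preimage (by fun_prop)
  · exact isOpen_Ioo.preimage (by fun_prop)

theorem Admissible.eventually_update (h : Admissible ν c d β) (i : Fin 3) :
    ∀ᶠ b in 𝓝 (β i), Admissible ν c d (Function.update β i b) := by
  have hc : ContinuousAt (fun b => Function.update β i b) (β i) := by fun_prop
  refine hc.eventually ((isOpen_admissible ν c d).mem_nhds ?_)
  simpa using! h

theorem center_add_bounds (h : Ordered ν β) (θ : ℝ) :
    β 2 ≤ center β + halfGap β * Real.cos θ ∧ center β + halfGap β * Real.cos θ ≤ β 1 :=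
  center_add_mem_Icc (c := β 2) (d := β 1) ⟨h.2.1.le, le_rfl⟩ ⟨le_rfl, h.2.1.le⟩ θ

theorem smoothOnBand_lengthDensity (h : Ordered ν β) : SmoothOnBand (lengthDensity ν) β :=
  fun θ => contDiffAt_lengthDensity (by linarith [(center_add_bounds h θ).1, h.1])
    (by linarith [(center_add_bounds h θ).2, h.2.2])

theorem smoothOnBand_periodDensity (h : Ordered ν β) : SmoothOnBand (periodDensity ν) β :=
  fun θ => contDiffAt_periodDensity (by linarith [(center_add_bounds h θ).1, h.1])
    (by linarith [(center_add_bounds h θ).2, h.2.2])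

theorem smoothOnBand_QPair (hf : ∀ y ∈ Ioo c d, ContDiffAt ℝ ∞ f y) (h : Admissible ν c d β) :
    SmoothOnBand (QPair f) β := fun θ =>
  contDiffAt_QPair hf (h.2 0) ⟨(h.2 2).1.trans_le (center_add_bounds h.1 θ).1,
    (center_add_bounds h.1 θ).2.trans_lt (h.2 1).2⟩

theorem bandMean_lengthDensity_pos (h : Ordered ν β) : 0 < bandMean (lengthDensity ν) β := by
  refine mul_pos (by have := Real.pi_pos; positivity) ?_
  refine intervalIntegral.intervalIntegral_pos_of_pos_on
    ((continuous_band (smoothOnBand_lengthDensity h)).intervalIntegrable _ _)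
    (fun θ _ => ?_) Real.pi_pos
  exact Real.sqrt_pos.2 (div_pos (by linarith [(center_add_bounds h θ).1, h.1])
    (by linarith [(center_add_bounds h θ).2, h.2.2]))

theorem bandMean_periodDensity_pos (h : Ordered ν β) : 0 < bandMean (periodDensity ν) β := by
  refine mul_pos (by have := Real.pi_pos; positivity) ?_
  refine intervalIntegral.intervalIntegral_pos_of_pos_on
    ((continuous_band (smoothOnBand_periodDensity h)).intervalIntegrable _ _)
    (fun θ _ => ?_) Real.pi_pos
  exact one_div_pos.2 (Real.sqrt_pos.2 (mul_pos (by linarith [(center_add_bounds h θ).1, h.1])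
    (by linarith [(center_add_bounds h θ).2, h.2.2])))

theorem qShift_eq_bandMean (hf : ∀ y ∈ Ioo c d, ContDiffAt ℝ ∞ f y) (h : Admissible ν c d β) :
    qShift f β = bandMean (QPair f) β := by
  obtain ⟨⟨h1, h2, h3⟩, h4⟩ := h
  refine qShift_eq_cosMean (c := β 2) (d := β 0) (fun y hy => ?_) ⟨by linarith, le_rfl⟩
    ⟨h2.le, h3.le⟩ ⟨le_rfl, by linarith⟩
  exact (hf y ⟨(h4 2).1.trans_le hy.1, hy.2.trans_lt (h4 0).2⟩).continuousAt.continuousWithinAt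

/-- The defect `x₀ - c t - Q - σ g` at double points. -/
def defect (ν : ℝ) (f : ℝ → ℝ) (t x₀ σ : ℝ) (p : ℝ × ℝ) : ℝ :=
  x₀ - (p.1 + 2 * p.2 + 2 * ν) * t - QPair f p - σ * lengthDensity ν p

/-- The term 2b averages to β₂ + β₃, so the speed at double points averages to the true phase
velocity. At x = x₀ the right-hand side is L(ξ - σ). -/
theorem bandMean_defect (hf : ∀ y ∈ Ioo c d, ContDiffAt ℝ ∞ f y) (h : Admissible ν c d β)
    (t x₀ σ : ℝ) : bandMean (defect ν f t x₀ σ) β =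
      x₀ - phaseVelocity ν β * t - qShift f β - σ * bandMean (lengthDensity ν) β := by
  have hq := continuous_band (smoothOnBand_QPair hf h)
  have hl := continuous_band (smoothOnBand_lengthDensity h.1)
  have e : ∀ θ, defect ν f t x₀ σ (β 0, center β + halfGap β * Real.cos θ) =
      x₀ - phaseVelocity ν β * t - 2 * t * halfGap β * Real.cos θ -
        QPair f (β 0, center β + halfGap β * Real.cos θ) -
        σ * lengthDensity ν (β 0, center β + halfGap β * Real.cos θ) := fun θ => by
    simp only [defect, phaseVelocity, center]
    ring
  rw [qShift_eq_bandMean hf h]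
  simp only [bandMean, cosMean, e]
  have i0 : IntervalIntegrable (fun θ => 2 * t * halfGap β * Real.cos θ) volume 0 Real.pi :=
    Continuous.intervalIntegrable (by fun_prop) _ _
  have iq := hq.intervalIntegrable (μ := volume) 0 Real.pi
  have il := (hl.intervalIntegrable (μ := volume) 0 Real.pi).const_mul σ
  rw [intervalIntegral.integral_sub ((intervalIntegrable_const.sub i0).sub iq) il,
    intervalIntegral.integral_sub (intervalIntegrable_const.sub i0) iq,
    intervalIntegral.integral_sub intervalIntegrable_const i0]
  simp only [intervalIntegral.integral_const_mul, intervalIntegral.integral_const,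
      integral_cos_pi, smul_eq_mul]
  have := Real.pi_ne_zero
  field_simp
  ring

theorem smoothOnBand_defect (hf : ∀ y ∈ Ioo c d, ContDiffAt ℝ ∞ f y) (h : Admissible ν c d β)
    (t x₀ σ : ℝ) : SmoothOnBand (defect ν f t x₀ σ) β := fun θ =>
  (ContDiffAt.sub (by fun_prop) (smoothOnBand_QPair hf h θ)).sub
    (contDiffAt_const.mul (smoothOnBand_lengthDensity h.1 θ))

/-- Each hodograph equation says that the phase is critical in the corresponding branch point. -/
theorem hodograph_critical (hf : ∀ y ∈ Ioo c d, ContDiffAt ℝ ∞ f y) (h : Admissible ν c d β)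
    {x t x₀ σ : ℝ} {i : Fin 3} (hx : x = speed ν i β * t + wFun ν f i β) {dL dD : ℝ}
    (hL : HasDerivAt (fun b => bandMean (lengthDensity ν) (Function.update β i b)) dL (β i))
    (hD : HasDerivAt (fun b => bandMean (defect ν f t x₀ σ) (Function.update β i b)) dD (β i))
    (hdL : dL ≠ 0) :
    bandMean (lengthDensity ν) β * dD = dL * (bandMean (defect ν f t x₀ σ) β + (x - x₀)) := by
  have hev := h.eventually_update i
  have hLpos := bandMean_lengthDensity_pos h.1
  set L := bandMean (lengthDensity ν) β with hLdef
  have hup : Function.update β i (β i) = β := Function.update_eq_self i β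
  have hk : HasDerivAt (fun b => waveNumber ν (Function.update β i b)) (-dL / L ^ 2) (β i) := by
    have h1 : HasDerivAt (fun b => 1 / bandMean (lengthDensity ν) (Function.update β i b))
        (-dL / L ^ 2) (β i) := by
      have := hL.fun_inv (by rw [hup]; exact hLpos.ne')
      rw [hup] at this
      simpa only [one_div] using this
    exact h1.congr_of_eventuallyEq (hev.mono fun b hb => waveNumber_eq hb.1)
  have hc : HasDerivAt (fun b => phaseVelocity ν (Function.update β i b)) 1 (β i) := by
    have hid := hasDerivAt_id (β i)
    fin_cases i
    · simpa [phaseVelocity] using ((hid.add_const (β 1)).add_const (β 2)).add_const (2 * ν)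
    · simpa [phaseVelocity] using ((hid.const_add (β 0)).add_const (β 2)).add_const (2 * ν)
    · simpa [phaseVelocity] using (hid.const_add (β 0 + β 1)).add_const (2 * ν)
  have hω := hc.fun_mul hk
  -- By `bandMean_defect`, q is a combination of averages whose derivatives are given, so its
  -- derivative needs no separate computation.
  have hq : HasDerivAt (fun b => qShift f (Function.update β i b)) (-t - dD - σ * dL) (β i) := by
    have h1 := (((hc.mul_const t).const_sub x₀).sub hD).sub (hL.const_mul σ)
    refine (h1.congr_of_eventuallyEq (hev.mono fun b hb => ?_)).congr_deriv (by ring)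
    have := bandMean_defect hf hb t x₀ σ
    simp only [Pi.sub_apply]
    linarith
  have hq0 := bandMean_defect hf h t x₀ σ
  -- From k = 1/L and ∂_i c = 1: ∂_i(ck)/∂_i k = c + k/∂_i k = c - L/∂_iL.
  have hs : speed ν i β = phaseVelocity ν β - L / dL := by
    have h1 : partialD i (frequency ν) β = _ := hω.deriv
    have h2 : partialD i (waveNumber ν) β = _ := hk.deriv
    rw [speed, h1, h2, hup, waveNumber_eq h.1]
    change (1 * (1 / L) + _) / _ = _
    field_simp
    ring
  have hqd : partialD i (qShift f) β = -t - dD - σ * dL := hq.deriv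
  rw [wFun, hs, hqd] at hx
  rw [← hLdef] at hq0
  have : x = phaseVelocity ν β * t - L / dL * t + (x₀ - phaseVelocity ν β * t -
      bandMean (defect ν f t x₀ σ) β - σ * L + (- (L / dL)) * (-t - dD - σ * dL)) := by
    rw [hx]
    linear_combination hq0
  field_simp at this
  linear_combination -this

end Hodograph

/-! ### The leading edge -/

section Edge
variable {ν c d t xm u v : ℝ} {f : ℝ → ℝ}

theorem PhiFun_eq (hf : ∀ y ∈ Ioo c d, ContDiffAt ℝ ∞ f y) {a b : ℝ} (ha : a ∈ Ioo c d)
    (hb : b ∈ Ioo c d) :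
    PhiFun f a b = partialA (QPair f) (a, b) + partialB (QPair f) (a, b) := by
  have h := contDiffAt_QPair hf (p := (a, b)) ha hb
  rw [PhiFun]
  exact congrArg₂ (· + ·) (hasDerivAt_partialA h).deriv (hasDerivAt_partialB h).deriv

theorem eventually_mem_Ioo (hv : v ∈ Ioo c d) : ∀ᶠ b in 𝓝 v, b ∈ Ioo c d :=
  isOpen_Ioo.mem_nhds hv

theorem hasDerivAt_PhiFun (hf : ∀ y ∈ Ioo c d, ContDiffAt ℝ ∞ f y) (hu : u ∈ Ioo c d)
    {b : ℝ} (hb : b ∈ Ioo c d) :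
    HasDerivAt (fun b => PhiFun f u b)
      (partialB (partialA (QPair f)) (u, b) + partialB (partialB (QPair f)) (u, b)) b := by
  have h := contDiffAt_QPair hf (p := (u, b)) hu hb
  refine ((hasDerivAt_partialB h.partialA).add (hasDerivAt_partialB h.partialB)).congr_of_eventuallyEq
    ?_
  filter_upwards [eventually_mem_Ioo hb] with b' hb'
  exact PhiFun_eq hf hu hb'

theorem iteratedDeriv_PhiFun (hf : ∀ y ∈ Ioo c d, ContDiffAt ℝ ∞ f y) (hu : u ∈ Ioo c d)
    (hv : v ∈ Ioo c d) : iteratedDeriv 2 (fun b => PhiFun f u b) v =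
      partialB (partialB (partialA (QPair f))) (u, v) +
        partialB (partialB (partialB (QPair f))) (u, v) := by
  have h := contDiffAt_QPair hf (p := (u, v)) hu hv
  rw [iteratedDeriv_succ, iteratedDeriv_one]
  refine (HasDerivAt.congr_of_eventuallyEq
    ((hasDerivAt_partialB h.partialA.partialB).add (hasDerivAt_partialB h.partialB.partialB)) ?_).deriv
  filter_upwards [eventually_mem_Ioo hv] with b' hb'
  exact (hasDerivAt_PhiFun hf hu hb').deriv

theorem eventually_deriv_eq {φ ψ φ' ψ' : ℝ → ℝ} {v : ℝ} (h : ∀ᶠ b in 𝓝 v, φ b = ψ b)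
    (hφ : ∀ᶠ b in 𝓝 v, HasDerivAt φ (φ' b) b) (hψ : ∀ᶠ b in 𝓝 v, HasDerivAt ψ (ψ' b) b) :
    ∀ᶠ b in 𝓝 v, φ' b = ψ' b := by
  filter_upwards [h.eventually_nhds, hφ, hψ] with b hb h1 h2
  exact h1.unique (h2.congr_of_eventuallyEq hb)

theorem SmoothNear.eventually_hasDerivAt {F : ℝ × ℝ → ℝ} (hF : SmoothNear F (u, v)) :
    ∀ᶠ b in 𝓝 v, HasDerivAt (fun b => F (u, b)) (CHOnePhase.partialB F (u, b)) b := by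
  have hc : ContinuousAt (fun b : ℝ => (u, b)) v := by fun_prop
  exact (hc.eventually hF).mono fun b hb => hasDerivAt_partialB hb

/-- If `F + 2 (u - b) G` is constant in `b`, then so are its first two derivatives zero. -/
theorem identity_derivatives {F G : ℝ × ℝ → ℝ} {k : ℝ} (hF : SmoothNear F (u, v))
    (hG : SmoothNear G (u, v)) (h : ∀ᶠ b in 𝓝 v, F (u, b) + 2 * (u - b) * G (u, b) = k) :
    partialB F (u, v) - 2 * G (u, v) + 2 * (u - v) * partialB G (u, v) = 0 ∧
      partialB (partialB F) (u, v) - 4 * partialB G (u, v) +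
        2 * (u - v) * partialB (partialB G) (u, v) = 0 := by
  have hlin : ∀ b : ℝ, HasDerivAt (fun b => 2 * (u - b)) (-2) b := fun b => by
    simpa using ((hasDerivAt_id b).const_sub u).const_mul 2
  have h1 : ∀ᶠ b in 𝓝 v, partialB F (u, b) +
      (-2 * G (u, b) + 2 * (u - b) * partialB G (u, b)) = 0 := by
    refine eventually_deriv_eq h ?_ (Eventually.of_forall fun b => hasDerivAt_const b k)
    filter_upwards [hF.eventually_hasDerivAt, hG.eventually_hasDerivAt] with b h1 h2
    exact h1.add ((hlin b).mul h2)
  have h2 : ∀ᶠ b in 𝓝 v, partialB (partialB F) (u, b) + (-2 * partialB G (u, b) +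
      (-2 * partialB G (u, b) + 2 * (u - b) * partialB (partialB G) (u, b))) = 0 := by
    refine eventually_deriv_eq h1 ?_ (Eventually.of_forall fun b => hasDerivAt_const b 0)
    filter_upwards [hF.partialB.eventually_hasDerivAt, hG.eventually_hasDerivAt,
      hG.partialB.eventually_hasDerivAt] with b h1 h2 h3
    exact h1.add ((h2.const_mul (-2)).add ((hlin b).mul h3))
  constructor
  · linear_combination h1.self_of_nhds
  · linear_combination h2.self_of_nhds

/-- The value of the phase at the leading edge. -/
def edgePhase (ν : ℝ) (f : ℝ → ℝ) (t u v : ℝ) : ℝ :=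
  -2 * √((u - v) * (v + ν)) * (PhiFun f u v + 3 * t)

theorem contDiffAt_defect (hf : ∀ y ∈ Ioo c d, ContDiffAt ℝ ∞ f y) {p : ℝ × ℝ} (σ : ℝ)
    (h1 : p.1 ∈ Ioo c d) (h2 : p.2 ∈ Ioo c d) (h3 : 0 < p.2 + ν) (h4 : 0 < p.1 - p.2) :
    ContDiffAt ℝ ∞ (defect ν f t xm σ) p :=
  (ContDiffAt.sub (by fun_prop) (contDiffAt_QPair hf h1 h2)).sub
    (contDiffAt_const.mul (contDiffAt_lengthDensity h3 h4))

theorem smoothNear_defect (hf : ∀ y ∈ Ioo c d, ContDiffAt ℝ ∞ f y) {p : ℝ × ℝ} (σ : ℝ)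
    (h1 : p.1 ∈ Ioo c d) (h2 : p.2 ∈ Ioo c d) (h3 : 0 < p.2 + ν) (h4 : 0 < p.1 - p.2) :
    SmoothNear (defect ν f t xm σ) p := by
  have : Ioo c d ×ˢ Ioo c d ∈ 𝓝 p := (isOpen_Ioo.prod isOpen_Ioo).mem_nhds ⟨h1, h2⟩
  filter_upwards [this, eventually_admissible h3 h4] with q hq hq'
  exact contDiffAt_defect hf σ hq.1 hq.2 hq'.1 hq'.2

theorem partialA_defect (hf : ∀ y ∈ Ioo c d, ContDiffAt ℝ ∞ f y) {p : ℝ × ℝ} (σ : ℝ)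
    (h1 : p.1 ∈ Ioo c d) (h2 : p.2 ∈ Ioo c d) (h3 : 0 < p.2 + ν) (h4 : 0 < p.1 - p.2) :
    partialA (defect ν f t xm σ) p =
      -t - partialA (QPair f) p - σ * partialA (lengthDensity ν) p := by
  refine (hasDerivAt_partialA (contDiffAt_defect hf σ h1 h2 h3 h4)).unique ?_
  have hlin : HasDerivAt (fun a => xm - (a + 2 * p.2 + 2 * ν) * t) (-t) p.1 := by
    simpa using ((((hasDerivAt_id p.1).add_const (2 * p.2)).add_const (2 * ν)).mul_const
      t).const_sub xm
  exact (hlin.sub (hasDerivAt_partialA (contDiffAt_QPair hf h1 h2))).sub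
    ((hasDerivAt_partialA (contDiffAt_lengthDensity h3 h4)).const_mul σ)

theorem partialB_defect (hf : ∀ y ∈ Ioo c d, ContDiffAt ℝ ∞ f y) {p : ℝ × ℝ} (σ : ℝ)
    (h1 : p.1 ∈ Ioo c d) (h2 : p.2 ∈ Ioo c d) (h3 : 0 < p.2 + ν) (h4 : 0 < p.1 - p.2) :
    partialB (defect ν f t xm σ) p =
      -2 * t - partialB (QPair f) p - σ * partialB (lengthDensity ν) p := by
  refine (hasDerivAt_partialB (contDiffAt_defect hf σ h1 h2 h3 h4)).unique ?_
  have hlin : HasDerivAt (fun b => xm - (p.1 + 2 * b + 2 * ν) * t) (-2 * t) p.2 := by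
    simpa using (((((hasDerivAt_id p.2).const_mul 2).const_add p.1).add_const (2 * ν)).mul_const
      t).const_sub xm
  exact (hlin.sub (hasDerivAt_partialB (contDiffAt_QPair hf h1 h2))).sub
    ((hasDerivAt_partialB (contDiffAt_lengthDensity h3 h4)).const_mul σ)

/-- `QPair_identity` and the homogeneous relation for the length density combine so that the
right-hand side depends on a alone. At a = u the edge position makes it zero for every b. -/
theorem defect_identity (hf : ∀ y ∈ Ioo c d, ContDiffAt ℝ ∞ f y) {p : ℝ × ℝ} (σ : ℝ)
    (h1 : p.1 ∈ Ioo c d) (h2 : p.2 ∈ Ioo c d) (h3 : 0 < p.2 + ν) (h4 : 0 < p.1 - p.2) :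
    defect ν f t xm σ p + 2 * (p.1 - p.2) * partialA (defect ν f t xm σ) p =
      xm - (3 * p.1 + 2 * ν) * t - f p.1 := by
  rw [partialA_defect hf σ h1 h2 h3 h4, partialA_lengthDensity h3 h4, ← QPair_identity hf h1 h2,
    defect]
  field_simp
  ring

/-- The values at the leading edge of the derivatives of the defect. -/
structure EdgeDerivatives (D : ℝ × ℝ → ℝ) (s u v : ℝ) : Prop where
  smooth : SmoothNear D (u, v)
  zero : D (u, v) = 0
  dA : partialA D (u, v) = 0
  dB : partialB D (u, v) = 0
  dBA : partialB (partialA D) (u, v) = 0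
  dBB : partialB (partialB D) (u, v) = 0
  dBBA : partialB (partialB (partialA D)) (u, v) = 0
  dAA : partialA (partialA D) (u, v) = -s / (2 * (u - v))
  dBBB : partialB (partialB (partialB D)) (u, v) ≠ 0

/-- The choice of σ makes D vanish at (u, v). The identity D + 2(u-b)D_a = 0 in b then converts
b-derivatives of D into those of D_a. A second identity expresses 2(b+ν)(u-b)D_b - (u+ν)D as 2(b-u)
times a bracket E(b) = (u+ν)(t+Q_a) + (b+ν)(2t+Q_b) free of σ; the edge system amounts to E(v) =
E'(v) = 0, while E''(v) = 0 would force V = 0. -/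
theorem edgeDerivatives_defect (hf : ∀ y ∈ Ioo c d, ContDiffAt ℝ ∞ f y) (hu : u ∈ Ioo c d)
    (hv : v ∈ Ioo c d) (hνv : -ν < v) (hvu : v < u) (hedge : IsLeadingEdge ν f t xm u v)
    (hV : VFun ν f t u v ≠ 0) :
    EdgeDerivatives (defect ν f t xm (edgePhase ν f t u v)) (3 * t + deriv f u) u v := by
  have hm : 0 < v + ν := by linarith
  have huv : 0 < u - v := by linarith
  set σ := edgePhase ν f t u v with hσ
  set D := defect ν f t xm σ with hDdef
  set Q := QPair f with hQdef
  have hQ : SmoothNear Q (u, v) := smoothNear_QPair hf hu hv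
  have hD : SmoothNear D (u, v) := smoothNear_defect hf σ hu hv hm huv
  obtain ⟨hpos, hcrit, hdbl⟩ := hedge
  have hΦ := PhiFun_eq hf hu hv
  have hΦ1 := (hasDerivAt_PhiFun hf hu hv).deriv
  have hQa : deriv (fun a => QFun f a v) u = partialA Q (u, v) :=
    (hasDerivAt_partialA hQ.contDiffAt).deriv
  have evb : ∀ᶠ b in 𝓝 v, b ∈ Ioo c d ∧ 0 < b + ν ∧ 0 < u - b := by
    refine (eventually_mem_Ioo hv).and (Eventually.and ?_ ?_)
    · filter_upwards [lt_mem_nhds hνv] with b hb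
      linarith
    · filter_upwards [gt_mem_nhds hvu] with b hb
      linarith
  have idQ : ∀ᶠ b in 𝓝 v, Q (u, b) + 2 * (u - b) * partialA Q (u, b) = f u := by
    filter_upwards [evb] with b hb using QPair_identity hf (p := (u, b)) hu hb.1
  obtain ⟨q1, q2⟩ := identity_derivatives hQ hQ.partialA idQ
  have idD : ∀ᶠ b in 𝓝 v, D (u, b) + 2 * (u - b) * partialA D (u, b) = 0 := by
    filter_upwards [evb] with b hb
    rw [defect_identity hf (p := (u, b)) σ hu hb.1 hb.2.1 hb.2.2]
    linarith
  obtain ⟨d1, d2⟩ := identity_derivatives hD hD.partialA idD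
  have hΦ' : PhiFun f u v = partialA Q (u, v) + partialB Q (u, v) := hΦ
  have hΦ1' : deriv (fun b => PhiFun f u b) v =
      partialB (partialA Q) (u, v) + partialB (partialB Q) (u, v) := hΦ1
  have hΦ2 : iteratedDeriv 2 (fun b => PhiFun f u b) v = partialB (partialB (partialA Q)) (u, v) +
      partialB (partialB (partialB Q)) (u, v) := iteratedDeriv_PhiFun hf hu hv
  rw [hQa, hΦ'] at hcrit
  rw [hΦ', hΦ1'] at hdbl
  rw [VFun, hΦ2, hΦ'] at hV
  -- the density at the edge
  have hσg : σ * lengthDensity ν (u, v) =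
      -2 * (v + ν) * (partialA Q (u, v) + partialB Q (u, v) + 3 * t) := by
    have h1 := Real.sqrt_pos.2 huv
    have h2 := Real.sq_sqrt hm.le
    rw [hσ, edgePhase, hΦ', lengthDensity, Real.sqrt_mul huv.le, Real.sqrt_div hm.le]
    field_simp
    rw [h2]
  have z0 : D (u, v) = 0 := by
    have h1 := idQ.self_of_nhds
    rw [hDdef, defect, hσg]
    linear_combination hpos - h1 - 2 * hcrit
  have zA : partialA D (u, v) = 0 := by
    have h1 := idD.self_of_nhds
    rw [z0, zero_add] at h1
    exact (mul_eq_zero.1 h1).resolve_left (by positivity)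
  -- the second identity
  have idE : ∀ᶠ b in 𝓝 v, 2 * ((b + ν) * (u - b)) * partialB D (u, b) - (u + ν) * D (u, b) =
      2 * (b - u) * ((u + ν) * (t + partialA Q (u, b)) + (b + ν) * (2 * t + partialB Q (u, b))) := by
    filter_upwards [evb, idQ] with b hb hq
    have h1 := hb.2.1
    have h2 := hb.2.2
    rw [partialB_defect hf (p := (u, b)) σ hu hb.1 h1 h2, partialB_lengthDensity h1 h2, hDdef,
      defect]
    field_simp
    linear_combination (-(u + ν)) * hpos + (u + ν) * hq
  -- The bracket at b = v is exactly the right-hand side of `critical`.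
  have zE : (u + ν) * (t + partialA Q (u, v)) + (v + ν) * (2 * t + partialB Q (u, v)) = 0 := by
    linear_combination -hcrit
  have zB : partialB D (u, v) = 0 := by
    have h1 := idE.self_of_nhds
    rw [z0, zE] at h1
    have h2 : 2 * ((v + ν) * (u - v)) * partialB D (u, v) = 0 := by linear_combination h1
    exact (mul_eq_zero.1 h2).resolve_left (by positivity)
  have hp1 : ∀ b : ℝ, HasDerivAt (fun b => 2 * ((b + ν) * (u - b)))
      (2 * (u - 2 * b - ν)) b := fun b => by
    refine ((((hasDerivAt_id b).add_const ν).mul ((hasDerivAt_id b).const_sub u)).const_mul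
      2).congr_deriv ?_
    simp only [id]
    ring
  have hp2 : ∀ b : ℝ, HasDerivAt (fun b => 2 * (b - u)) 2 b := fun b => by
    simpa using ((hasDerivAt_id b).sub_const u).const_mul 2
  have hp3 : ∀ b : ℝ, HasDerivAt (fun b => b + ν) 1 b := fun b => (hasDerivAt_id b).add_const ν
  have hp4 : ∀ b : ℝ, HasDerivAt (fun b => 2 * (u - 2 * b - ν)) (-4) b := fun b => by
    refine (((((hasDerivAt_id b).const_mul 2).const_sub u).sub_const ν).const_mul 2).congr_deriv ?_
    ring
  have idE1 : ∀ᶠ b in 𝓝 v, (2 * (u - 2 * b - ν) * partialB D (u, b) +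
      2 * ((b + ν) * (u - b)) * partialB (partialB D) (u, b)) - (u + ν) * partialB D (u, b) =
      2 * ((u + ν) * (t + partialA Q (u, b)) + (b + ν) * (2 * t + partialB Q (u, b))) +
      2 * (b - u) * ((u + ν) * partialB (partialA Q) (u, b) + (1 * (2 * t + partialB Q (u, b)) +
        (b + ν) * partialB (partialB Q) (u, b))) := by
    refine eventually_deriv_eq idE ?_ ?_
    · filter_upwards [hD.eventually_hasDerivAt, hD.partialB.eventually_hasDerivAt] with b h1 h2
      exact ((hp1 b).mul h2).sub (h1.const_mul _)
    · filter_upwards [hQ.partialA.eventually_hasDerivAt,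
        hQ.partialB.eventually_hasDerivAt] with b h1 h2
      exact (hp2 b).mul (((h1.const_add t).const_mul _).add
        ((hp3 b).mul (h2.const_add (2 * t))))
  -- The first b-derivative of the bracket vanishes: this is `double`, rewritten with the once
  -- differentiated identity for Q and `critical`.
  have zE1 : (u + ν) * partialB (partialA Q) (u, v) + (2 * t + partialB Q (u, v)) +
      (v + ν) * partialB (partialB Q) (u, v) = 0 := by
    have h3 : 2 * (u - v) * ((u + ν) * partialB (partialA Q) (u, v) + (2 * t + partialB Q (u, v)) +
      (v + ν) * partialB (partialB Q) (u, v)) = 0 := by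
      linear_combination -hdbl + (u - v) * q1 - hcrit
    exact (mul_eq_zero.1 h3).resolve_left (by positivity)
  have zBB : partialB (partialB D) (u, v) = 0 := by
    have h1 := idE1.self_of_nhds
    have h2 : 2 * ((v + ν) * (u - v)) * partialB (partialB D) (u, v) = 0 := by
      rw [zB] at h1
      linear_combination h1 + 2 * zE + 2 * (v - u) * zE1
    exact (mul_eq_zero.1 h2).resolve_left (by positivity)
  have idE2 : ∀ᶠ b in 𝓝 v, ((-4 * partialB D (u, b) +
      2 * (u - 2 * b - ν) * partialB (partialB D) (u, b)) +
      (2 * (u - 2 * b - ν) * partialB (partialB D) (u, b) +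
      2 * ((b + ν) * (u - b)) * partialB (partialB (partialB D)) (u, b))) -
      (u + ν) * partialB (partialB D) (u, b) =
      2 * ((u + ν) * partialB (partialA Q) (u, b) + (1 * (2 * t + partialB Q (u, b)) +
        (b + ν) * partialB (partialB Q) (u, b))) +
      (2 * ((u + ν) * partialB (partialA Q) (u, b) + (1 * (2 * t + partialB Q (u, b)) +
        (b + ν) * partialB (partialB Q) (u, b))) +
      2 * (b - u) * ((u + ν) * partialB (partialB (partialA Q)) (u, b) +
        (1 * partialB (partialB Q) (u, b) + (1 * partialB (partialB Q) (u, b) +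
        (b + ν) * partialB (partialB (partialB Q)) (u, b))))) := by
    refine eventually_deriv_eq idE1 ?_ ?_
    · filter_upwards [hD.partialB.eventually_hasDerivAt,
        hD.partialB.partialB.eventually_hasDerivAt] with b h1 h2
      exact (((hp4 b).mul h1).add ((hp1 b).mul h2)).sub (h1.const_mul _)
    · filter_upwards [hQ.partialA.eventually_hasDerivAt,
        hQ.partialB.eventually_hasDerivAt, hQ.partialA.partialB.eventually_hasDerivAt,
        hQ.partialB.partialB.eventually_hasDerivAt] with b h1 h2 h3 h4
      exact ((((h1.const_add t).const_mul _).add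
        ((hp3 b).mul (h2.const_add (2 * t)))).const_mul 2).add ((hp2 b).mul ((h3.const_mul _).add
        (((h2.const_add (2 * t)).const_mul 1).add ((hp3 b).mul h4))))
  refine ⟨hD, z0, zA, zB, ?_, zBB, ?_, ?_, ?_⟩
  · rw [zB, zA] at d1
    have h2 : 2 * (u - v) * partialB (partialA D) (u, v) = 0 := by linear_combination d1
    exact (mul_eq_zero.1 h2).resolve_left (by positivity)
  · have dBA : partialB (partialA D) (u, v) = 0 := by
      rw [zB, zA] at d1
      have h2 : 2 * (u - v) * partialB (partialA D) (u, v) = 0 := by linear_combination d1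
      exact (mul_eq_zero.1 h2).resolve_left (by positivity)
    rw [zBB, dBA] at d2
    have h2 : 2 * (u - v) * partialB (partialB (partialA D)) (u, v) = 0 := by
      linear_combination d2
    exact (mul_eq_zero.1 h2).resolve_left (by positivity)
  -- Differentiating `defect_identity` in a at (u, v) leaves 3D_a + 2(u-v)D_aa = -3t - f'(u), with
  -- D_a = 0.
  · have hfu : HasDerivAt f (deriv f u) u := ((hf u hu).differentiableAt (by simp)).hasDerivAt
    have eva : ∀ᶠ a in 𝓝 u, D (a, v) + 2 * (a - v) * partialA D (a, v) =
        xm - (3 * a + 2 * ν) * t - f a := by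
      filter_upwards [eventually_mem_Ioo hu, lt_mem_nhds hvu] with a ha ha'
      exact defect_identity hf (p := (a, v)) σ ha hv hm (by simpa using ha')
    have l1 : HasDerivAt (fun a => 2 * (a - v)) 2 u := by
      simpa using ((hasDerivAt_id u).sub_const v).const_mul 2
    have l2 : HasDerivAt (fun a => xm - (3 * a + 2 * ν) * t) (-3 * t) u := by
      simpa using ((((hasDerivAt_id u).const_mul 3).add_const (2 * ν)).mul_const t).const_sub xm
    have h1 := (hasDerivAt_partialA hD.contDiffAt).add
      (l1.mul (hasDerivAt_partialA hD.contDiffAt.partialA))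
    have h2 := h1.unique ((l2.sub hfu).congr_of_eventuallyEq eva)
    dsimp only at h2
    rw [zA] at h2
    rw [eq_div_iff (by positivity)]
    linear_combination h2
  -- If D_bbb vanished, so would the second derivative of the bracket; V is a linear combination of
  -- that quantity and of relations already known to vanish.
  · intro hzero
    have h1 := idE2.self_of_nhds
    rw [zB, zBB, hzero] at h1
    have h3 : 2 * (u - v) * ((u + ν) * partialB (partialB (partialA Q)) (u, v) +
        2 * partialB (partialB Q) (u, v) +
        (v + ν) * partialB (partialB (partialB Q)) (u, v)) = 0 := by
      linear_combination h1 + 4 * zE1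
    have zE2 := (mul_eq_zero.1 h3).resolve_left (by positivity)
    refine hV ?_
    generalize partialB (partialB (partialA Q)) (u, v) = Q112 at *
    generalize partialB (partialB (partialB Q)) (u, v) = Q222 at *
    generalize partialB (partialB Q) (u, v) = Q22 at *
    generalize partialB (partialA Q) (u, v) = Q12 at *
    generalize partialA Q (u, v) = Q1 at *
    generalize partialB Q (u, v) = Q2 at *
    linear_combination (4 * (v + ν) * (u - v) ^ 2) * zE2 - 2 * (v + ν) * (u - v) ^ 2 * q2 -
      6 * (u - v) ^ 2 * zE1 + (u - v) * (3 * (u + ν) - 4 * (v + ν)) * q1 +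
      3 * ((u + ν) - 2 * (v + ν)) * zE

end Edge

/-! ### Asymptotics of the solution of the hodograph system -/

/-- The distance to the leading edge, of the size of the squared gap. -/
def edgeSize (u v : ℝ) (β : Fin 3 → ℝ) : ℝ := |β 0 - u| + |center β - v| + halfGap β ^ 2

theorem edgeSize_nonneg (u v : ℝ) (β : Fin 3 → ℝ) : 0 ≤ edgeSize u v β := by
  unfold edgeSize
  positivity

section Bounds
variable {ι : Type*} {l : Filter ι} {β : ι → Fin 3 → ℝ} {u v : ℝ} {F : ℝ × ℝ → ℝ}

/-- The branch points converge to `(u, v, v)`. -/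
def TendstoEdge (l : Filter ι) (β : ι → Fin 3 → ℝ) (u v : ℝ) : Prop :=
  Tendsto (fun x => (β x 0, center (β x), halfGap (β x))) l (𝓝 (u, v, 0))

theorem tendstoEdge_of (h0 : Tendsto (fun x => β x 0) l (𝓝 u))
    (h1 : Tendsto (fun x => β x 1) l (𝓝 v)) (h2 : Tendsto (fun x => β x 2) l (𝓝 v)) :
    TendstoEdge l β u v := by
  refine h0.prodMk_nhds (Tendsto.prodMk_nhds ?_ ?_)
  · simpa [center] using (h1.add h2).div_const 2
  · simpa [halfGap] using (h1.sub h2).div_const 2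

namespace TendstoEdge

variable (h : TendstoEdge l β u v)
include h

theorem tendsto_pair : Tendsto (fun x => (β x 0, center (β x))) l (𝓝 (u, v)) :=
  (Continuous.tendsto' (f := fun p : ℝ × ℝ × ℝ => (p.1, p.2.1)) (by fun_prop) (u, v, 0) (u, v)
    rfl).comp h

theorem tendsto_halfGap : Tendsto (fun x => halfGap (β x)) l (𝓝 0) :=
  (Continuous.tendsto' (f := fun p : ℝ × ℝ × ℝ => p.2.2) (by fun_prop) (u, v, 0) 0 rfl).comp h

theorem tendsto_edgeSize : Tendsto (fun x => edgeSize u v (β x)) l (𝓝 0) :=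
  (Continuous.tendsto' (f := fun p : ℝ × ℝ × ℝ => |p.1 - u| + |p.2.1 - v| + p.2.2 ^ 2)
    (by fun_prop) (u, v, 0) 0 (by simp)).comp h

end TendstoEdge

theorem isBigO_edgeSize_of_abs_le {φ : ι → ℝ} (hφ : ∀ x, |φ x| ≤ edgeSize u v (β x)) :
    φ =O[l] fun x => edgeSize u v (β x) :=
  IsBigO.of_bound 1 (Eventually.of_forall fun x => by
    rw [Real.norm_eq_abs, Real.norm_eq_abs, abs_of_nonneg (edgeSize_nonneg u v _), one_mul]
    exact hφ x)

theorem fst_isBigO : (fun x => β x 0 - u) =O[l] fun x => edgeSize u v (β x) :=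
  isBigO_edgeSize_of_abs_le fun x => by
    unfold edgeSize
    linarith [abs_nonneg (center (β x) - v), sq_nonneg (halfGap (β x))]

theorem center_isBigO : (fun x => center (β x) - v) =O[l] fun x => edgeSize u v (β x) :=
  isBigO_edgeSize_of_abs_le fun x => by
    unfold edgeSize
    linarith [abs_nonneg (β x 0 - u), sq_nonneg (halfGap (β x))]

theorem halfGap_sq_isBigO : (fun x => halfGap (β x) ^ 2) =O[l] fun x => edgeSize u v (β x) :=
  isBigO_edgeSize_of_abs_le fun x => by
    unfold edgeSize
    rw [abs_of_nonneg (sq_nonneg _)]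
    linarith [abs_nonneg (center (β x) - v), abs_nonneg (β x 0 - u)]

theorem isBigO_sq_of_tendsto_zero {φ : ι → ℝ} (hφ : Tendsto φ l (𝓝 0)) :
    (fun x => φ x ^ 2) =O[l] φ := by
  have h1 : φ =O[l] fun _ => (1 : ℝ) := hφ.isBigO_one ℝ
  simpa [sq] using h1.mul (isBigO_refl φ l)

theorem linear_pair_isBigO (hβ : TendstoEdge l β u v) (hF : SmoothNear F (u, v)) :
    (fun x => F (β x 0, center (β x)) - (F (u, v) + (β x 0 - u) * partialA F (u, v) +
      (center (β x) - v) * partialB F (u, v))) =O[l] fun x => edgeSize u v (β x) ^ 2 := by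
  refine ((sub_linear_isBigO hF.contDiffAt).comp_tendsto hβ.tendsto_pair).trans ?_
  refine IsBigO.pow (IsBigO.add ?_ ?_) 2
  · exact fst_isBigO.abs_left
  · exact center_isBigO.abs_left

theorem pair_isBigO (hβ : TendstoEdge l β u v) (hF : SmoothNear F (u, v)) :
    (fun x => F (β x 0, center (β x)) - F (u, v)) =O[l] fun x => edgeSize u v (β x) := by
  have h1 := (linear_pair_isBigO hβ hF).trans (isBigO_sq_of_tendsto_zero hβ.tendsto_edgeSize)
  have h2 := ((fst_isBigO (l := l) (β := β) (u := u) (v := v)).const_mul_left (partialA F (u, v))).add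
    ((center_isBigO (l := l) (β := β) (u := u) (v := v)).const_mul_left (partialB F (u, v)))
  exact (h1.add h2).congr_left fun x => by ring

theorem bandMean_sub_pair_isBigO (hβ : TendstoEdge l β u v) (hF : SmoothNear F (u, v)) :
    (fun x => bandMean F (β x) - (F (β x 0, center (β x)) +
      partialB (partialB F) (β x 0, center (β x)) / 4 * halfGap (β x) ^ 2)) =O[l]
      fun x => halfGap (β x) ^ 4 :=
  (cosMean_sub_isBigO hF).comp_tendsto hβ

/-- The edge size r weighs δ² like a first power of β₁-u and m-v, so the terms displayed are all
those of order r, and δ⁴ is O(r²). -/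
theorem bandMean_isBigO (hβ : TendstoEdge l β u v) (hF : SmoothNear F (u, v)) :
    (fun x => bandMean F (β x) - (F (u, v) + (β x 0 - u) * partialA F (u, v) +
      (center (β x) - v) * partialB F (u, v) + partialB (partialB F) (u, v) / 4 * halfGap (β x) ^ 2))
      =O[l] fun x => edgeSize u v (β x) ^ 2 := by
  have h1 : (fun x => halfGap (β x) ^ 4) =O[l] fun x => edgeSize u v (β x) ^ 2 :=
    ((halfGap_sq_isBigO (u := u) (v := v)).pow 2).congr_left fun x => by ring
  have h2 := (bandMean_sub_pair_isBigO hβ hF).trans h1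
  have h3 := linear_pair_isBigO hβ hF
  have h4 := ((pair_isBigO hβ hF.partialB.partialB).mul (halfGap_sq_isBigO (β := β) (l := l) (u := u) (v := v))).congr_right
    (g₂ := fun x => edgeSize u v (β x) ^ 2) fun x => by ring
  exact ((h2.add h3).add (h4.const_mul_left (1 / 4))).congr_left fun x => by ring

theorem bandMean_sub_const_isBigO (hβ : TendstoEdge l β u v) (hF : SmoothNear F (u, v)) :
    (fun x => bandMean F (β x) - F (u, v)) =O[l] fun x => edgeSize u v (β x) := by
  have h1 := (bandMean_isBigO hβ hF).trans (isBigO_sq_of_tendsto_zero hβ.tendsto_edgeSize)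
  have h2 := ((fst_isBigO (l := l) (β := β) (u := u) (v := v)).const_mul_left (partialA F (u, v))).add
    ((center_isBigO (l := l) (β := β) (u := u) (v := v)).const_mul_left (partialB F (u, v)))
  have h3 := (halfGap_sq_isBigO (l := l) (β := β) (u := u) (v := v)).const_mul_left
    (partialB (partialB F) (u, v) / 4)
  exact ((h1.add h2).add h3).congr_left fun x => by ring

theorem tendsto_bandMean (hβ : TendstoEdge l β u v) (hF : SmoothNear F (u, v)) :
    Tendsto (fun x => bandMean F (β x)) l (𝓝 (F (u, v))) :=
  tendsto_sub_nhds_zero_iff.1 ((bandMean_sub_const_isBigO hβ hF).trans_tendsto hβ.tendsto_edgeSize)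

/-- The scaled first moment. -/
def momentRatio (F : ℝ × ℝ → ℝ) (β : Fin 3 → ℝ) : ℝ :=
  cosMoment F (β 0) (center β) (halfGap β) / halfGap β

/-- The first moment itself tends to zero with δ; dividing by δ leaves half the derivative of F, so
the third critical equation keeps its content as β₂ and β₃ merge. -/
theorem momentRatio_isBigO (hβ : TendstoEdge l β u v) (hδ : ∀ᶠ x in l, 0 < halfGap (β x))
    (hF : SmoothNear F (u, v)) :
    (fun x => momentRatio F (β x) - partialB F (β x 0, center (β x)) / 2) =O[l]
      fun x => halfGap (β x) ^ 2 := by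
  have h1 : (fun x => cosMoment F (β x 0) (center (β x)) (halfGap (β x)) -
      partialB F (β x 0, center (β x)) / 2 * halfGap (β x)) =O[l] fun x => halfGap (β x) ^ 3 :=
    (cosMoment_sub_isBigO hF).comp_tendsto hβ
  have h2 := h1.mul (isBigO_refl (fun x => (halfGap (β x))⁻¹) l)
  refine h2.congr' ?_ ?_
  · filter_upwards [hδ] with x hx
    rw [momentRatio]
    field_simp
  · filter_upwards [hδ] with x hx
    field_simp

/-- Where |r| < 1/(2C), the term Cr² is at most |r|/2 and can be moved to the left. -/
theorem isBigO_absorb {r X : ι → ℝ} (hr : Tendsto r l (𝓝 0))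
    (h : r =O[l] fun x => |X x| + r x ^ 2) : r =O[l] X := by
  obtain ⟨C, hC, hb⟩ := h.exists_pos
  have hsmall : ∀ᶠ x in l, |r x| < 1 / (2 * C) := by
    have := hr.abs
    rw [abs_zero] at this
    exact this.eventually (gt_mem_nhds (by positivity))
  refine IsBigO.of_bound (2 * C) ?_
  filter_upwards [hb.bound, hsmall] with x h1 h2
  rw [Real.norm_eq_abs, Real.norm_of_nonneg (by positivity), ← sq_abs (r x)] at h1
  rw [Real.norm_eq_abs, Real.norm_eq_abs]
  have h3 : C * |r x| ^ 2 ≤ |r x| / 2 := by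
    have h4 : C * |r x| ≤ 1 / 2 := by
      calc C * |r x| ≤ C * (1 / (2 * C)) := by gcongr
        _ = 1 / 2 := by field_simp
    nlinarith [abs_nonneg (r x)]
  nlinarith

end Bounds

/-! ### Inverting the critical equations near the edge -/

section Solve
variable {ι : Type*} {l : Filter ι} {β : ι → Fin 3 → ℝ} {u v ν s : ℝ} {D : ℝ × ℝ → ℝ} {X : ι → ℝ}

/-- The critical point equations in terms of averages. -/
structure CriticalEquations (D g : ℝ × ℝ → ℝ) (X : ℝ) (β : Fin 3 → ℝ) : Prop where
  eqA : bandMean g β * bandMean (partialA D) β = bandMean (partialA g) β * (bandMean D β + X)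
  eqB : bandMean g β * bandMean (partialB D) β = bandMean (partialB g) β * (bandMean D β + X)
  eqC : bandMean g β * momentRatio (partialB D) β =
    momentRatio (partialB g) β * (bandMean D β + X)

/-- The linearised equations are triangular. Up to O(|X| + r²), the A-equation bounds D_aa(β₁-u),
the B-equation bounds D_bbb δ²/4, and the C-equation, given these two, bounds D_bbb(m-v)/2. Adding
gives r = O(|X| + r²), hence r = O(X). As D vanishes to first order and D_bb = 0 at the edge, ⟨D⟩ =
O(r²). -/
theorem edge_asymptotics {g : ℝ × ℝ → ℝ} (hg : SmoothNear g (u, v)) (hg0 : g (u, v) ≠ 0)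
    (hgB : partialB g (u, v) ≠ 0) (hβ : TendstoEdge l β u v) (hδ : ∀ᶠ x in l, 0 < halfGap (β x))
    (hX : Tendsto X l (𝓝 0)) (huv : v < u) (hs : s ≠ 0) (hD : EdgeDerivatives D s u v)
    (heq : ∀ᶠ x in l, CriticalEquations D g (X x) (β x)) :
    (fun x => edgeSize u v (β x)) =O[l] X ∧ X =O[l] (fun x => halfGap (β x) ^ 2) ∧
      (fun x => bandMean D (β x)) =O[l] (fun x => X x ^ 2) ∧
      (fun x => -s / (2 * (u - v)) * (β x 0 - u) - partialA g (u, v) / g (u, v) * X x) =O[l]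
        fun x => X x ^ 2 := by
  have huv' : 0 < u - v := by linarith
  set r := fun x => edgeSize u v (β x) with hr
  have hr0 : Tendsto r l (𝓝 0) := hβ.tendsto_edgeSize
  have hL := tendsto_bandMean hβ hg
  have hLne : ∀ᶠ x in l, bandMean g (β x) ≠ 0 := hL.eventually_ne hg0
  have hinv : Tendsto (fun x => (bandMean g (β x))⁻¹) l (𝓝 (g (u, v))⁻¹) := hL.inv₀ hg0
  have hinv1 : (fun x => (bandMean g (β x))⁻¹) =O[l] fun _ => (1 : ℝ) := hinv.isBigO_one ℝ
  -- sizes of the terms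
  have oA : (fun x => β x 0 - u) =O[l] r := fst_isBigO
  have oM : (fun x => center (β x) - v) =O[l] r := center_isBigO
  have oδ : (fun x => halfGap (β x) ^ 2) =O[l] r := halfGap_sq_isBigO
  have eD : (fun x => bandMean D (β x)) =O[l] fun x => r x ^ 2 := by
    refine (bandMean_isBigO hβ hD.smooth).congr_left fun x => ?_
    rw [hD.zero, hD.dA, hD.dB, hD.dBB]
    ring
  have eDA : (fun x => bandMean (partialA D) (β x) - -s / (2 * (u - v)) * (β x 0 - u)) =O[l]
      fun x => r x ^ 2 := by
    refine (bandMean_isBigO hβ hD.smooth.partialA).congr_left fun x => ?_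
    rw [hD.dA, hD.dAA, hD.dBA, hD.dBBA]
    ring
  have eDB : (fun x => bandMean (partialB D) (β x) -
      partialB (partialB (partialB D)) (u, v) / 4 * halfGap (β x) ^ 2) =O[l]
      fun x => r x ^ 2 := by
    refine (bandMean_isBigO hβ hD.smooth.partialB).congr_left fun x => ?_
    rw [hD.dB, partial_comm hD.smooth.contDiffAt, hD.dBA, hD.dBB]
    ring
  -- orders relative to `|X| + r²`
  set W := fun x => |X x| + r x ^ 2 with hW
  have oXW : X =O[l] W := IsBigO.of_bound 1 (Eventually.of_forall fun x => by
    have : 0 ≤ |X x| + r x ^ 2 := by positivity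
    rw [one_mul, Real.norm_eq_abs, Real.norm_of_nonneg this]
    linarith [sq_nonneg (r x)])
  have orW : (fun x => r x ^ 2) =O[l] W := IsBigO.of_bound 1 (Eventually.of_forall fun x => by
    have : 0 ≤ |X x| + r x ^ 2 := by positivity
    rw [one_mul, Real.norm_of_nonneg (sq_nonneg _), Real.norm_of_nonneg this]
    linarith [abs_nonneg (X x)])
  have oY : (fun x => bandMean D (β x) + X x) =O[l] W := (eD.trans orW).add oXW
  -- Each critical equation is divided by the average of g, which has a nonzero limit.
  have quot : ∀ {P Q : (Fin 3 → ℝ) → ℝ}, (fun x => Q (β x)) =O[l] (fun _ => (1 : ℝ)) →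
      (∀ᶠ x in l, bandMean g (β x) * P (β x) = Q (β x) * (bandMean D (β x) + X x)) →
      (fun x => P (β x)) =O[l] W := by
    intro P Q hQ hPQ
    have h1 := (hinv1.mul hQ).mul oY
    refine (h1.congr' ?_ (Eventually.of_forall fun x => by ring))
    filter_upwards [hPQ, hLne] with x hx hx'
    rw [mul_assoc, ← hx]
    field_simp
  have bA := (tendsto_bandMean hβ hg.partialA).isBigO_one ℝ
  have bB := (tendsto_bandMean hβ hg.partialB).isBigO_one ℝ
  have r1 : r =O[l] fun _ => (1 : ℝ) := hr0.isBigO_one ℝ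
  have wA := quot (P := bandMean (partialA D)) (Q := bandMean (partialA g)) bA
    (heq.mono fun x hx => hx.eqA)
  have wB := quot (P := bandMean (partialB D)) (Q := bandMean (partialB g)) bB
    (heq.mono fun x hx => hx.eqB)
  have bC : (fun x => momentRatio (partialB g) (β x)) =O[l] fun _ => (1 : ℝ) := by
    have h1 := (momentRatio_isBigO hβ hδ hg.partialB).trans (oδ.trans r1)
    have h2 := (hg.partialB.partialB.continuousAt.tendsto.comp hβ.tendsto_pair).isBigO_one ℝ
    exact (h1.add (h2.const_mul_left (1 / 2))).congr_left fun x => by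
      simp only [Function.comp]
      ring
  have wC := quot (P := momentRatio (partialB D)) (Q := momentRatio (partialB g)) bC
    (heq.mono fun x hx => hx.eqC)
  have cA : -s / (2 * (u - v)) ≠ 0 := div_ne_zero (neg_ne_zero.2 hs) (by positivity)
  have cB : partialB (partialB (partialB D)) (u, v) / 4 ≠ 0 :=
    div_ne_zero hD.dBBB (by norm_num)
  have kA : (fun x => β x 0 - u) =O[l] W := by
    rw [← isBigO_const_mul_left_iff cA]
    exact (wA.sub (eDA.trans orW)).congr_left fun x => by ring
  have kδ : (fun x => halfGap (β x) ^ 2) =O[l] W := by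
    rw [← isBigO_const_mul_left_iff cB]
    exact (wB.sub (eDB.trans orW)).congr_left fun x => by ring
  have kM : (fun x => center (β x) - v) =O[l] W := by
    rw [← isBigO_const_mul_left_iff hD.dBBB]
    have h1 := (momentRatio_isBigO hβ hδ hD.smooth.partialB).trans kδ
    have h2 := (linear_pair_isBigO hβ hD.smooth.partialB.partialB).trans orW
    have h3 := kA.const_mul_left (partialA (partialB (partialB D)) (u, v))
    refine ((((wC.sub h1).const_mul_left 2).sub h2).sub h3).congr_left fun x => ?_
    rw [hD.dBB]
    ring
  have orX : r =O[l] X := isBigO_absorb hr0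
    (((kA.abs_left.add kM.abs_left).add kδ).congr_left fun x => rfl)
  have orX2 : (fun x => r x ^ 2) =O[l] fun x => X x ^ 2 := orX.pow 2
  have eDX := eD.trans orX2
  refine ⟨orX, ?_, eDX, ?_⟩
  -- The B-equation is now solved for X, which is possible because ∂_b g ≠ 0 at the edge.
  · refine isBigO_absorb hX ?_
    have hBinv : Tendsto (fun x => (bandMean (partialB g) (β x))⁻¹) l
        (𝓝 (partialB g (u, v))⁻¹) := (tendsto_bandMean hβ hg.partialB).inv₀ hgB
    have hBne := (tendsto_bandMean hβ hg.partialB).eventually_ne hgB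
    set W2 := fun x => |halfGap (β x) ^ 2| + X x ^ 2 with hW2
    have o1 : (fun x => halfGap (β x) ^ 2) =O[l] W2 := IsBigO.of_bound 1 (Eventually.of_forall
      fun x => by
        have : 0 ≤ |halfGap (β x) ^ 2| + X x ^ 2 := by positivity
        rw [one_mul, Real.norm_eq_abs, Real.norm_of_nonneg this]
        linarith [sq_nonneg (X x)])
    have o2 : (fun x => X x ^ 2) =O[l] W2 := IsBigO.of_bound 1 (Eventually.of_forall fun x => by
        have : 0 ≤ |halfGap (β x) ^ 2| + X x ^ 2 := by positivity
        rw [one_mul, Real.norm_of_nonneg (sq_nonneg _), Real.norm_of_nonneg this]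
        linarith [abs_nonneg (halfGap (β x) ^ 2)])
    have h1 : (fun x => bandMean (partialB D) (β x)) =O[l] W2 :=
      ((eDB.trans (orX2.trans o2)).add (o1.const_mul_left _)).congr_left fun x =>
        sub_add_cancel _ _
    have h2 := (((hBinv.isBigO_one ℝ).mul (hL.isBigO_one ℝ)).mul h1).congr_right
      (g₂ := W2) fun x => by ring
    have h3 := h2.sub (eDX.trans o2)
    refine h3.congr' ?_ EventuallyEq.rfl
    filter_upwards [heq, hBne] with x hx hx'
    rw [mul_assoc, hx.eqB, inv_mul_cancel_left₀ hx']
    ring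
  -- Replacing the ratio of averages ⟨∂ₐg⟩/⟨g⟩ by its edge value costs O(X), hence O(X²) after
  -- multiplication by X.
  · have h1 : (fun x => (bandMean g (β x))⁻¹ * (bandMean (partialA g) (β x) * g (u, v) -
        partialA g (u, v) * bandMean g (β x)) * X x) =O[l] fun x => X x ^ 2 := by
      have h2 : (fun x => bandMean (partialA g) (β x) * g (u, v) -
        partialA g (u, v) * bandMean g (β x)) =O[l] X := by
        refine (((bandMean_sub_const_isBigO hβ hg.partialA).const_mul_left (g (u, v))).sub
          ((bandMean_sub_const_isBigO hβ hg).const_mul_left (partialA g (u, v)))).trans orX |>.congr_left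
          fun x => by ring
      exact ((hinv1.mul h2).mul (isBigO_refl X l)).congr_right fun x => by ring
    have h3 : (fun x => (bandMean g (β x))⁻¹ * bandMean (partialA g) (β x) *
        bandMean D (β x)) =O[l] fun x => X x ^ 2 :=
      ((hinv1.mul bA).mul eDX).congr_right fun x => by ring
    have h4 := ((h1.const_mul_left (g (u, v))⁻¹).add h3).sub (eDA.trans orX2)
    refine h4.congr' ?_ EventuallyEq.rfl
    filter_upwards [heq, hLne] with x hx hx'
    have h5 : bandMean (partialA D) (β x) = (bandMean g (β x))⁻¹ *
        (bandMean (partialA g) (β x) * (bandMean D (β x) + X x)) := by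
      rw [← hx.eqA, inv_mul_cancel_left₀ hx']
    rw [h5]
    field_simp
    ring

end Solve

/-! ### From the hodograph equations to the expansions of β₁ and ξ -/

section HodographAsymptotics
variable {ν c d t xm u v : ℝ} {f : ℝ → ℝ} {β : ℝ → Fin 3 → ℝ}

theorem tendsto_cosMoment {ι : Type*} {l : Filter ι} {β : ι → Fin 3 → ℝ} {F : ℝ × ℝ → ℝ}
    (hβ : TendstoEdge l β u v) (hF : SmoothNear F (u, v)) :
    Tendsto (fun x => cosMoment F (β x 0) (center (β x)) (halfGap (β x))) l (𝓝 0) := by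
  have h1 : (fun x => cosMoment F (β x 0) (center (β x)) (halfGap (β x)) -
      partialB F (β x 0, center (β x)) / 2 * halfGap (β x)) =O[l] fun x => halfGap (β x) ^ 3 :=
    (cosMoment_sub_isBigO hF).comp_tendsto hβ
  have h0 := hβ.tendsto_halfGap
  have h2 := h1.trans_tendsto (by simpa using h0.pow 3)
  have h3 := ((hF.partialB.continuousAt.tendsto.comp hβ.tendsto_pair).div_const 2).mul h0
  have h4 := h2.add h3
  simpa using! h4

/-- The sum of the equations for β₂ and β₃ is the equation between averages. Their difference
involves only first moments and may be divided by δ > 0. -/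
theorem criticalEquations_of_hodograph (hf : ∀ y ∈ Ioo c d, ContDiffAt ℝ ∞ f y) {x σ : ℝ}
    {β : Fin 3 → ℝ} (h : Admissible ν c d β) (hhod : SolvesHodograph ν f x t β)
    (hA : bandMean (partialA (lengthDensity ν)) β ≠ 0)
    (hB1 : bandMean (partialB (lengthDensity ν)) β +
      cosMoment (partialB (lengthDensity ν)) (β 0) (center β) (halfGap β) ≠ 0)
    (hB2 : bandMean (partialB (lengthDensity ν)) β -
      cosMoment (partialB (lengthDensity ν)) (β 0) (center β) (halfGap β) ≠ 0) :
    CriticalEquations (defect ν f t xm σ) (lengthDensity ν) (x - xm) β := by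
  have sL := smoothOnBand_lengthDensity h.1
  have sD := smoothOnBand_defect hf h t xm σ
  have e0 := hodograph_critical hf h (hhod 0) (hasDerivAt_bandMean_zero sL)
    (hasDerivAt_bandMean_zero sD) hA
  have e1 := hodograph_critical hf h (hhod 1) (hasDerivAt_bandMean_one sL)
    (hasDerivAt_bandMean_one sD) (div_ne_zero hB1 two_ne_zero)
  have e2 := hodograph_critical hf h (hhod 2) (hasDerivAt_bandMean_two sL)
    (hasDerivAt_bandMean_two sD) (div_ne_zero hB2 two_ne_zero)
  have hδ : halfGap β ≠ 0 := by
    have := h.1.2.1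
    unfold halfGap
    exact (by linarith : 0 < (β 1 - β 2) / 2).ne'
  refine ⟨e0, by linear_combination e1 + e2, ?_⟩
  rw [momentRatio, momentRatio]
  field_simp
  linear_combination e1 - e2

/-- The derivatives of L do not vanish near the edge: the averages of ∂ₐg and ∂_b g tend to nonzero
values and the cosine moment tends to zero. -/
theorem eventually_criticalEquations (hf : ∀ y ∈ Ioo c d, ContDiffAt ℝ ∞ f y) {σ : ℝ}
    (hνv : -ν < v) (hvu : v < u) (hβ : TendstoEdge (𝓝[>] xm) β u v)
    (hadm : ∀ᶠ x in 𝓝[>] xm, Admissible ν c d (β x))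
    (hhod : ∀ᶠ x in 𝓝[>] xm, SolvesHodograph ν f x t (β x)) :
    ∀ᶠ x in 𝓝[>] xm, CriticalEquations (defect ν f t xm σ) (lengthDensity ν) (x - xm) (β x) := by
  have hm : 0 < v + ν := by linarith
  have huv : 0 < u - v := by linarith
  have hg : SmoothNear (lengthDensity ν) (u, v) := smoothNear_lengthDensity hm huv
  have hgpos : 0 < lengthDensity ν (u, v) := Real.sqrt_pos.2 (div_pos hm huv)
  have hgA : partialA (lengthDensity ν) (u, v) ≠ 0 := by
    rw [partialA_lengthDensity (p := (u, v)) hm huv]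
    exact div_ne_zero (neg_ne_zero.2 hgpos.ne') (by positivity)
  have hgB : partialB (lengthDensity ν) (u, v) ≠ 0 := by
    rw [partialB_lengthDensity (p := (u, v)) hm huv]
    have : 0 < u + ν := by linarith
    exact (div_pos (mul_pos hgpos this) (by positivity)).ne'
  have t1 := tendsto_bandMean hβ hg.partialA
  have t2 := tendsto_bandMean hβ hg.partialB
  have t3 := tendsto_cosMoment hβ hg.partialB
  filter_upwards [hadm, hhod, t1.eventually_ne hgA,
    (t2.add t3).eventually_ne (by simpa using hgB),
    (t2.sub t3).eventually_ne (by simpa using hgB)] with x h1 h2 h3 h4 h5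
  exact criticalEquations_of_hodograph hf h1 h2 h3 h4 h5

/-- The asymptotics of the solution of the hodograph system and of the phase at the leading
edge. -/
theorem hodograph_asymptotics (hf : ∀ y ∈ Ioo c d, ContDiffAt ℝ ∞ f y) (hu : u ∈ Ioo c d)
    (hv : v ∈ Ioo c d) (hνv : -ν < v) (hvu : v < u) (hedge : IsLeadingEdge ν f t xm u v)
    (hslope : 3 * t + deriv f u ≠ 0) (hV : VFun ν f t u v ≠ 0)
    (hβ : TendstoEdge (𝓝[>] xm) β u v) (hadm : ∀ᶠ x in 𝓝[>] xm, Admissible ν c d (β x))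
    (hhod : ∀ᶠ x in 𝓝[>] xm, SolvesHodograph ν f x t (β x)) :
    (fun x => edgeSize u v (β x)) =O[𝓝[>] xm] (fun x => halfGap (β x) ^ 2) ∧
      (fun x => β x 0 - u - (x - xm) / (3 * t + deriv f u)) =O[𝓝[>] xm]
        (fun x => halfGap (β x) ^ 4) ∧
      (fun x => phaseXi ν f x t (β x) - (edgePhase ν f t u v +
        √((u - v) / (v + ν)) * (x - xm))) =O[𝓝[>] xm] fun x => (x - xm) ^ 2 := by
  have hm : 0 < v + ν := by linarith
  have huv : 0 < u - v := by linarith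
  have hg : SmoothNear (lengthDensity ν) (u, v) := smoothNear_lengthDensity hm huv
  have hgpos : 0 < lengthDensity ν (u, v) := Real.sqrt_pos.2 (div_pos hm huv)
  have hgA := partialA_lengthDensity (ν := ν) (p := (u, v)) hm huv
  have hgB : partialB (lengthDensity ν) (u, v) ≠ 0 := by
    rw [partialB_lengthDensity (p := (u, v)) hm huv]
    have : 0 < u + ν := by linarith
    exact (div_pos (mul_pos hgpos this) (by positivity)).ne'
  have hX : Tendsto (fun x => x - xm) (𝓝[>] xm) (𝓝 0) :=
    (Continuous.tendsto' (f := fun x => x - xm) (by fun_prop) xm 0 (sub_self xm)).mono_left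
      nhdsWithin_le_nhds
  have hδ : ∀ᶠ x in 𝓝[>] xm, 0 < halfGap (β x) := hadm.mono fun x hx => by
    have := hx.1.2.1
    unfold halfGap
    linarith
  have hD := edgeDerivatives_defect hf hu hv hνv hvu hedge hV
  set σ := edgePhase ν f t u v with hσ
  have heq := eventually_criticalEquations (σ := σ) hf hνv hvu hβ hadm hhod
  obtain ⟨h1, h2, h3, h4⟩ := edge_asymptotics hg hgpos.ne' hgB hβ hδ hX hvu hslope hD heq
  refine ⟨h1.trans h2, ?_, ?_⟩
  -- Dividing by D_aa; since ∂ₐg/g = -1/(2(u-v)), the coefficient of X becomes 1/(3t+f'(u)).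
  · have h5 := (h4.const_mul_left (-(2 * (u - v)) / (3 * t + deriv f u))).trans
      ((h2.pow 2).congr_right (g₂ := fun x => halfGap (β x) ^ 4) fun x => by ring)
    refine h5.congr_left fun x => ?_
    rw [hgA]
    dsimp only
    have := hgpos.ne'
    have := huv.ne'
    field_simp
    ring
  -- Here ξ - σ = (⟨D⟩ + X)/L, with ⟨D⟩ = O(X²) and L = g(u,v) + O(X).
  · have hL := tendsto_bandMean hβ hg
    have hinv1 : (fun x => (bandMean (lengthDensity ν) (β x))⁻¹) =O[𝓝[>] xm] fun _ => (1 : ℝ) :=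
      (hL.inv₀ hgpos.ne').isBigO_one ℝ
    have h5 := (hinv1.mul h3).congr_right (g₂ := fun x => (x - xm) ^ 2) fun x => by ring
    have h6 := (hinv1.mul (((bandMean_sub_const_isBigO hβ hg).trans h1).mul
      (isBigO_refl (fun x => x - xm) _))).congr_right (g₂ := fun x => (x - xm) ^ 2)
      fun x => by ring
    refine (h5.sub (h6.const_mul_left (lengthDensity ν (u, v))⁻¹)).congr' ?_ EventuallyEq.rfl
    filter_upwards [hadm] with x hx
    have e1 : √((u - v) / (v + ν)) = (lengthDensity ν (u, v))⁻¹ := by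
      rw [lengthDensity, ← Real.sqrt_inv, inv_div]
    have hLx := (bandMean_lengthDensity_pos hx.1).ne'
    have e2 := bandMean_defect hf hx t xm σ
    rw [e1, phaseXi, waveNumber_eq hx.1]
    change _ = 1 / bandMean (lengthDensity ν) (β x) * _ - _
    rw [e2]
    have := hgpos.ne'
    field_simp
    ring

end HodographAsymptotics

/-! ### The complete elliptic integral and the arithmetic-geometric mean -/

/-- Gauss's integral, the reciprocal of an arithmetic-geometric mean up to a constant. -/
def gaussIntegral (a b : ℝ) : ℝ := ∫ x in Ioi (0 : ℝ), 1 / √((x ^ 2 + a ^ 2) * (x ^ 2 + b ^ 2))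

/-- The substitution y = (x - ab/x)/2 maps (0, ∞) bijectively onto the line and carries the
integrand for the two means to twice the one for (a, b). -/
theorem gaussIntegral_step {a b : ℝ} (ha : 0 < a) (hb : 0 < b) :
    gaussIntegral ((a + b) / 2) (√(a * b)) = gaussIntegral a b := by
  have hab : 0 < a * b := mul_pos ha hb
  set G : ℝ → ℝ := fun y => 1 / √((y ^ 2 + ((a + b) / 2) ^ 2) * (y ^ 2 + √(a * b) ^ 2)) with hG
  -- The integrand is even, so the whole line counts the half line twice.
  have h1 : ∫ y, G y = 2 * gaussIntegral ((a + b) / 2) (√(a * b)) := by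
    rw [gaussIntegral, ← integral_comp_abs (f := G)]
    simp [hG]
  have himg : (fun x => (x - a * b / x) / 2) '' Ioi 0 = univ := by
    -- The preimage of y is the positive root of x² - 2yx - ab = 0.
    refine eq_univ_of_forall fun y => ⟨y + √(y ^ 2 + a * b), ?_, ?_⟩
    · have : |y| < √(y ^ 2 + a * b) := by
        rw [← Real.sqrt_sq_eq_abs]
        exact Real.sqrt_lt_sqrt (sq_nonneg y) (by linarith)
      have := neg_abs_le y
      rw [mem_Ioi]
      linarith
    · have hs := Real.sq_sqrt (show 0 ≤ y ^ 2 + a * b by positivity)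
      have : |y| < √(y ^ 2 + a * b) := by
        rw [← Real.sqrt_sq_eq_abs]
        exact Real.sqrt_lt_sqrt (sq_nonneg y) (by linarith)
      have hne : y + √(y ^ 2 + a * b) ≠ 0 := by
        have := neg_abs_le y
        linarith
      dsimp only
      field_simp
      linear_combination hs
  have hd : ∀ x ∈ Ioi (0 : ℝ), HasDerivWithinAt (fun x => (x - a * b / x) / 2)
      ((1 + a * b / x ^ 2) / 2) (Ioi 0) x := fun x hx => by
    have hx0 : x ≠ 0 := (mem_Ioi.1 hx).ne'
    refine (((hasDerivAt_id x).sub ((hasDerivAt_inv hx0).const_mul (a * b))).div_const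
      2).hasDerivWithinAt.congr_deriv ?_
    field_simp
    ring
  have hinj : InjOn (fun x => (x - a * b / x) / 2) (Ioi 0) := by
    intro x hx y hy hxy
    have hx0 : 0 < x := hx
    have hy0 : 0 < y := hy
    dsimp only at hxy
    field_simp at hxy
    have h2 : (x - y) * (x * y + a * b) = 0 := by linear_combination hxy
    have := (mul_eq_zero.1 h2).resolve_right (by positivity)
    linarith
  have h2 := integral_image_eq_integral_abs_deriv_smul measurableSet_Ioi hd hinj G
  rw [himg, setIntegral_univ, h1] at h2
  have h3 : ∫ x in Ioi (0 : ℝ), |(1 + a * b / x ^ 2) / 2| • G ((x - a * b / x) / 2) =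
      2 * gaussIntegral a b := by
    rw [gaussIntegral, ← integral_const_mul]
    refine setIntegral_congr_fun measurableSet_Ioi fun x hx => ?_
    have hx0 : 0 < x := hx
    have e1 : (((x - a * b / x) / 2) ^ 2 + ((a + b) / 2) ^ 2) *
        (((x - a * b / x) / 2) ^ 2 + √(a * b) ^ 2) =
        ((x ^ 2 + a * b) / (4 * x ^ 2)) ^ 2 * ((x ^ 2 + a ^ 2) * (x ^ 2 + b ^ 2)) := by
      rw [Real.sq_sqrt hab.le]
      field_simp
      ring
    simp only [hG, e1, smul_eq_mul]
    rw [Real.sqrt_mul (by positivity), Real.sqrt_sq (by positivity), abs_of_pos (by positivity)]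
    have : 0 < √((x ^ 2 + a ^ 2) * (x ^ 2 + b ^ 2)) := Real.sqrt_pos.2 (by positivity)
    field_simp
    ring
  linarith [h2.trans h3]

theorem gaussIntegral_mul {a b k : ℝ} (hk : 0 < k) :
    gaussIntegral (k * a) (k * b) = k⁻¹ * gaussIntegral a b := by
  have h1 := integral_comp_mul_left_Ioi
    (fun x => 1 / √((x ^ 2 + (k * a) ^ 2) * (x ^ 2 + (k * b) ^ 2))) 0 hk
  rw [mul_zero, smul_eq_mul] at h1
  have h2 : ∫ x in Ioi (0 : ℝ), 1 / √(((k * x) ^ 2 + (k * a) ^ 2) * ((k * x) ^ 2 + (k * b) ^ 2)) =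
      (k ^ 2)⁻¹ * gaussIntegral a b := by
    rw [gaussIntegral, ← integral_const_mul]
    refine setIntegral_congr_fun measurableSet_Ioi fun x hx => ?_
    have e : ((k * x) ^ 2 + (k * a) ^ 2) * ((k * x) ^ 2 + (k * b) ^ 2) =
        (k ^ 2) ^ 2 * ((x ^ 2 + a ^ 2) * (x ^ 2 + b ^ 2)) := by ring
    rw [e, Real.sqrt_mul (by positivity), Real.sqrt_sq (by positivity), one_div, mul_inv, one_div]
  rw [h2] at h1
  change _ = k⁻¹ * gaussIntegral (k * a) (k * b) at h1
  field_simp at h1 ⊢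
  linarith

/-- Substitute z = 1/√(1+x²), a bijection from (0, ∞) to (0, 1). -/
theorem ellipticK_eq_gaussIntegral {s : ℝ} (hs : s ^ 2 < 1) :
    ellipticK s = gaussIntegral 1 (√(1 - s ^ 2)) := by
  have himg : (fun x : ℝ => 1 / √(1 + x ^ 2)) '' Ioi 0 = Ioo 0 1 := by
    ext z
    constructor
    · rintro ⟨x, hx, rfl⟩
      have hx0 : 0 < x := hx
      have h1 : 1 < √(1 + x ^ 2) := by
        rw [Real.lt_sqrt zero_le_one]
        nlinarith
      exact ⟨by positivity, by rw [div_lt_one (by positivity)]; exact h1⟩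
    · rintro ⟨h0, h1⟩
      have h2 : 0 < 1 - z ^ 2 := by nlinarith
      refine ⟨√(1 - z ^ 2) / z, div_pos (Real.sqrt_pos.2 h2) h0, ?_⟩
      dsimp only
      have : 1 + (√(1 - z ^ 2) / z) ^ 2 = (1 / z) ^ 2 := by
        rw [div_pow, Real.sq_sqrt h2.le]
        field_simp
        ring
      rw [this, Real.sqrt_sq (by positivity), one_div_one_div]
  have hd : ∀ x ∈ Ioi (0 : ℝ), HasDerivWithinAt (fun x : ℝ => 1 / √(1 + x ^ 2))
      (-x / ((1 + x ^ 2) * √(1 + x ^ 2))) (Ioi 0) x := fun x _ => by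
    have h0 : 0 < 1 + x ^ 2 := by positivity
    have h1 : HasDerivAt (fun x : ℝ => 1 + x ^ 2) (2 * x) x := by
      simpa using ((hasDerivAt_id x).pow 2).const_add 1
    have h2 := (h1.sqrt h0.ne').fun_inv (Real.sqrt_pos.2 h0).ne'
    simp only [one_div]
    refine h2.hasDerivWithinAt.congr_deriv ?_
    have h3 := Real.sqrt_pos.2 h0
    rw [Real.sq_sqrt h0.le]
    field_simp
  have hinj : InjOn (fun x : ℝ => 1 / √(1 + x ^ 2)) (Ioi 0) := by
    intro x hx y hy hxy
    have hx0 : 0 < x := hx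
    have hy0 : 0 < y := hy
    simp only [one_div, inv_inj] at hxy
    have h1 := (Real.sqrt_inj (by positivity) (by positivity)).1 hxy
    have h2 : (x - y) * (x + y) = 0 := by linear_combination h1
    have := (mul_eq_zero.1 h2).resolve_right (by positivity)
    linarith
  rw [ellipticK, intervalIntegral.integral_of_le zero_le_one, integral_Ioc_eq_integral_Ioo, ← himg,
    integral_image_eq_integral_abs_deriv_smul measurableSet_Ioi hd hinj, gaussIntegral]
  refine setIntegral_congr_fun measurableSet_Ioi fun x hx => ?_
  have hx0 : 0 < x := hx
  have h0 : 0 < 1 + x ^ 2 := by positivity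
  have hs' : 0 < 1 - s ^ 2 := by linarith
  have e1 : (1 - (1 / √(1 + x ^ 2)) ^ 2) * (1 - s ^ 2 * (1 / √(1 + x ^ 2)) ^ 2) =
      (x / (1 + x ^ 2)) ^ 2 * (x ^ 2 + √(1 - s ^ 2) ^ 2) := by
    rw [div_pow, Real.sq_sqrt h0.le, Real.sq_sqrt hs'.le]
    field_simp
    ring
  have h4 : 0 < √(x ^ 2 + √(1 - s ^ 2) ^ 2) := Real.sqrt_pos.2 (by positivity)
  have h5 : 0 < √(1 + x ^ 2) := Real.sqrt_pos.2 h0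
  simp only [smul_eq_mul]
  rw [e1, Real.sqrt_mul (by positivity), Real.sqrt_sq (by positivity), neg_div, abs_neg,
    abs_of_pos (by positivity), Real.sqrt_mul (by positivity), one_pow, add_comm (x ^ 2) 1]
  field_simp

/-- Two Landen transformations. -/
theorem gaussIntegral_ratio {s c : ℝ} (hs0 : 0 < s) (hc0 : 0 < c) (hc1 : c < 1)
    (hsc : s ^ 2 = 1 - c ^ 4) :
    gaussIntegral 1 s / gaussIntegral 1 (c ^ 2) =
      1 / 4 * (gaussIntegral 1 (((1 - c) / (1 + c)) ^ 2) /
        gaussIntegral 1 (√(1 - (((1 - c) / (1 + c)) ^ 2) ^ 2))) := by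
  have hc' : 0 < 1 - c := by linarith
  have hc2 : 0 < 1 - c ^ 2 := by nlinarith
  -- The pairs are ((1+c)², (1-c)²), then (1+c², 1-c²), then (1, s), the last because s² = 1 - c⁴.
  have e1 : gaussIntegral 1 s = ((1 + c) ^ 2)⁻¹ * gaussIntegral 1 (((1 - c) / (1 + c)) ^ 2) := by
    rw [← gaussIntegral_mul (by positivity), mul_one]
    have h1 : (1 + c) ^ 2 * ((1 - c) / (1 + c)) ^ 2 = (1 - c) ^ 2 := by
      field_simp
    rw [h1, ← gaussIntegral_step (a := (1 + c) ^ 2) (b := (1 - c) ^ 2) (by positivity)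
      (by positivity)]
    have h2 : √((1 + c) ^ 2 * (1 - c) ^ 2) = 1 - c ^ 2 := by
      rw [show (1 + c) ^ 2 * (1 - c) ^ 2 = (1 - c ^ 2) ^ 2 by ring, Real.sqrt_sq hc2.le]
    have h3 : ((1 + c) ^ 2 + (1 - c) ^ 2) / 2 = 1 + c ^ 2 := by ring
    rw [h2, h3, ← gaussIntegral_step (a := 1 + c ^ 2) (by positivity) hc2]
    have h4 : √((1 + c ^ 2) * (1 - c ^ 2)) = s := by
      rw [show (1 + c ^ 2) * (1 - c ^ 2) = s ^ 2 by rw [hsc]; ring, Real.sqrt_sq hs0.le]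
    rw [h4]
    norm_num
  -- The pairs are (1, c²), then ((1+c²)/2, c), then one with first entry (1+c)²/4; this quarter is
  -- the factor 1/4 in the statement.
  have e2 : gaussIntegral 1 (c ^ 2) = ((1 + c) ^ 2 / 4)⁻¹ *
      gaussIntegral 1 (√(1 - (((1 - c) / (1 + c)) ^ 2) ^ 2)) := by
    rw [← gaussIntegral_mul (by positivity), mul_one,
      ← gaussIntegral_step (a := 1) (b := c ^ 2) zero_lt_one (by positivity), one_mul,
      Real.sqrt_sq hc0.le,
      ← gaussIntegral_step (a := (1 + c ^ 2) / 2) (b := c) (by positivity) hc0]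
    have h1 : ((1 + c ^ 2) / 2 + c) / 2 = (1 + c) ^ 2 / 4 := by ring
    have h2 : √((1 + c ^ 2) / 2 * c) =
        (1 + c) ^ 2 / 4 * √(1 - (((1 - c) / (1 + c)) ^ 2) ^ 2) := by
      have h5 : (1 + c) ^ 2 / 4 = √(((1 + c) ^ 2 / 4) ^ 2) := (Real.sqrt_sq (by positivity)).symm
      rw [h5, ← Real.sqrt_mul (by positivity)]
      congr 1
      field_simp
      ring
    rw [h1, h2]
  rw [e1, e2]
  field_simp

/-! ### Logarithmic asymptotics -/

theorem integrableOn_gauss {κ : ℝ} (h0 : 0 < κ) (h1 : κ ≤ 1) :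
    IntegrableOn (fun x : ℝ => 1 / √((x ^ 2 + 1 ^ 2) * (x ^ 2 + κ ^ 2))) (Ioi 0) := by
  refine Integrable.mono' ((integrable_inv_one_add_sq.const_mul κ⁻¹).integrableOn)
    (Continuous.aestronglyMeasurable ?_) (Eventually.of_forall fun x => ?_)
  · exact Continuous.div continuous_const (by fun_prop) fun x =>
      (Real.sqrt_pos.2 (by positivity)).ne'
  · rw [Real.norm_of_nonneg (by positivity), ← mul_inv, ← one_div]
    refine one_div_le_one_div_of_le (by positivity) (Real.le_sqrt_of_sq_le ?_)
    have h2 : κ ^ 2 ≤ 1 := by nlinarith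
    have h3 : κ ^ 2 * (1 + x ^ 2) ≤ x ^ 2 + κ ^ 2 := by nlinarith [sq_nonneg x]
    nlinarith [sq_nonneg x]

/-- The inversion x ↦ κ/x preserves the form being integrated and exchanges (0, √κ) with (√κ, ∞). -/
theorem gaussIntegral_eq_two_mul {κ : ℝ} (h0 : 0 < κ) (h1 : κ ≤ 1) :
    gaussIntegral 1 κ =
      2 * ∫ x in (0 : ℝ)..√κ, 1 / √((x ^ 2 + 1 ^ 2) * (x ^ 2 + κ ^ 2)) := by
  set G : ℝ → ℝ := fun x => 1 / √((x ^ 2 + 1 ^ 2) * (x ^ 2 + κ ^ 2)) with hG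
  have hk : 0 < √κ := Real.sqrt_pos.2 h0
  have hkk := Real.sq_sqrt h0.le
  have hint := integrableOn_gauss h0 h1
  have hsplit : gaussIntegral 1 κ = (∫ x in Ioc 0 (√κ), G x) + ∫ x in Ioi (√κ), G x := by
    rw [gaussIntegral, ← Ioc_union_Ioi_eq_Ioi hk.le]
    exact setIntegral_union (Ioc_disjoint_Ioi le_rfl) measurableSet_Ioi
      (hint.mono_set Ioc_subset_Ioi_self) (hint.mono_set (Ioi_subset_Ioi hk.le))
  have himg : (fun y => κ / y) '' Ioo 0 (√κ) = Ioi (√κ) := by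
    ext x
    constructor
    · rintro ⟨y, hy, rfl⟩
      rw [mem_Ioi, lt_div_iff₀ hy.1]
      nlinarith [hy.1, hy.2]
    · intro hx
      have hx0 : 0 < x := hk.trans hx
      have hx1 : √κ < x := hx
      refine ⟨κ / x, ⟨by positivity, ?_⟩, by field_simp⟩
      rw [div_lt_iff₀ hx0]
      nlinarith
  have hd : ∀ y ∈ Ioo 0 (√κ), HasDerivWithinAt (fun y => κ / y) (-(κ / y ^ 2)) (Ioo 0 (√κ)) y :=
    fun y hy => by
      refine ((hasDerivAt_inv hy.1.ne').const_mul κ).hasDerivWithinAt.congr_deriv ?_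
      field_simp
  have hinj : InjOn (fun y => κ / y) (Ioo 0 (√κ)) := by
    intro x hx y hy hxy
    have := hx.1
    have := hy.1
    dsimp only at hxy
    field_simp at hxy
    exact hxy.symm
  have htail : ∫ x in Ioi (√κ), G x = ∫ x in Ioc 0 (√κ), G x := by
    rw [← himg, integral_image_eq_integral_abs_deriv_smul measurableSet_Ioo hd hinj,
      integral_Ioc_eq_integral_Ioo]
    refine setIntegral_congr_fun measurableSet_Ioo fun y hy => ?_
    have hy0 : 0 < y := hy.1
    have e1 : ((κ / y) ^ 2 + 1 ^ 2) * ((κ / y) ^ 2 + κ ^ 2) =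
        (κ / y ^ 2) ^ 2 * ((y ^ 2 + 1 ^ 2) * (y ^ 2 + κ ^ 2)) := by
      field_simp
      ring
    simp only [hG, e1, smul_eq_mul, abs_neg]
    rw [Real.sqrt_mul (by positivity), Real.sqrt_sq (by positivity), abs_of_pos (by positivity)]
    have : 0 < √((y ^ 2 + 1 ^ 2) * (y ^ 2 + κ ^ 2)) := Real.sqrt_pos.2 (by positivity)
    field_simp
  rw [hsplit, htail, intervalIntegral.integral_of_le hk.le]
  ring

/-- On (0, √κ) the factor √(x²+1) is nearly 1. Dropping it leaves arsinh(1/√κ), and twice that is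
log(4/κ) + 2 log((1+√(1+κ))/2). -/
theorem gaussIntegral_log {κ : ℝ} (h0 : 0 < κ) (h1 : κ ≤ 1) :
    |gaussIntegral 1 κ - Real.log (4 / κ)| ≤ κ / 2 := by
  have hk : 0 < √κ := Real.sqrt_pos.2 h0
  have hkk := Real.sq_sqrt h0.le
  have hpos : ∀ x : ℝ, 0 < x ^ 2 + κ ^ 2 := fun x => by positivity
  have hc1 : Continuous fun x : ℝ => 1 / √(x ^ 2 + κ ^ 2) :=
    Continuous.div continuous_const (by fun_prop) fun x => (Real.sqrt_pos.2 (hpos x)).ne'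
  have hc2 : Continuous fun x : ℝ => 1 / √((x ^ 2 + 1 ^ 2) * (x ^ 2 + κ ^ 2)) :=
    Continuous.div continuous_const (by fun_prop) fun x =>
      (Real.sqrt_pos.2 (by positivity)).ne'
  have hA : ∫ x in (0 : ℝ)..√κ, 1 / √(x ^ 2 + κ ^ 2) = Real.arsinh (√κ / κ) := by
    have h2 := intervalIntegral.integral_eq_sub_of_hasDerivAt (a := 0) (b := √κ)
      (f := fun x => Real.arsinh (x / κ)) (f' := fun x => 1 / √(x ^ 2 + κ ^ 2))
      (fun x _ => by
        refine ((Real.hasDerivAt_arsinh (x / κ)).comp x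
          ((hasDerivAt_id x).div_const κ)).congr_deriv ?_
        have e : x ^ 2 + κ ^ 2 = κ ^ 2 * (1 + (x / κ) ^ 2) := by
          field_simp
          ring
        rw [e, Real.sqrt_mul (by positivity), Real.sqrt_sq h0.le]
        have : 0 < √(1 + (x / κ) ^ 2) := Real.sqrt_pos.2 (by positivity)
        field_simp) (hc1.intervalIntegrable _ _)
    rw [h2]
    simp
  have hupper : ∫ x in (0 : ℝ)..√κ, 1 / √((x ^ 2 + 1 ^ 2) * (x ^ 2 + κ ^ 2)) ≤
      ∫ x in (0 : ℝ)..√κ, 1 / √(x ^ 2 + κ ^ 2) := by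
    refine intervalIntegral.integral_mono_on hk.le (hc2.intervalIntegrable _ _)
      (hc1.intervalIntegrable _ _) fun x _ => ?_
    refine one_div_le_one_div_of_le (Real.sqrt_pos.2 (hpos x)) (Real.sqrt_le_sqrt ?_)
    nlinarith [hpos x, sq_nonneg x]
  -- Dropping √(x²+1) changes the integrand by at most x/2, because √(x²+κ²) ≥ x; the integral of
  -- x/2 up to √κ is κ/4.
  have hlower : (∫ x in (0 : ℝ)..√κ, 1 / √(x ^ 2 + κ ^ 2)) - κ / 4 ≤
      ∫ x in (0 : ℝ)..√κ, 1 / √((x ^ 2 + 1 ^ 2) * (x ^ 2 + κ ^ 2)) := by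
    have h3 : ∫ x in (0 : ℝ)..√κ, x / 2 = κ / 4 := by
      rw [intervalIntegral.integral_div, integral_id, hkk]
      ring
    rw [← h3, ← intervalIntegral.integral_sub (hc1.intervalIntegrable _ _)
      (Continuous.intervalIntegrable (by fun_prop) _ _)]
    refine intervalIntegral.integral_mono_on hk.le
      ((hc1.sub (by fun_prop)).intervalIntegrable _ _) (hc2.intervalIntegrable _ _) fun x hx => ?_
    have hx0 : 0 ≤ x := hx.1
    have hy := Real.sqrt_pos.2 (hpos x)
    have hxy : x ≤ √(x ^ 2 + κ ^ 2) := Real.le_sqrt_of_sq_le (by nlinarith)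
    have hz : 0 < √(x ^ 2 + 1 ^ 2) := Real.sqrt_pos.2 (by positivity)
    have hz1 : 1 ≤ √(x ^ 2 + 1 ^ 2) := Real.le_sqrt_of_sq_le (by nlinarith)
    have hz2 : √(x ^ 2 + 1 ^ 2) ≤ 1 + x ^ 2 / 2 := by
      rw [Real.sqrt_le_left (by positivity)]
      nlinarith [sq_nonneg (x ^ 2)]
    rw [Real.sqrt_mul (by positivity)]
    generalize √(x ^ 2 + κ ^ 2) = y at *
    generalize √(x ^ 2 + 1 ^ 2) = z at *
    rw [div_sub_div _ _ hy.ne' two_ne_zero, div_le_div_iff₀ (by positivity) (by positivity)]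
    have h5 : z * (2 - x * y) ≤ 2 := by
      rcases le_total (2 - x * y) 0 with h | h
      · nlinarith
      · have h6 : (1 + x ^ 2 / 2) * (2 - x * y) ≤ 2 := by
          have h7 : x * x ≤ x * y := mul_le_mul_of_nonneg_left hxy hx0
          have h8 : 0 ≤ x ^ 2 * (x * y) := mul_nonneg (sq_nonneg x) (mul_nonneg hx0 hy.le)
          linarith
        exact (mul_le_mul_of_nonneg_right hz2 h).trans h6
    have h9 := mul_le_mul_of_nonneg_right h5 hy.le
    linarith
  have hlog : 2 * Real.arsinh (√κ / κ) = Real.log (4 / κ) + 2 * Real.log ((1 + √(1 + κ)) / 2) := by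
    have hw : 0 < √(1 + κ) := Real.sqrt_pos.2 (by linarith)
    have e1 : √κ / κ + √(1 + (√κ / κ) ^ 2) = (1 + √(1 + κ)) / √κ := by
      have e2 : √κ / κ = 1 / √κ := by
        rw [div_eq_div_iff h0.ne' hk.ne']
        linear_combination hkk
      have e3 : 1 + (1 / √κ) ^ 2 = (1 + κ) / κ := by
        rw [div_pow, hkk]
        field_simp
        ring
      rw [e2, e3, Real.sqrt_div (by linarith)]
      ring
    have e4 : 4 / κ = (2 / √κ) ^ 2 := by
      rw [div_pow, hkk]
      norm_num
    have e5 : (1 + √(1 + κ)) / √κ = 2 / √κ * ((1 + √(1 + κ)) / 2) := by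
      field_simp
    rw [Real.arsinh, e1, e4, e5, Real.log_mul (by positivity) (by positivity), Real.log_pow]
    push_cast
    ring
  have hl0 : 0 ≤ Real.log ((1 + √(1 + κ)) / 2) := by
    refine Real.log_nonneg ?_
    have : 1 ≤ √(1 + κ) := Real.le_sqrt_of_sq_le (by linarith)
    linarith
  have hl1 : Real.log ((1 + √(1 + κ)) / 2) ≤ κ / 4 := by
    have h6 : 0 ≤ √(1 + κ) := Real.sqrt_nonneg _
    have h7 : √(1 + κ) ≤ 1 + κ / 2 := by
      rw [Real.sqrt_le_left (by positivity)]
      nlinarith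
    have := Real.log_le_sub_one_of_pos (show 0 < (1 + √(1 + κ)) / 2 by positivity)
    linarith
  rw [gaussIntegral_eq_two_mul h0 h1, abs_le]
  rw [hA] at hupper hlower
  constructor <;> linarith

/-! ### Elliptic integrals of small modulus -/

theorem abs_inv_sqrt_sub_le {y : ℝ} (h0 : 0 ≤ y) (h1 : y ≤ 1 / 2) :
    |1 / √(1 - y) - (1 + y / 2)| ≤ y ^ 2 := by
  have ht := Real.sq_sqrt (show 0 ≤ 1 - y by linarith)
  have ht1 : 7 / 10 ≤ √(1 - y) := Real.le_sqrt_of_sq_le (by linarith)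
  generalize √(1 - y) = t at *
  have hy : y = 1 - t ^ 2 := by linarith
  have ht0 : 0 < t := by linarith
  have e : 1 / t - (1 + y / 2) = (1 - t) ^ 2 * (2 + t) / (2 * t) := by
    rw [hy]
    field_simp
    ring
  rw [e, abs_of_nonneg (by positivity), div_le_iff₀ (by positivity)]
  have h2 : 2 + t ≤ (1 + t) ^ 2 * (2 * t) := by nlinarith [mul_pos ht0 ht0]
  have h3 := mul_le_mul_of_nonneg_left h2 (sq_nonneg (1 - t))
  rw [hy]
  linarith

/-- Put z = sin φ and expand (1 - s² sin² φ)^(-1/2) to first order. The pointwise error s⁴ is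
integrated over a length arcsin w ≤ 2. -/
theorem abs_incomplete_elliptic_sub_le {w s : ℝ} (hw0 : 0 ≤ w) (hw1 : w ≤ 1)
    (hs : s ^ 2 ≤ 1 / 2) :
    |(∫ z in (0 : ℝ)..w, 1 / √((1 - z ^ 2) * (1 - s ^ 2 * z ^ 2))) -
      (Real.arcsin w + s ^ 2 / 4 * (Real.arcsin w - w * √(1 - w ^ 2)))| ≤ 2 * s ^ 4 := by
  have ha0 : 0 ≤ Real.arcsin w := Real.arcsin_nonneg.2 hw0
  have ha1 := Real.arcsin_le_pi_div_two w
  have hsin : Real.sin (Real.arcsin w) = w := Real.sin_arcsin (by linarith) hw1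
  have hb : ∀ φ : ℝ, 0 ≤ s ^ 2 * Real.sin φ ^ 2 ∧ s ^ 2 * Real.sin φ ^ 2 ≤ 1 / 2 ∧
      s ^ 2 * Real.sin φ ^ 2 ≤ s ^ 2 := fun φ => by
    have h := Real.sin_sq_le_one φ
    have h2 := mul_le_mul_of_nonneg_left h (sq_nonneg s)
    exact ⟨by positivity, by linarith, by linarith⟩
  have hsub : ∫ z in (0 : ℝ)..w, 1 / √((1 - z ^ 2) * (1 - s ^ 2 * z ^ 2)) =
      ∫ φ in (0 : ℝ)..Real.arcsin w, 1 / √(1 - s ^ 2 * Real.sin φ ^ 2) := by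
    have hm : StrictMonoOn Real.sin (Icc 0 (Real.arcsin w)) :=
      Real.strictMonoOn_sin.mono (Icc_subset_Icc (by linarith [Real.pi_pos]) ha1)
    have himg := image_Ioo_of_strictMonoOn ha0 Real.continuous_sin.continuousOn hm
    rw [hsin, Real.sin_zero] at himg
    refine integral_Ioo_eq_integral_Ioo Real.sin Real.cos himg
      (fun x _ => Real.hasDerivAt_sin x) (hm.injOn.mono Ioo_subset_Icc_self) ha0 hw0 _ _ ?_
    intro φ hφ
    have hc : 0 < Real.cos φ :=
      Real.cos_pos_of_mem_Ioo ⟨by linarith [hφ.1, Real.pi_pos], by linarith [hφ.2]⟩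
    rw [show 1 - Real.sin φ ^ 2 = Real.cos φ ^ 2 by linarith [Real.sin_sq_add_cos_sq φ],
      Real.sqrt_mul (sq_nonneg _), Real.sqrt_sq hc.le, abs_of_pos hc]
    field_simp
  have hcont : Continuous fun φ : ℝ => 1 / √(1 - s ^ 2 * Real.sin φ ^ 2) :=
    Continuous.div continuous_const (by fun_prop) fun φ =>
      (Real.sqrt_pos.2 (by linarith [(hb φ).2.1])).ne'
  have hmain : ∫ φ in (0 : ℝ)..Real.arcsin w, (1 + s ^ 2 * Real.sin φ ^ 2 / 2) =
      Real.arcsin w + s ^ 2 / 4 * (Real.arcsin w - w * √(1 - w ^ 2)) := by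
    rw [intervalIntegral.integral_add (by simp) (Continuous.intervalIntegrable (by fun_prop) _ _),
      intervalIntegral.integral_div, intervalIntegral.integral_const_mul, integral_sin_sq, hsin,
      Real.cos_arcsin]
    simp
    ring
  rw [hsub, ← hmain, ← intervalIntegral.integral_sub (hcont.intervalIntegrable _ _)
    (Continuous.intervalIntegrable (by fun_prop) _ _)]
  have h := intervalIntegral.norm_integral_le_of_norm_le_const (a := 0) (b := Real.arcsin w)
    (f := fun φ => 1 / √(1 - s ^ 2 * Real.sin φ ^ 2) - (1 + s ^ 2 * Real.sin φ ^ 2 / 2))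
    (C := s ^ 4) fun φ _ => by
      rw [Real.norm_eq_abs]
      refine (abs_inv_sqrt_sub_le (hb φ).1 (hb φ).2.1).trans ?_
      calc (s ^ 2 * Real.sin φ ^ 2) ^ 2 ≤ (s ^ 2) ^ 2 :=
            pow_le_pow_left₀ (hb φ).1 (hb φ).2.2 2
        _ = s ^ 4 := by ring
  rw [Real.norm_eq_abs, sub_zero, abs_of_nonneg ha0] at h
  refine h.trans ?_
  have h4 : 0 ≤ s ^ 4 := by positivity
  have : Real.arcsin w ≤ 2 := by linarith [Real.pi_le_four]
  nlinarith

theorem abs_ellipticK_sub_le {s : ℝ} (hs : s ^ 2 ≤ 1 / 2) :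
    |ellipticK s - Real.pi / 2 * (1 + s ^ 2 / 4)| ≤ 2 * s ^ 4 := by
  have h := abs_incomplete_elliptic_sub_le zero_le_one le_rfl hs
  rw [Real.arcsin_one] at h
  rw [ellipticK]
  convert h using 2
  norm_num
  ring

/-- The threshold 3/40 is not sharp; it makes the quartic error small against the s² term. -/
theorem ellipticK_bounds {s : ℝ} (hs : s ^ 2 ≤ 3 / 40) :
    1 ≤ 2 / Real.pi * ellipticK s ∧ 2 / Real.pi * ellipticK s ≤ 1 + s ^ 2 := by
  have h := abs_le.1 (abs_ellipticK_sub_le (by linarith : s ^ 2 ≤ 1 / 2))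
  have h3 := Real.pi_gt_three
  have h4 : s ^ 4 ≤ 3 / 40 * s ^ 2 := by nlinarith [sq_nonneg s]
  have h5 : 3 * s ^ 2 ≤ Real.pi * s ^ 2 := mul_le_mul_of_nonneg_right h3.le (sq_nonneg s)
  have h6 : 0 < Real.pi := by linarith
  rw [div_mul_eq_mul_div, one_le_div h6, div_le_iff₀ h6]
  constructor <;> linarith [sq_nonneg s]

/-! ### The nome -/

/-- The nome of the modulus `s`. -/
def nome (s : ℝ) : ℝ := Real.exp (-(Real.pi * (ellipticK (√(1 - s ^ 2)) / ellipticK s)))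

/-- The fraction 8y(1+y²)/(1+y)⁴ is s² in terms of the Landen variable y, so this converts y/2, the
leading form of the nome, into powers of s. The constant 104 is the sum of the coefficients in the
numerator. -/
theorem nome_polynomial_bound {y : ℝ} (h0 : 0 ≤ y) (h1 : y ≤ 1) :
    |y / 2 - ((8 * y * (1 + y ^ 2) / (1 + y) ^ 4) / 16 +
      (8 * y * (1 + y ^ 2) / (1 + y) ^ 4) ^ 2 / 32)| ≤ 104 * y ^ 3 := by
  have e : y / 2 - ((8 * y * (1 + y ^ 2) / (1 + y) ^ 4) / 16 +
      (8 * y * (1 + y ^ 2) / (1 + y) ^ 4) ^ 2 / 32) =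
      y ^ 3 * (21 / 2 + 20 * y + 63 / 2 * y ^ 2 + 24 * y ^ 3 + 27 / 2 * y ^ 4 + 4 * y ^ 5 +
        y ^ 6 / 2) / (1 + y) ^ 8 := by
    field_simp
    ring
  have h2 : ∀ n, y ^ n ≤ 1 := fun n => pow_le_one₀ h0 h1
  have h3 : 1 ≤ (1 + y) ^ 8 := one_le_pow₀ (by linarith)
  rw [e, abs_of_nonneg (by positivity)]
  refine (div_le_self (by positivity) h3).trans ?_
  rw [mul_comm]
  refine mul_le_mul_of_nonneg_right ?_ (by positivity)
  linarith [h2 2, h2 3, h2 4, h2 5, h2 6]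

/-- Applied directly with κ = s, the logarithmic estimate has error O(s), which is too coarse. Two
Landen steps replace s by y², where y = (1-c)/(1+c), c⁴ = 1 - s² and y ≤ s²; there the estimate
gives nome = (y/2)e^E with E = O(y²). -/
theorem abs_nome_sub_le {s : ℝ} (hs0 : 0 < s) (hs : s ^ 2 ≤ 1 / 2) :
    |nome s - (s ^ 2 / 16 + s ^ 4 / 32)| ≤ 107 * s ^ 6 := by
  have hs1 : 0 < 1 - s ^ 2 := by linarith
  obtain ⟨c, hc, hc4, hc2⟩ : ∃ c : ℝ, 4 / 5 ≤ c ∧ c ^ 4 = 1 - s ^ 2 ∧ √(1 - s ^ 2) = c ^ 2 := by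
    refine ⟨√√(1 - s ^ 2), ?_, ?_, (Real.sq_sqrt (Real.sqrt_nonneg _)).symm⟩
    -- (4/5)⁴ = 0.4096 is below 1 - s² ≥ 1/2; the bound y ≤ 1/9 comes from c ≥ 4/5.
    · refine Real.le_sqrt_of_sq_le (Real.le_sqrt_of_sq_le ?_)
      linarith
    · rw [show √√(1 - s ^ 2) ^ 4 = (√√(1 - s ^ 2) ^ 2) ^ 2 by ring,
        Real.sq_sqrt (Real.sqrt_nonneg _), Real.sq_sqrt hs1.le]
  have hc0 : 0 < c := by linarith
  have hc1 : c < 1 := by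
    by_contra h
    have : 1 ≤ c ^ 4 := one_le_pow₀ (not_lt.1 h)
    nlinarith
  set y := (1 - c) / (1 + c) with hy
  have hy0 : 0 < y := div_pos (by linarith) (by linarith)
  have hy9 : y ≤ 1 / 9 := by
    rw [hy, div_le_iff₀ (by linarith)]
    linarith
  have hys : y ≤ s ^ 2 := by
    have h1 : 1 - c ≤ s ^ 2 := by
      have : c ^ 4 ≤ c := by
        simpa using pow_le_pow_of_le_one hc0.le hc1.le (show 1 ≤ 4 by norm_num)
      linarith
    exact (div_le_self (by linarith) (by linarith)).trans h1
  have hsy : s ^ 2 = 8 * y * (1 + y ^ 2) / (1 + y) ^ 4 := by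
    have : s ^ 2 = 1 - c ^ 4 := by linarith
    have h1 : 1 + y = 2 / (1 + c) := by
      rw [hy]
      field_simp
      ring
    rw [this, h1, hy]
    field_simp
    ring
  clear_value y
  have hk0 : 0 < y ^ 2 := by positivity
  have hk1 : y ^ 2 ≤ 1 / 81 := by nlinarith
  have hkk : (y ^ 2) ^ 2 ≤ 3 / 40 := by nlinarith
  have hK := ellipticK_bounds hkk
  set T := 2 / Real.pi * ellipticK (y ^ 2) with hT
  have hratio : Real.pi * (ellipticK (√(1 - s ^ 2)) / ellipticK s) =
      1 / 2 * (gaussIntegral 1 (y ^ 2) / T) := by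
    rw [ellipticK_eq_gaussIntegral (s := √(1 - s ^ 2)) (by rw [Real.sq_sqrt hs1.le]; nlinarith),
      ellipticK_eq_gaussIntegral (s := s) (by linarith), Real.sq_sqrt hs1.le, sub_sub_cancel,
      Real.sqrt_sq hs0.le, hc2, gaussIntegral_ratio hs0 hc0 hc1 (by linarith), ← hy, hT,
      ← ellipticK_eq_gaussIntegral (s := y ^ 2) (by linarith)]
    have := Real.pi_pos
    field_simp
    norm_num
    ring
  have hlog := abs_le.1 (gaussIntegral_log hk0 (by linarith : y ^ 2 ≤ 1))
  have hl0 : 0 ≤ Real.log (4 / y ^ 2) := Real.log_nonneg (by rw [one_le_div hk0]; linarith)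
  -- The logarithm is unbounded, but it is multiplied by T - 1 ≤ y⁴, and one factor y² suffices to
  -- tame it.
  have hl1 : y ^ 2 * Real.log (4 / y ^ 2) ≤ 4 := by
    have := mul_le_mul_of_nonneg_left (Real.log_le_self (show 0 ≤ 4 / y ^ 2 by positivity)) hk0.le
    rwa [mul_div_cancel₀ _ hk0.ne'] at this
  set E := 1 / 2 * Real.log (4 / y ^ 2) - 1 / 2 * (gaussIntegral 1 (y ^ 2) / T) with hE
  have hT0 : 0 < T := by linarith
  have hEb : |E| ≤ 3 * y ^ 2 := by
    have e : E = (Real.log (4 / y ^ 2) * T - gaussIntegral 1 (y ^ 2)) / (2 * T) := by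
      rw [hE]
      field_simp
    have h1 : Real.log (4 / y ^ 2) ≤ Real.log (4 / y ^ 2) * T := le_mul_of_one_le_right hl0 hK.1
    have h2 : Real.log (4 / y ^ 2) * T ≤ Real.log (4 / y ^ 2) * (1 + (y ^ 2) ^ 2) :=
      mul_le_mul_of_nonneg_left hK.2 hl0
    have h3 : y ^ 2 * (y ^ 2 * Real.log (4 / y ^ 2)) ≤ y ^ 2 * 4 :=
      mul_le_mul_of_nonneg_left hl1 hk0.le
    rw [e, abs_div, abs_of_pos (show 0 < 2 * T by linarith), div_le_iff₀ (by linarith), abs_le]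
    constructor <;> nlinarith
  have hnome : nome s = y / 2 * Real.exp E := by
    have e1 : Real.exp (-(1 / 2 * Real.log (4 / y ^ 2))) = y / 2 := by
      rw [show 4 / y ^ 2 = (2 / y) ^ 2 by rw [div_pow]; norm_num, Real.log_pow,
        show -(1 / 2 * (((2 : ℕ) : ℝ) * Real.log (2 / y))) = -Real.log (2 / y) by push_cast; ring,
        Real.exp_neg, Real.exp_log (by positivity), inv_div]
    rw [nome, hratio, ← e1, ← Real.exp_add]
    congr 1
    rw [hE]
    ring
  have hexp : |Real.exp E - 1| ≤ 6 * y ^ 2 := by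
    have := Real.abs_exp_sub_one_le (show |E| ≤ 1 by linarith)
    linarith
  have h1 : |nome s - y / 2| ≤ 3 * y ^ 3 := by
    rw [hnome, show y / 2 * Real.exp E - y / 2 = y / 2 * (Real.exp E - 1) by ring, abs_mul,
      abs_of_pos (by positivity)]
    nlinarith
  have h2 := nome_polynomial_bound hy0.le (by linarith)
  rw [← hsy] at h2
  have h3 : y ^ 3 ≤ s ^ 6 := by
    calc y ^ 3 ≤ (s ^ 2) ^ 3 := pow_le_pow_left₀ hy0.le hys 3
      _ = s ^ 6 := by ring
  -- The constants 3 and 104 of the two parts add up to 107.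
  have h4 := abs_add_le (nome s - y / 2) (y / 2 - (s ^ 2 / 16 + (s ^ 2) ^ 2 / 32))
  rw [show nome s - y / 2 + (y / 2 - (s ^ 2 / 16 + (s ^ 2) ^ 2 / 32)) =
    nome s - (s ^ 2 / 16 + s ^ 4 / 32) by ring] at h4
  linarith

/-! ### The theta function for a small nome -/

/-- The sign σ treats the indices n and -n together; only σ² = 1 is used. -/
theorem jacobiTheta₂_term_ofReal {σ : ℂ} (hσ : σ ^ 2 = 1) (n : ℕ) (x y : ℝ) :
    Complex.exp (2 * Real.pi * Complex.I * (σ * n) * x +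
      Real.pi * Complex.I * (σ * n) ^ 2 * (y * Complex.I)) =
      Complex.exp (σ * (2 * Real.pi * n * x : ℝ) * Complex.I) *
        (Real.exp (-(Real.pi * y)) ^ n ^ 2 : ℝ) := by
  rw [← Real.exp_nat_mul, Complex.ofReal_exp, ← Complex.exp_add]
  congr 1
  push_cast
  linear_combination (-(Real.pi : ℂ) * n ^ 2 * y) * hσ +
    (Real.pi : ℂ) * n ^ 2 * y * σ ^ 2 * Complex.I_sq

theorem jacobiTheta₂_term_natCast (n : ℕ) (x y : ℝ) :
    jacobiTheta₂_term n x (y * Complex.I) =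
      Complex.exp ((2 * Real.pi * n * x : ℝ) * Complex.I) *
        (Real.exp (-(Real.pi * y)) ^ n ^ 2 : ℝ) := by
  have := jacobiTheta₂_term_ofReal (σ := 1) (by norm_num) n x y
  simpa only [jacobiTheta₂_term, Int.cast_natCast, one_mul] using this

theorem jacobiTheta₂_term_neg_natCast (n : ℕ) (x y : ℝ) :
    jacobiTheta₂_term (-n) x (y * Complex.I) =
      Complex.exp (-(2 * Real.pi * n * x : ℝ) * Complex.I) *
        (Real.exp (-(Real.pi * y)) ^ n ^ 2 : ℝ) := by
  have := jacobiTheta₂_term_ofReal (σ := -1) (by norm_num) n x y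
  simpa only [jacobiTheta₂_term, Int.cast_neg, Int.cast_natCast, one_mul, neg_mul] using this

theorem jacobiTheta₂_term_add_neg (n : ℕ) (x y : ℝ) :
    jacobiTheta₂_term n x (y * Complex.I) + jacobiTheta₂_term (-n) x (y * Complex.I) =
      ((2 * Real.exp (-(Real.pi * y)) ^ n ^ 2 * Real.cos (2 * Real.pi * n * x) : ℝ) : ℂ) := by
  rw [jacobiTheta₂_term_natCast, jacobiTheta₂_term_neg_natCast, ← add_mul, ← Complex.two_cos,
    ← Complex.ofReal_cos]
  push_cast
  ring

theorem jacobiTheta₂'_term_add_neg (n : ℕ) (x y : ℝ) :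
    jacobiTheta₂'_term n x (y * Complex.I) + jacobiTheta₂'_term (-n) x (y * Complex.I) =
      ((-(4 * Real.pi * n) * Real.exp (-(Real.pi * y)) ^ n ^ 2 *
        Real.sin (2 * Real.pi * n * x) : ℝ) : ℂ) := by
  have h := Complex.two_sin ((2 * Real.pi * n * x : ℝ) : ℂ)
  rw [jacobiTheta₂'_term, jacobiTheta₂'_term, jacobiTheta₂_term_natCast,
    jacobiTheta₂_term_neg_natCast, Complex.ofReal_mul (_ * _) (Real.sin _), Complex.ofReal_sin]
  simp only [Int.cast_neg, Int.cast_natCast]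
  push_cast at h ⊢
  linear_combination (2 * Real.pi * n * Complex.exp (-(Real.pi * y)) ^ n ^ 2) * h

/-- Pairing n with -n over the naturals counts n = 0 twice, hence the added 1. -/
theorem hasSum_theta3 (x : ℝ) {y : ℝ} (hy : 0 < y) :
    HasSum (fun n : ℕ => 2 * Real.exp (-(Real.pi * y)) ^ n ^ 2 * Real.cos (2 * Real.pi * n * x))
      (theta3 x y + 1) := by
  have h := (hasSum_jacobiTheta₂_term (x : ℂ) (τ := y * Complex.I) (by simpa)).nat_add_neg
  rw [← ofReal_theta3] at h
  simp only [jacobiTheta₂_term_add_neg] at h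
  have h0 : jacobiTheta₂_term 0 x (y * Complex.I) = 1 := by simp [jacobiTheta₂_term]
  rw [h0, ← Complex.ofReal_one, ← Complex.ofReal_add] at h
  exact Complex.hasSum_ofReal.1 h

/-- The derivative of `theta3` in its first variable. -/
def theta3Deriv (x y : ℝ) : ℝ := (jacobiTheta₂' (x : ℂ) (y * Complex.I)).re

theorem hasDerivAt_theta3 (x : ℝ) {y : ℝ} (hy : 0 < y) :
    HasDerivAt (fun x => theta3 x y) (theta3Deriv x y) x :=
  (hasDerivAt_jacobiTheta₂_fst (x : ℂ) (τ := y * Complex.I) (by simpa)).real_of_complex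

theorem hasSum_theta3Deriv (x : ℝ) {y : ℝ} (hy : 0 < y) :
    HasSum (fun n : ℕ => -(4 * Real.pi * n) * Real.exp (-(Real.pi * y)) ^ n ^ 2 *
      Real.sin (2 * Real.pi * n * x)) (theta3Deriv x y) := by
  have h := (hasSum_jacobiTheta₂'_term (x : ℂ) (τ := y * Complex.I) (by simpa)).nat_add_neg
  simp only [jacobiTheta₂'_term_add_neg] at h
  have h0 : jacobiTheta₂'_term 0 x (y * Complex.I) = 0 := by simp [jacobiTheta₂'_term]
  rw [h0, add_zero] at h
  have h1 := Complex.hasSum_re h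
  simp only [Complex.ofReal_re] at h1
  exact h1

theorem abs_sub_two_terms_le {f : ℕ → ℝ} {S C : ℝ} (hf : HasSum f S)
    (hC : ∀ n, |f (n + 2)| ≤ C * (1 / 2) ^ n) : |S - (f 0 + f 1)| ≤ 2 * C := by
  have h1 : HasSum (fun n => f (n + 2)) (S - (f 0 + f 1)) := by
    have := (hasSum_nat_add_iff' 2).2 hf
    simpa [Finset.sum_range_succ] using this
  have h2 : HasSum (fun n : ℕ => C * (1 / 2 : ℝ) ^ n) (2 * C) := by
    have := hasSum_geometric_two.mul_left C
    rwa [mul_comm C 2] at this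
  rw [← h1.tsum_eq, ← Real.norm_eq_abs]
  exact tsum_of_norm_bounded h2 hC

/-- The ratio 1/4, not 1/2, leaves room for the linear factor n + 2 of the differentiated series. -/
theorem pow_add_two_sq_le {q : ℝ} (h0 : 0 ≤ q) (h1 : q ≤ 1 / 2) (n : ℕ) :
    q ^ (n + 2) ^ 2 ≤ q ^ 4 * (1 / 4) ^ n := by
  have e : (n + 2) ^ 2 = 4 + (2 * n + (n ^ 2 + 2 * n)) := by ring
  rw [e, pow_add, pow_add, pow_mul]
  refine mul_le_mul_of_nonneg_left ?_ (by positivity)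
  have h2 : q ^ (n ^ 2 + 2 * n) ≤ 1 := pow_le_one₀ h0 (by linarith)
  have h3 : (q ^ 2) ^ n ≤ (1 / 4) ^ n := pow_le_pow_left₀ (by positivity) (by nlinarith) n
  calc (q ^ 2) ^ n * q ^ (n ^ 2 + 2 * n) ≤ (q ^ 2) ^ n * 1 :=
        mul_le_mul_of_nonneg_left h2 (by positivity)
    _ ≤ (1 / 4) ^ n := by rwa [mul_one]

theorem abs_theta3_sub_le (x : ℝ) {y q : ℝ} (hy : 0 < y) (hq : q = Real.exp (-(Real.pi * y)))
    (h1 : q ≤ 1 / 2) :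
    |theta3 x y - (1 + 2 * q * Real.cos (2 * Real.pi * x))| ≤ 4 * q ^ 4 := by
  have hq0 : 0 ≤ q := hq ▸ (Real.exp_pos _).le
  have h := hasSum_theta3 x hy
  rw [← hq] at h
  have h2 := abs_sub_two_terms_le (C := 2 * q ^ 4) h fun n => by
    rw [abs_mul, abs_of_nonneg (by positivity)]
    have h3 := pow_add_two_sq_le hq0 h1 n
    have h4 : ((1 : ℝ) / 4) ^ n ≤ (1 / 2) ^ n := pow_le_pow_left₀ (by norm_num) (by norm_num) n
    calc 2 * q ^ (n + 2) ^ 2 * |Real.cos (2 * Real.pi * ((n + 2 : ℕ) : ℝ) * x)|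
        ≤ 2 * q ^ (n + 2) ^ 2 * 1 :=
          mul_le_mul_of_nonneg_left (Real.abs_cos_le_one _) (by positivity)
      _ ≤ 2 * q ^ 4 * (1 / 2) ^ n := by nlinarith [pow_nonneg hq0 4]
  simp at h2
  rw [show theta3 x y - (1 + 2 * q * Real.cos (2 * Real.pi * x)) =
    theta3 x y + 1 - (2 + 2 * q * Real.cos (2 * Real.pi * x)) by ring]
  linarith

theorem abs_theta3Deriv_sub_le (x : ℝ) {y q : ℝ} (hy : 0 < y)
    (hq : q = Real.exp (-(Real.pi * y))) (h1 : q ≤ 1 / 2) :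
    |theta3Deriv x y + 4 * Real.pi * q * Real.sin (2 * Real.pi * x)| ≤
      16 * Real.pi * q ^ 4 := by
  have hq0 : 0 ≤ q := hq ▸ (Real.exp_pos _).le
  have hpi := Real.pi_pos
  have h := hasSum_theta3Deriv x hy
  rw [← hq] at h
  have h2 := abs_sub_two_terms_le (C := 8 * Real.pi * q ^ 4) h fun n => by
    rw [abs_mul, neg_mul, abs_neg, abs_of_nonneg (by positivity)]
    have h3 := pow_add_two_sq_le hq0 h1 n
    have h4 : ((n + 2 : ℕ) : ℝ) * (1 / 4) ^ n ≤ 2 * (1 / 2) ^ n := by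
      have h5 : n + 2 ≤ 2 * 2 ^ n := by
        have := Nat.lt_two_pow_self (n := n)
        have := Nat.one_le_two_pow (n := n)
        omega
      have h6 : ((n + 2 : ℕ) : ℝ) ≤ 2 * 2 ^ n := by exact_mod_cast h5
      calc ((n + 2 : ℕ) : ℝ) * (1 / 4) ^ n ≤ 2 * 2 ^ n * (1 / 4) ^ n :=
            mul_le_mul_of_nonneg_right h6 (by positivity)
        _ = 2 * (1 / 2) ^ n := by rw [mul_assoc, ← mul_pow]; norm_num
    calc 4 * Real.pi * ((n + 2 : ℕ) : ℝ) * q ^ (n + 2) ^ 2 *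
          |Real.sin (2 * Real.pi * ((n + 2 : ℕ) : ℝ) * x)|
        ≤ 4 * Real.pi * ((n + 2 : ℕ) : ℝ) * q ^ (n + 2) ^ 2 * 1 :=
          mul_le_mul_of_nonneg_left (Real.abs_sin_le_one _) (by positivity)
      _ ≤ 4 * Real.pi * ((n + 2 : ℕ) : ℝ) * (q ^ 4 * (1 / 4) ^ n) := by
          rw [mul_one]
          exact mul_le_mul_of_nonneg_left h3 (by positivity)
      _ = 4 * Real.pi * q ^ 4 * (((n + 2 : ℕ) : ℝ) * (1 / 4) ^ n) := by ring
      _ ≤ 4 * Real.pi * q ^ 4 * (2 * (1 / 2) ^ n) :=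
          mul_le_mul_of_nonneg_left h4 (by positivity)
      _ = 8 * Real.pi * q ^ 4 * (1 / 2) ^ n := by ring
  simp at h2
  linarith

theorem abs_mul_le_of_le {a b A B : ℝ} (ha : |a| ≤ A) (hb : |b| ≤ B) : |a * b| ≤ A * B := by
  rw [abs_mul]
  exact mul_le_mul ha hb (abs_nonneg _) ((abs_nonneg _).trans ha)

/-! ### The quotient of theta functions and its derivative to second order in the nome -/

section ThetaRatio
variable {x y p q : ℝ}

theorem theta3_bounds (hy : 0 < y) (hq : q = Real.exp (-(Real.pi * y))) (h1 : q ≤ 1 / 8) :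
    |theta3 x y - 1| ≤ 3 * q ∧ 1 / 2 ≤ theta3 x y := by
  have hq0 : 0 ≤ q := hq ▸ (Real.exp_pos _).le
  have h := abs_theta3_sub_le x hy hq (by linarith)
  have h2 : |2 * q * Real.cos (2 * Real.pi * x)| ≤ 2 * q := by
    rw [abs_mul, abs_of_nonneg (by linarith)]
    exact mul_le_of_le_one_right (by linarith) (Real.abs_cos_le_one _)
  have h3 : q ^ 4 ≤ 1 / 8 * q := by
    have : q ^ 4 = q ^ 3 * q := by ring
    rw [this]
    exact mul_le_mul_of_nonneg_right ((pow_le_pow_left₀ hq0 h1 3).trans (by norm_num)) hq0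
  have h4 : |theta3 x y - 1| ≤ 3 * q := by
    rw [abs_le] at h h2 ⊢
    constructor <;> linarith [h.1, h.2, h2.1, h2.2]
  exact ⟨h4, by linarith [(abs_le.1 h4).1]⟩

/-- From log(1+w) = w + O(w²) with |w| ≤ 3q: the square costs 2(3q)² = 18q², and the tail of the
theta series at most q². -/
theorem abs_log_theta3_sub_le (hy : 0 < y) (hq : q = Real.exp (-(Real.pi * y))) (h1 : q ≤ 1 / 8) :
    |Real.log (theta3 x y) - 2 * q * Real.cos (2 * Real.pi * x)| ≤ 19 * q ^ 2 := by
  have hq0 : 0 ≤ q := hq ▸ (Real.exp_pos _).le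
  obtain ⟨hb, _⟩ := theta3_bounds (x := x) hy hq h1
  have h := abs_theta3_sub_le x hy hq (by linarith)
  set w := theta3 x y - 1 with hw
  have hw1 : |w| ≤ 1 / 2 := by linarith
  have hl := Real.abs_log_sub_add_sum_range_le (x := -w) (by rw [abs_neg]; linarith) 1
  rw [show (1 : ℝ) - -w = theta3 x y by rw [hw]; ring, abs_neg] at hl
  simp only [Finset.sum_range_one, zero_add, pow_one, Nat.cast_zero, div_one] at hl
  have h2 : |w| ^ (1 + 1) / (1 - |w|) ≤ 18 * q ^ 2 := by
    rw [div_le_iff₀ (by linarith)]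
    have h5 : |w| ^ 2 ≤ (3 * q) ^ 2 := pow_le_pow_left₀ (abs_nonneg _) hb 2
    have h6 : 18 * q ^ 2 * (1 / 2) ≤ 18 * q ^ 2 * (1 - |w|) :=
      mul_le_mul_of_nonneg_left (by linarith) (by positivity)
    rw [show 1 + 1 = 2 from rfl]
    linarith
  have h3 : q ^ 4 ≤ 1 / 4 * q ^ 2 := by
    have : q ^ 4 = q ^ 2 * q ^ 2 := by ring
    rw [this]
    exact mul_le_mul_of_nonneg_right (by nlinarith) (sq_nonneg q)
  rw [abs_le] at h hl ⊢
  constructor <;> linarith [h.1, h.2, hl.1, hl.2]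

/-- The second harmonic comes from dividing the first by 1 + 2q cos(2πx); the second term of the
theta series itself enters only at order q⁴. -/
theorem abs_theta3_logDeriv_sub_le (hy : 0 < y) (hq : q = Real.exp (-(Real.pi * y)))
    (h1 : q ≤ 1 / 8) :
    |theta3Deriv x y / theta3 x y - (-(4 * Real.pi * q) * Real.sin (2 * Real.pi * x) +
      4 * Real.pi * q ^ 2 * Real.sin (2 * (2 * Real.pi * x)))| ≤ 160 * q ^ 3 := by
  have hq0 : 0 ≤ q := hq ▸ (Real.exp_pos _).le
  have hpi := Real.pi_pos
  have hpi4 := Real.pi_lt_d2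
  obtain ⟨_, hb⟩ := theta3_bounds (x := x) hy hq h1
  have h0 := abs_theta3_sub_le x hy hq (by linarith)
  have h0' := abs_theta3Deriv_sub_le x hy hq (by linarith)
  rw [Real.sin_two_mul]
  have hS := Real.abs_sin_le_one (2 * Real.pi * x)
  have hc := Real.abs_cos_le_one (2 * Real.pi * x)
  generalize Real.sin (2 * Real.pi * x) = S at *
  generalize Real.cos (2 * Real.pi * x) = c at *
  generalize theta3 x y = θ at *
  generalize theta3Deriv x y = θ' at *
  obtain ⟨e, he⟩ : ∃ e, e = θ - (1 + 2 * q * c) := ⟨_, rfl⟩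
  obtain ⟨e', he'⟩ : ∃ e', e' = θ' + 4 * Real.pi * q * S := ⟨_, rfl⟩
  rw [← he] at h0
  rw [← he'] at h0'
  have hθ : θ = 1 + 2 * q * c + e := by linarith
  have hθ0 : 0 < θ := by linarith
  have hθ' : θ' = -(4 * Real.pi * q * S) + e' := by linarith
  have key : θ' / θ - (-(4 * Real.pi * q) * S + 4 * Real.pi * q ^ 2 * (2 * S * c)) =
      (e' + 4 * Real.pi * q * (S * e) - 16 * Real.pi * q ^ 3 * (S * (c * c)) -
        8 * Real.pi * q ^ 2 * (S * (c * e))) / θ := by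
    rw [eq_div_iff hθ0.ne', sub_mul, div_mul_cancel₀ _ hθ0.ne', hθ, hθ']
    ring
  have hq1 : q ^ 2 ≤ 1 / 64 := by nlinarith
  have hq3 : 0 ≤ q ^ 3 := by positivity
  have q4 : q ^ 4 ≤ 1 / 8 * q ^ 3 := by
    rw [pow_succ q 3, mul_comm]
    exact mul_le_mul_of_nonneg_right h1 hq3
  have b1 : |4 * Real.pi * q * (S * e)| ≤ 4 * Real.pi * q * (1 * (4 * q ^ 4)) := by
    rw [abs_mul, abs_of_nonneg (by positivity)]
    exact mul_le_mul_of_nonneg_left (abs_mul_le_of_le hS h0) (by positivity)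
  have b2 : |16 * Real.pi * q ^ 3 * (S * (c * c))| ≤ 16 * Real.pi * q ^ 3 * (1 * (1 * 1)) := by
    rw [abs_mul, abs_of_nonneg (by positivity)]
    exact mul_le_mul_of_nonneg_left (abs_mul_le_of_le hS (abs_mul_le_of_le hc hc))
      (by positivity)
  have b3 : |8 * Real.pi * q ^ 2 * (S * (c * e))| ≤ 8 * Real.pi * q ^ 2 * (1 * (1 * (4 * q ^ 4))) := by
    rw [abs_mul, abs_of_nonneg (by positivity)]
    exact mul_le_mul_of_nonneg_left (abs_mul_le_of_le hS (abs_mul_le_of_le hc h0))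
      (by positivity)
  have c1 : 4 * Real.pi * q * (1 * (4 * q ^ 4)) ≤ 2 * Real.pi * q ^ 4 := by
    have : 0 ≤ Real.pi * q ^ 4 := by positivity
    nlinarith
  have c3 : 8 * Real.pi * q ^ 2 * (1 * (1 * (4 * q ^ 4))) ≤ Real.pi * q ^ 4 := by
    have : 0 ≤ Real.pi * q ^ 4 := by positivity
    nlinarith
  have hnum : |e' + 4 * Real.pi * q * (S * e) - 16 * Real.pi * q ^ 3 * (S * (c * c)) -
        8 * Real.pi * q ^ 2 * (S * (c * e))| ≤ 19 * Real.pi * q ^ 3 := by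
    have h5 := mul_le_mul_of_nonneg_left q4 hpi.le
    have h6 : 0 ≤ Real.pi * q ^ 3 := by positivity
    rw [abs_le] at h0' b1 b2 b3 ⊢
    constructor <;> linarith [h0'.1, h0'.2, b1.1, b1.2, b2.1, b2.2, b3.1, b3.2]
  rw [key, abs_div, abs_of_pos hθ0, div_le_iff₀ hθ0]
  refine hnum.trans ?_
  have : 160 * q ^ 3 * (1 / 2) ≤ 160 * q ^ 3 * θ := mul_le_mul_of_nonneg_left hb (by positivity)
  nlinarith

/-- The logarithm of the quotient of theta functions in the one-phase solution. -/
def logThetaRatio (p y z : ℝ) : ℝ := Real.log (theta3 (z - p) y / theta3 (z + p) y)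

theorem hasDerivAt_logThetaRatio (hy : 0 < y) (hq : q = Real.exp (-(Real.pi * y)))
    (h1 : q ≤ 1 / 8) (z : ℝ) :
    HasDerivAt (logThetaRatio p y) (theta3Deriv (z - p) y / theta3 (z - p) y -
      theta3Deriv (z + p) y / theta3 (z + p) y) z := by
  have hpos : ∀ x, 0 < theta3 x y := fun x => by linarith [(theta3_bounds (x := x) hy hq h1).2]
  have e : logThetaRatio p y = fun z => Real.log (theta3 (z - p) y) - Real.log (theta3 (z + p) y) :=
    funext fun z => Real.log_div (hpos _).ne' (hpos _).ne'
  rw [e]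
  have d1 := (hasDerivAt_theta3 (z - p) hy).comp_sub_const z p
  have d2 := (hasDerivAt_theta3 (z + p) hy).comp_add_const z p
  exact (d1.log (hpos _).ne').sub (d2.log (hpos _).ne')

theorem abs_logThetaRatio_sub_le (hy : 0 < y) (hq : q = Real.exp (-(Real.pi * y)))
    (h1 : q ≤ 1 / 8) (z : ℝ) :
    |logThetaRatio p y z - 4 * q * Real.sin (2 * Real.pi * p) * Real.sin (2 * Real.pi * z)| ≤
      38 * q ^ 2 := by
  have hpos : ∀ x, 0 < theta3 x y := fun x => by linarith [(theta3_bounds (x := x) hy hq h1).2]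
  have a1 := abs_log_theta3_sub_le (x := z - p) hy hq h1
  have a2 := abs_log_theta3_sub_le (x := z + p) hy hq h1
  have e1 : Real.cos (2 * Real.pi * (z - p)) - Real.cos (2 * Real.pi * (z + p)) =
      2 * Real.sin (2 * Real.pi * p) * Real.sin (2 * Real.pi * z) := by
    rw [mul_sub, mul_add, Real.cos_sub, Real.cos_add]
    ring
  rw [logThetaRatio, Real.log_div (hpos _).ne' (hpos _).ne',
    show 4 * q * Real.sin (2 * Real.pi * p) * Real.sin (2 * Real.pi * z) =
      2 * q * (2 * Real.sin (2 * Real.pi * p) * Real.sin (2 * Real.pi * z)) by ring, ← e1]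
  rw [abs_le] at a1 a2 ⊢
  constructor <;> linarith [a1.1, a1.2, a2.1, a2.2]

theorem abs_deriv_logThetaRatio_sub_le (hy : 0 < y) (hq : q = Real.exp (-(Real.pi * y)))
    (h1 : q ≤ 1 / 8) (z : ℝ) :
    |deriv (logThetaRatio p y) z -
      (8 * Real.pi * q * Real.sin (2 * Real.pi * p) * Real.cos (2 * Real.pi * z) -
        8 * Real.pi * q ^ 2 * Real.sin (2 * (2 * Real.pi * p)) * Real.cos (2 * (2 * Real.pi * z)))| ≤
      320 * q ^ 3 := by
  have a1 := abs_theta3_logDeriv_sub_le (x := z - p) hy hq h1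
  have a2 := abs_theta3_logDeriv_sub_le (x := z + p) hy hq h1
  have e1 : Real.sin (2 * Real.pi * (z + p)) - Real.sin (2 * Real.pi * (z - p)) =
      2 * Real.sin (2 * Real.pi * p) * Real.cos (2 * Real.pi * z) := by
    rw [mul_sub, mul_add, Real.sin_sub, Real.sin_add]
    ring
  have e2 : Real.sin (2 * (2 * Real.pi * (z + p))) - Real.sin (2 * (2 * Real.pi * (z - p))) =
      2 * Real.sin (2 * (2 * Real.pi * p)) * Real.cos (2 * (2 * Real.pi * z)) := by
    rw [mul_sub, mul_add, mul_sub, mul_add, Real.sin_sub, Real.sin_add]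
    ring
  rw [(hasDerivAt_logThetaRatio hy hq h1 z).deriv,
    show 8 * Real.pi * q * Real.sin (2 * Real.pi * p) * Real.cos (2 * Real.pi * z) -
        8 * Real.pi * q ^ 2 * Real.sin (2 * (2 * Real.pi * p)) * Real.cos (2 * (2 * Real.pi * z)) =
      4 * Real.pi * q * (2 * Real.sin (2 * Real.pi * p) * Real.cos (2 * Real.pi * z)) -
        4 * Real.pi * q ^ 2 *
          (2 * Real.sin (2 * (2 * Real.pi * p)) * Real.cos (2 * (2 * Real.pi * z))) by ring,
    ← e1, ← e2]
  rw [abs_le] at a1 a2 ⊢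
  constructor <;> linarith [a1.1, a1.2, a2.1, a2.2]

/-- The derivative is at least 2π - 100qk > 0, and the perturbation of 2πz is bounded, so the map is
strictly increasing and tends to ±∞. -/
theorem bijective_phase (hy : 0 < y) (hq : q = Real.exp (-(Real.pi * y)))
    (h1 : q ≤ 1 / 8) {k : ℝ} (hk : 0 < k) (hkq : 100 * q * k < 6) :
    Function.Bijective fun z => 2 * Real.pi * z - k * logThetaRatio p y z := by
  have hq0 : 0 ≤ q := hq ▸ (Real.exp_pos _).le
  have hpi := Real.pi_gt_three
  have hpi4 := Real.pi_lt_d2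
  have hq2 : q ^ 2 ≤ 1 / 8 * q := by nlinarith
  have hq3 : q ^ 3 ≤ 1 / 64 * q := by nlinarith
  have hD : ∀ z, |deriv (logThetaRatio p y) z| ≤ 100 * q := fun z => by
    have h := abs_deriv_logThetaRatio_sub_le (p := p) hy hq h1 z
    have b1 : |8 * Real.pi * q * Real.sin (2 * Real.pi * p) * Real.cos (2 * Real.pi * z)| ≤
        8 * Real.pi * q := by
      rw [abs_mul, abs_mul, abs_of_nonneg (by positivity), mul_assoc]
      exact mul_le_of_le_one_right (by positivity)
        (mul_le_one₀ (Real.abs_sin_le_one _) (abs_nonneg _) (Real.abs_cos_le_one _))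
    have b2 : |8 * Real.pi * q ^ 2 * Real.sin (2 * (2 * Real.pi * p)) *
        Real.cos (2 * (2 * Real.pi * z))| ≤ 8 * Real.pi * q ^ 2 := by
      rw [abs_mul, abs_mul, abs_of_nonneg (by positivity), mul_assoc]
      exact mul_le_of_le_one_right (by positivity)
        (mul_le_one₀ (Real.abs_sin_le_one _) (abs_nonneg _) (Real.abs_cos_le_one _))
    have c1 : Real.pi * q ≤ 3.15 * q := mul_le_mul_of_nonneg_right hpi4.le hq0
    have c2 : Real.pi * q ^ 2 ≤ 3.15 * q ^ 2 := mul_le_mul_of_nonneg_right hpi4.le (sq_nonneg q)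
    rw [abs_le] at h b1 b2 ⊢
    constructor <;> linarith [h.1, h.2, b1.1, b1.2, b2.1, b2.2]
  have hd : ∀ z, HasDerivAt (fun z => 2 * Real.pi * z - k * logThetaRatio p y z)
      (2 * Real.pi - k * deriv (logThetaRatio p y) z) z := fun z => by
    have h := (hasDerivAt_logThetaRatio (p := p) hy hq h1 z).differentiableAt.hasDerivAt
    simpa using! ((hasDerivAt_id z).const_mul (2 * Real.pi)).sub (h.const_mul k)
  have hcont : Continuous fun z => 2 * Real.pi * z - k * logThetaRatio p y z :=
    continuous_iff_continuousAt.2 fun z => (hd z).continuousAt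
  have hb : ∀ z, |k * logThetaRatio p y z| ≤ k * 20 := fun z => by
    have h := abs_logThetaRatio_sub_le (p := p) hy hq h1 z
    have b1 : |4 * q * Real.sin (2 * Real.pi * p) * Real.sin (2 * Real.pi * z)| ≤ 4 * q := by
      rw [abs_mul, abs_mul, abs_of_nonneg (by positivity), mul_assoc]
      exact mul_le_of_le_one_right (by positivity)
        (mul_le_one₀ (Real.abs_sin_le_one _) (abs_nonneg _) (Real.abs_sin_le_one _))
    rw [abs_mul, abs_of_pos hk]
    refine mul_le_mul_of_nonneg_left ?_ hk.le
    rw [abs_le] at h b1 ⊢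
    constructor <;> linarith [h.1, h.2, b1.1, b1.2]
  constructor
  · refine StrictMono.injective (strictMono_of_deriv_pos fun z => ?_)
    rw [(hd z).deriv]
    have := mul_le_mul_of_nonneg_left (le_of_abs_le (hD z)) hk.le
    linarith
  · refine hcont.surjective ?_ ?_
    · refine tendsto_atTop_mono (f := fun z => 2 * Real.pi * z - k * 20) (fun z => ?_) ?_
      · linarith [le_of_abs_le (hb z)]
      · exact tendsto_atTop_add_const_right _ _
          (tendsto_id.const_mul_atTop (by positivity))
    · refine tendsto_atBot_mono (f := fun z => 2 * Real.pi * z + k * 20) (fun z => ?_) ?_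
      · linarith [neg_le_of_abs_le (hb z)]
      · exact tendsto_atBot_add_const_right _ _
          (tendsto_id.const_mul_atBot (by positivity))

end ThetaRatio

/-! ### The angle `2πp` -/

/-- In the quotient the correction s²/4 · arcsin w of the incomplete integral cancels the correction
s²/4 of K. -/
theorem abs_shift_angle_sub_le {w s : ℝ} (hw0 : 0 ≤ w) (hw1 : w ≤ 1) (hs : s ^ 2 ≤ 3 / 40) :
    |2 * Real.pi * (1 / (2 * ellipticK s) *
        ∫ z in (0 : ℝ)..w, 1 / √((1 - z ^ 2) * (1 - s ^ 2 * z ^ 2))) -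
      (2 * Real.arcsin w - s ^ 2 / 2 * (w * √(1 - w ^ 2)))| ≤ 20 * s ^ 4 := by
  have hF := abs_incomplete_elliptic_sub_le hw0 hw1 (by linarith : s ^ 2 ≤ 1 / 2)
  have hK := abs_ellipticK_sub_le (by linarith : s ^ 2 ≤ 1 / 2)
  have hpi := Real.pi_gt_three
  have hpi2 := Real.pi_lt_d2
  have hK1 : 1 ≤ ellipticK s := by
    have := (ellipticK_bounds hs).1
    rw [div_mul_eq_mul_div, one_le_div (by linarith)] at this
    linarith
  have ha0 : 0 ≤ Real.arcsin w := Real.arcsin_nonneg.2 hw0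
  have ha1 := Real.arcsin_le_pi_div_two w
  have hη : |w * √(1 - w ^ 2)| ≤ 1 * 1 := by
    refine abs_mul_le_of_le (by rwa [abs_of_nonneg hw0]) ?_
    rw [abs_of_nonneg (Real.sqrt_nonneg _)]
    exact Real.sqrt_le_iff.2 ⟨zero_le_one, by linarith [sq_nonneg w]⟩
  generalize w * √(1 - w ^ 2) = η at *
  generalize (∫ z in (0 : ℝ)..w, 1 / √((1 - z ^ 2) * (1 - s ^ 2 * z ^ 2))) = F at *
  generalize ellipticK s = K at *
  generalize Real.arcsin w = α at *
  obtain ⟨e, he⟩ : ∃ e, e = F - (α + s ^ 2 / 4 * (α - η)) := ⟨_, rfl⟩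
  obtain ⟨e', he'⟩ : ∃ e', e' = K - Real.pi / 2 * (1 + s ^ 2 / 4) := ⟨_, rfl⟩
  rw [← he] at hF
  rw [← he'] at hK
  -- The term with π/16 · s⁴ is the product of the two s² corrections; `e` and `e'` are the errors
  -- of the two integrals.
  have key : 2 * Real.pi * (1 / (2 * K) * F) - (2 * α - s ^ 2 / 2 * η) =
      (Real.pi * e - e' * (2 * α - s ^ 2 / 2 * η) + Real.pi / 16 * s ^ 4 * η) / K := by
    have hF' : F = e + (α + s ^ 2 / 4 * (α - η)) := by linarith
    rw [eq_div_iff (by linarith)]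
    have : K * K⁻¹ = 1 := mul_inv_cancel₀ (by linarith)
    rw [hF', he', one_div, mul_inv]
    linear_combination (Real.pi * (e + (α + s ^ 2 / 4 * (α - η)))) * this
  have hs4 : 0 ≤ s ^ 4 := by positivity
  have hT : |2 * α - s ^ 2 / 2 * η| ≤ 4 := by
    have := abs_mul_le_of_le (show |s ^ 2 / 2| ≤ 1 / 2 by
      rw [abs_of_nonneg (by positivity)]; linarith) hη
    rw [abs_le] at this ⊢
    constructor <;> linarith [this.1, this.2]
  have b1 := abs_mul_le_of_le (show |Real.pi| ≤ 3.15 by rw [abs_of_pos (by linarith)]; linarith) hF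
  have b2 := abs_mul_le_of_le hK hT
  have b3 := abs_mul_le_of_le (show |Real.pi / 16 * s ^ 4| ≤ 1 * s ^ 4 by
    rw [abs_of_nonneg (by positivity)]
    exact mul_le_mul_of_nonneg_right (by linarith) hs4) hη
  rw [key, abs_div, abs_of_pos (by linarith : 0 < K)]
  refine (div_le_self (abs_nonneg _) hK1).trans ?_
  rw [abs_le] at b1 b2 b3 ⊢
  constructor <;> linarith [b1.1, b1.2, b2.1, b2.2, b3.1, b3.2]

theorem abs_sin_add_sub_le (ψ h : ℝ) : |Real.sin (ψ + h) - Real.sin ψ - h * Real.cos ψ| ≤ h ^ 2 := by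
  have := abs_le_of_abs_deriv_le (φ := fun h => Real.sin (ψ + h) - Real.sin ψ - h * Real.cos ψ)
    (φ' := fun h => Real.cos (ψ + h) - Real.cos ψ) (C := 1) (n := 1) (ρ := |h| + 1) zero_le_one
    (by simp) (fun h _ => by
      have h1 := ((Real.hasDerivAt_sin (ψ + h)).comp_const_add ψ h).sub_const (Real.sin ψ)
      simpa using! h1.sub ((hasDerivAt_id h).mul_const (Real.cos ψ)))
    (fun h _ => by simpa using Real.abs_cos_sub_cos_le (ψ + h) ψ) (h := h) (by linarith)
  simpa using this

theorem abs_cos_add_sub_le (ψ h : ℝ) : |Real.cos (ψ + h) - Real.cos ψ + h * Real.sin ψ| ≤ h ^ 2 := by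
  have := abs_sin_add_sub_le (ψ + Real.pi / 2) h
  rwa [show ψ + Real.pi / 2 + h = ψ + h + Real.pi / 2 by ring, Real.sin_add_pi_div_two,
    Real.sin_add_pi_div_two, Real.cos_add_pi_div_two, mul_neg, sub_neg_eq_add] at this

/-! ### Powers of a small quantity -/

/-- `f = O(dⁿ)` along the filter `l`. -/
def IsBigOPow {ι : Type*} (l : Filter ι) (d : ι → ℝ) (n : ℕ) (f : ι → ℝ) : Prop :=
  f =O[l] fun x => d x ^ n

namespace IsBigOPow
variable {ι : Type*} {l : Filter ι} {d f g f' g' : ι → ℝ} {m n i j : ℕ}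

theorem congr' (h : IsBigOPow l d n f) (e : ∀ᶠ x in l, g x = f x) : IsBigOPow l d n g :=
  IsBigO.congr' h (e.mono fun _ hx => hx.symm) EventuallyEq.rfl

theorem congr (h : IsBigOPow l d n f) (e : ∀ x, g x = f x) : IsBigOPow l d n g :=
  h.congr' (Eventually.of_forall e)

theorem add (hf : IsBigOPow l d n f) (hg : IsBigOPow l d n g) :
    IsBigOPow l d n fun x => f x + g x := IsBigO.add hf hg

theorem sub (hf : IsBigOPow l d n f) (hg : IsBigOPow l d n g) :
    IsBigOPow l d n fun x => f x - g x := IsBigO.sub hf hg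

theorem const_mul (hf : IsBigOPow l d n f) (c : ℝ) : IsBigOPow l d n fun x => c * f x :=
  IsBigO.const_mul_left hf c

theorem mul (hf : IsBigOPow l d m f) (hg : IsBigOPow l d n g) (e : m + n = i) :
    IsBigOPow l d i fun x => f x * g x := by
  have h := IsBigO.mul hf hg
  simp only [← pow_add, e] at h
  exact h

theorem pow (hf : IsBigOPow l d m f) (k : ℕ) : IsBigOPow l d (m * k) fun x => f x ^ k := by
  have h := IsBigO.pow hf k
  simp only [← pow_mul] at h
  exact h

theorem mono (hf : IsBigOPow l d n f) (hd : Tendsto d l (𝓝 0)) (h : m ≤ n) :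
    IsBigOPow l d m f := by
  refine IsBigO.trans hf ?_
  have h1 : (fun x => d x ^ (n - m)) =O[l] fun _ => (1 : ℝ) := (hd.pow (n - m)).isBigO_one ℝ
  refine (h1.mul (isBigO_refl (fun x => d x ^ m) l)).congr (fun x => ?_) fun x => one_mul _
  rw [← pow_add, Nat.sub_add_cancel h]

theorem of_abs_le (hg : IsBigOPow l d n g) {C : ℝ} (h : ∀ᶠ x in l, |f x| ≤ C * |g x|) :
    IsBigOPow l d n f :=
  (IsBigO.of_bound C h).trans hg

theorem of_tendsto {c : ℝ} (h : Tendsto f l (𝓝 c)) : IsBigOPow l d 0 f := by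
  have := h.isBigO_one ℝ
  simpa only [IsBigOPow, pow_zero] using this

theorem of_bounded {C : ℝ} (h : ∀ x, |f x| ≤ C) : IsBigOPow l d 0 f := by
  have : f =O[l] fun _ => (1 : ℝ) := IsBigO.of_bound C (Eventually.of_forall fun x => by
    simpa using h x)
  simpa only [IsBigOPow, pow_zero] using this

theorem self (l : Filter ι) (d : ι → ℝ) : IsBigOPow l d 1 d := by
  simpa only [IsBigOPow, pow_one] using isBigO_refl d l

theorem self_pow (l : Filter ι) (d : ι → ℝ) (n : ℕ) : IsBigOPow l d n fun x => d x ^ n :=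
  isBigO_refl _ l

theorem tendsto_zero (hf : IsBigOPow l d n f) (hd : Tendsto d l (𝓝 0)) (hn : n ≠ 0) :
    Tendsto f l (𝓝 0) :=
  IsBigO.trans_tendsto hf (by simpa [hn] using hd.pow n)

/-- Product rule for approximations, fg - f'g' = f(g-g') + (f-f')g': each error is improved by the
order of the other factor. -/
theorem mul_sub_mul (hf : IsBigOPow l d i f) (hg : IsBigOPow l d j fun x => g x - g' x)
    (e : i + j = n) {i' j' : ℕ} (hf' : IsBigOPow l d i' fun x => f x - f' x)
    (hg' : IsBigOPow l d j' g') (e' : i' + j' = n) :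
    IsBigOPow l d n fun x => f x * g x - f' x * g' x :=
  ((hf.mul hg e).add (hf'.mul hg' e')).congr fun x => by ring

theorem inv_sub_inv {c : ℝ} (h : IsBigOPow l d n fun x => f x - g x) (hf : Tendsto f l (𝓝 c))
    (hg : Tendsto g l (𝓝 c)) (hc : c ≠ 0) : IsBigOPow l d n fun x => (f x)⁻¹ - (g x)⁻¹ := by
  have h1 : IsBigOPow l d 0 fun x => (f x)⁻¹ := of_tendsto (hf.inv₀ hc)
  have h2 : IsBigOPow l d 0 fun x => (g x)⁻¹ := of_tendsto (hg.inv₀ hc)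
  refine (((h.mul h1 (add_zero n)).mul h2 (add_zero n)).const_mul (-1)).congr' ?_
  filter_upwards [hf.eventually_ne hc, hg.eventually_ne hc] with x hx hx'
  field_simp
  ring

end IsBigOPow

/-- A family of branch points at which `β₂` and `β₃` merge. -/
structure EdgeFamily {ι : Type*} (ν u v : ℝ) (l : Filter ι) (β : ι → Fin 3 → ℝ) : Prop where
  tendsto : TendstoEdge l β u v
  ordered : ∀ᶠ x in l, Ordered ν (β x)
  lower : 0 < v + ν
  upper : 0 < u - v

theorem partialB_periodDensity {ν : ℝ} {p : ℝ × ℝ} (h1 : 0 < p.2 + ν) (h2 : 0 < p.1 - p.2) :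
    partialB (periodDensity ν) p =
      -(periodDensity ν p * (p.1 - 2 * p.2 - ν) / (2 * (p.2 + ν) * (p.1 - p.2))) := by
  have h3 := mul_pos h1 h2
  have h4 := Real.sqrt_pos.2 h3
  have hd : HasDerivAt (fun b => (b + ν) * (p.1 - b)) (p.1 - 2 * p.2 - ν) p.2 := by
    refine (((hasDerivAt_id p.2).add_const ν).mul ((hasDerivAt_id p.2).const_sub p.1)).congr_deriv ?_
    simp
    ring
  have hd' := (hd.sqrt h3.ne').fun_inv h4.ne'
  have h5 := hasDerivAt_partialB (contDiffAt_periodDensity (ν := ν) h1 h2)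
  have e : (fun b => periodDensity ν (p.1, b)) = fun b => (√((b + ν) * (p.1 - b)))⁻¹ :=
    funext fun b => by simp [periodDensity]
  rw [e] at h5
  rw [h5.unique hd', periodDensity, Real.sq_sqrt h3.le]
  field_simp

theorem Ordered.halfGap_bounds {ν : ℝ} {β : Fin 3 → ℝ} (h : Ordered ν β) :
    0 < halfGap β ∧ halfGap β < center β + ν ∧ halfGap β < β 0 - center β := by
  obtain ⟨h1, h2, h3⟩ := h
  unfold halfGap center
  refine ⟨?_, ?_, ?_⟩ <;> linarith

theorem center_add_halfGap (β : Fin 3 → ℝ) : center β + halfGap β = β 1 := by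
  unfold center halfGap
  ring

theorem modulus_sq_eq {ν : ℝ} {β : Fin 3 → ℝ} (h : Ordered ν β) : modulus ν β ^ 2 =
    2 * (β 0 + ν) * halfGap β /
      ((center β + ν + halfGap β) * (β 0 - center β + halfGap β)) := by
  rw [modulus_sq h]
  unfold center halfGap
  congr 1 <;> ring

/-- Pointwise the length density is b + ν = (m+ν) + δ cos θ times the period density. -/
theorem bandMean_lengthDensity_eq {ν : ℝ} {β : Fin 3 → ℝ} (h : Ordered ν β) :
    bandMean (lengthDensity ν) β = (center β + ν) * bandMean (periodDensity ν) β +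
      halfGap β * cosMoment (periodDensity ν) (β 0) (center β) (halfGap β) := by
  have hc := continuous_band (smoothOnBand_periodDensity h)
  have hc' : Continuous fun θ =>
      Real.cos θ * periodDensity ν (β 0, center β + halfGap β * Real.cos θ) :=
    Real.continuous_cos.mul hc
  have e : ∀ θ, lengthDensity ν (β 0, center β + halfGap β * Real.cos θ) =
      (center β + ν) * periodDensity ν (β 0, center β + halfGap β * Real.cos θ) +
      halfGap β * (Real.cos θ * periodDensity ν (β 0, center β + halfGap β * Real.cos θ)) :=
    fun θ => by
      have h1 : 0 < center β + halfGap β * Real.cos θ + ν := by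
        linarith [(center_add_bounds h θ).1, h.1]
      have h2 : 0 < β 0 - (center β + halfGap β * Real.cos θ) := by
        linarith [(center_add_bounds h θ).2, h.2.2]
      simp only [lengthDensity, periodDensity]
      rw [Real.sqrt_div h1.le, Real.sqrt_mul h1.le]
      have h3 := Real.sqrt_pos.2 h1
      have h4 := Real.sqrt_pos.2 h2
      have h5 := Real.sq_sqrt h1.le
      field_simp
      rw [h5]
      ring
  simp only [bandMean, cosMean, cosMoment, e]
  rw [intervalIntegral.integral_add ((hc.const_mul _).intervalIntegrable _ _)
    ((hc'.const_mul _).intervalIntegrable _ _),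
    intervalIntegral.integral_const_mul, intervalIntegral.integral_const_mul]
  ring

/-- The cancellation behind the first harmonic: with `a`, `m` measured from -ν, the δ² corrections
of the nome, of sin 2πp and of the period add up to zero, leaving a multiple of δ³. -/
theorem amplitude_algebra {a m δ D r C : ℝ} (ha : a ≠ 0) (hD : D ≠ 0)
    (hDdef : D = (m + δ) * (a - m + δ)) (hr : r = 2 * a * δ / D) (hC : C = 1 - 2 * (m + δ) / a) :
    r / a * (1 + r * (2 - C) / 4) * ((m * (a - m) + (m + δ) * (a - m - δ)) / 2) - 2 * δ =
      (-2 * (m * (a - m)) - a ^ 2 - 4 * a * m - 4 * m ^ 2 - (7 * a + 10 * m) * δ - 8 * δ ^ 2) /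
        (2 * D ^ 2) * δ ^ 3 := by
  have h1 : r * (2 - C) / 4 = δ * (a + 2 * m + 2 * δ) / (2 * D) := by
    rw [hr, hC]
    field_simp
    ring
  have h2 : r / a = 2 * δ / D := by
    rw [hr]
    field_simp
  rw [h1, h2]
  field_simp
  rw [hDdef]
  ring

/-! ### Orders in δ of the modulus, the periods and the mean value -/

namespace EdgeFamily
variable {ι : Type*} {ν u v : ℝ} {l : Filter ι} {β : ι → Fin 3 → ℝ}

theorem tendsto_halfGap (h : EdgeFamily ν u v l β) :
    Tendsto (fun x => halfGap (β x)) l (𝓝 0) := h.tendsto.tendsto_halfGap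

/-- `G` is the cofactor of δⁿ as a function of (β₁, m, δ). Continuity at the edge bounds it, so
order estimates reduce to algebraic identities. -/
theorem of_eq (h : EdgeFamily ν u v l β) {G : ℝ × ℝ × ℝ → ℝ}
    (hG : ContinuousAt G (u, v, 0)) {f : ι → ℝ} {n : ℕ}
    (e : ∀ᶠ x in l, f x = G (β x 0, center (β x), halfGap (β x)) * halfGap (β x) ^ n) :
    IsBigOPow l (fun x => halfGap (β x)) n f :=
  ((IsBigOPow.of_tendsto (hG.tendsto.comp h.tendsto)).mul (IsBigOPow.self_pow _ _ n)
    (zero_add n)).congr' e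

theorem modulus_sq_isBigOPow (h : EdgeFamily ν u v l β) :
    IsBigOPow l (fun x => halfGap (β x)) 1 fun x => modulus ν (β x) ^ 2 := by
  have h1 := h.lower
  have h2 := h.upper
  refine h.of_eq (G := fun p => 2 * (p.1 + ν) / ((p.2.1 + ν + p.2.2) * (p.1 - p.2.1 + p.2.2)))
    (ContinuousAt.div (by fun_prop) (by fun_prop) (by simp; constructor <;> linarith)) ?_
  filter_upwards [h.ordered] with x hx
  rw [modulus_sq_eq hx]
  ring

theorem eventually_modulus (h : EdgeFamily ν u v l β) {c : ℝ} (hc : 0 < c) :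
    ∀ᶠ x in l, 0 < modulus ν (β x) ∧ modulus ν (β x) ^ 2 < c := by
  filter_upwards [h.ordered, (h.modulus_sq_isBigOPow.tendsto_zero h.tendsto_halfGap
    one_ne_zero).eventually (gt_mem_nhds hc)] with x hx hx'
  obtain ⟨h1, h2, h3⟩ := hx
  refine ⟨Real.sqrt_pos.2 (div_pos (mul_pos ?_ ?_) (mul_pos ?_ ?_)), hx'⟩ <;> linarith

theorem smoothNear_period (h : EdgeFamily ν u v l β) : SmoothNear (periodDensity ν) (u, v) :=
  smoothNear_periodDensity h.lower h.upper

theorem smoothNear_length (h : EdgeFamily ν u v l β) : SmoothNear (lengthDensity ν) (u, v) :=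
  smoothNear_lengthDensity h.lower h.upper

theorem bandMean_sub_isBigOPow (h : EdgeFamily ν u v l β) {F : ℝ × ℝ → ℝ}
    (hF : SmoothNear F (u, v)) :
    IsBigOPow l (fun x => halfGap (β x)) 2
      fun x => bandMean F (β x) - F (β x 0, center (β x)) := by
  have h1 : IsBigOPow l (fun x => halfGap (β x)) 4 _ := bandMean_sub_pair_isBigO h.tendsto hF
  have h2 : IsBigOPow l (fun x => halfGap (β x)) 2 fun x =>
      partialB (partialB F) (β x 0, center (β x)) / 4 * halfGap (β x) ^ 2 :=
    (IsBigOPow.of_tendsto ((hF.partialB.partialB.continuousAt.tendsto.comp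
      h.tendsto.tendsto_pair).div_const 4)).mul (IsBigOPow.self_pow _ _ 2) (zero_add 2)
  exact ((h1.mono h.tendsto_halfGap (by norm_num)).add h2).congr fun x => by ring

theorem period_pos (h : EdgeFamily ν u v l β) : 0 < periodDensity ν (u, v) :=
  one_div_pos.2 (Real.sqrt_pos.2 (mul_pos h.lower h.upper))

theorem length_pos (h : EdgeFamily ν u v l β) : 0 < lengthDensity ν (u, v) :=
  Real.sqrt_pos.2 (div_pos h.lower h.upper)

theorem inv_period_isBigOPow (h : EdgeFamily ν u v l β) :
    IsBigOPow l (fun x => halfGap (β x)) 0 fun x => (bandMean (periodDensity ν) (β x))⁻¹ :=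
  IsBigOPow.of_tendsto ((tendsto_bandMean h.tendsto h.smoothNear_period).inv₀ h.period_pos.ne')

theorem inv_length_isBigOPow (h : EdgeFamily ν u v l β) :
    IsBigOPow l (fun x => halfGap (β x)) 0 fun x => (bandMean (lengthDensity ν) (β x))⁻¹ :=
  IsBigOPow.of_tendsto ((tendsto_bandMean h.tendsto h.smoothNear_length).inv₀ h.length_pos.ne')

theorem inv_period_sub_isBigOPow (h : EdgeFamily ν u v l β) :
    IsBigOPow l (fun x => halfGap (β x)) 2 fun x => (bandMean (periodDensity ν) (β x))⁻¹ -
      √((center (β x) + ν) * (β x 0 - center (β x))) := by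
  have h1 := (h.bandMean_sub_isBigOPow h.smoothNear_period).inv_sub_inv
    (tendsto_bandMean h.tendsto h.smoothNear_period)
    (h.smoothNear_period.continuousAt.tendsto.comp h.tendsto.tendsto_pair) h.period_pos.ne'
  refine h1.congr fun x => ?_
  simp [periodDensity]

/-- The error is δ⁴ rather than δ³ because the cosine moment, known up to δ³, is multiplied by δ in
`bandMean_lengthDensity_eq`. -/
theorem length_sub_isBigOPow (h : EdgeFamily ν u v l β) :
    IsBigOPow l (fun x => halfGap (β x)) 4 fun x =>
      bandMean (lengthDensity ν) (β x) - (center (β x) + ν) * bandMean (periodDensity ν) (β x) +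
        periodDensity ν (β x 0, center (β x)) * ((β x 0 - 2 * center (β x) - ν) /
          (4 * (center (β x) + ν) * (β x 0 - center (β x)))) * halfGap (β x) ^ 2 := by
  have h1 : IsBigOPow l (fun x => halfGap (β x)) 3 _ :=
    (cosMoment_sub_isBigO h.smoothNear_period).comp_tendsto h.tendsto
  refine ((IsBigOPow.self l (fun x => halfGap (β x))).mul h1 (by norm_num : 1 + 3 = 4)).congr' ?_
  filter_upwards [h.ordered] with x hx
  obtain ⟨b1, b2, b3⟩ := hx.halfGap_bounds
  rw [bandMean_lengthDensity_eq hx]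
  dsimp only [Function.comp]
  have c1 : 0 < center (β x) + ν := by linarith
  have c2 : 0 < β x 0 - center (β x) := by linarith
  rw [partialB_periodDensity c1 c2]
  dsimp only
  field_simp
  ring

/-- The mean value of the one-phase solution. -/
theorem mean_isBigOPow (h : EdgeFamily ν u v l β) :
    IsBigOPow l (fun x => halfGap (β x)) 4 fun x => phaseVelocity ν (β x)
      - 2 * (β x 2 + ν) * (ellipticLambda (modulus ν (β x)) (rho ν (β x)) /
        ellipticK (modulus ν (β x))) -
      (β x 0 + (β x 0 - 2 * center (β x) - ν) /
          (2 * (center (β x) + ν) * (β x 0 - center (β x))) * halfGap (β x) ^ 2) := by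
  have h1 := h.lower
  have h2 := h.upper
  have hκ : IsBigOPow l (fun x => halfGap (β x)) 2 fun x => (β x 0 - 2 * center (β x) - ν) /
      (2 * (center (β x) + ν) * (β x 0 - center (β x))) * halfGap (β x) ^ 2 := by
    refine h.of_eq (G := fun p => (p.1 - 2 * p.2.1 - ν) / (2 * (p.2.1 + ν) * (p.1 - p.2.1)))
      (ContinuousAt.div (by fun_prop) (by fun_prop) (by simp; constructor <;> linarith)) ?_
    exact Eventually.of_forall fun x => rfl
  -- The phase velocity is β₁ + 2(m+ν), and L/J = (m+ν) - (κ/2)(h/J)δ² + O(δ⁴), where J is the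
  -- average of the period density, h its value at the centre and κδ² the claimed correction. `a1`
  -- is this error; `a2` replaces h/J by 1.
  have a1 := (h.length_sub_isBigOPow.mul h.inv_period_isBigOPow (add_zero 4)).const_mul (-2)
  have a2 := (hκ.mul (h.bandMean_sub_isBigOPow h.smoothNear_period) (by norm_num : 2 + 2 = 4)).mul
    h.inv_period_isBigOPow (add_zero 4)
  refine (a1.sub a2).congr' ?_
  filter_upwards [h.ordered] with x hx
  obtain ⟨b1, b2, b3⟩ := hx.halfGap_bounds
  have hJ := bandMean_periodDensity_pos hx
  rw [mul_assoc 2, lambda_div_K_eq hx]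
  change _ - 2 * (bandMean (lengthDensity ν) (β x) / bandMean (periodDensity ν) (β x)) - _ = _
  generalize bandMean (periodDensity ν) (β x) = J at *
  generalize bandMean (lengthDensity ν) (β x) = L at *
  have hv : phaseVelocity ν (β x) = β x 0 + 2 * (center (β x) + ν) := by
    unfold phaseVelocity center
    ring
  have c1 : 0 < center (β x) + ν := by linarith
  have c2 : 0 < β x 0 - center (β x) := by linarith
  rw [hv]
  generalize periodDensity ν (β x 0, center (β x)) = g
  field_simp
  ring

end EdgeFamily

/-! ### Orders in δ of the nome and of the angle 2πp -/

namespace EdgeFamily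
variable {ι : Type*} {ν u v : ℝ} {l : Filter ι} {β : ι → Fin 3 → ℝ}

theorem nome_sub_isBigOPow (h : EdgeFamily ν u v l β) :
    IsBigOPow l (fun x => halfGap (β x)) 3 fun x => nome (modulus ν (β x)) -
      (modulus ν (β x) ^ 2 / 16 + (modulus ν (β x) ^ 2) ^ 2 / 32) := by
  refine (h.modulus_sq_isBigOPow.pow 3).of_abs_le (C := 107) ?_
  filter_upwards [h.eventually_modulus one_half_pos] with x hx
  have := abs_nome_sub_le hx.1 hx.2.le
  rwa [abs_of_nonneg (a := (modulus ν (β x) ^ 2) ^ 3) (by positivity), ← pow_mul, ← pow_mul]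

theorem nome_sub_linear_isBigOPow (h : EdgeFamily ν u v l β) :
    IsBigOPow l (fun x => halfGap (β x)) 2 fun x => nome (modulus ν (β x)) -
      (β x 0 + ν) * halfGap (β x) / (8 * ((center (β x) + ν) * (β x 0 - center (β x)))) := by
  have h1 := h.lower
  have h2 := h.upper
  have a1 := h.nome_sub_isBigOPow.mono h.tendsto_halfGap (by norm_num : 2 ≤ 3)
  have a2 := (h.modulus_sq_isBigOPow.pow 2).const_mul (1 / 32)
  have a3 : IsBigOPow l (fun x => halfGap (β x)) 2 fun x => modulus ν (β x) ^ 2 / 16 -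
      (β x 0 + ν) * halfGap (β x) / (8 * ((center (β x) + ν) * (β x 0 - center (β x)))) := by
    refine h.of_eq (G := fun p => -((p.1 + ν) * (p.1 + ν + p.2.2)) /
      (8 * ((p.2.1 + ν + p.2.2) * (p.1 - p.2.1 + p.2.2)) * ((p.2.1 + ν) * (p.1 - p.2.1))))
      (ContinuousAt.div (by fun_prop) (by fun_prop) ?_) ?_
    · simp [h1.ne', h2.ne']
    · filter_upwards [h.ordered] with x hx
      obtain ⟨b1, b2, b3⟩ := hx.halfGap_bounds
      have c1 : 0 < center (β x) + ν := by linarith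
      have c2 : 0 < β x 0 - center (β x) := by linarith
      have c3 : 0 < center (β x) + ν + halfGap (β x) := by linarith
      have c4 : 0 < β x 0 - center (β x) + halfGap (β x) := by linarith
      rw [modulus_sq_eq hx]
      field_simp
      ring
  exact ((a1.add a2).add a3).congr fun x => by ring

theorem linear_isBigOPow (h : EdgeFamily ν u v l β) :
    IsBigOPow l (fun x => halfGap (β x)) 1 fun x =>
      (β x 0 + ν) * halfGap (β x) / (8 * ((center (β x) + ν) * (β x 0 - center (β x)))) := by
  have h1 := h.lower
  have h2 := h.upper
  refine h.of_eq (G := fun p => (p.1 + ν) / (8 * ((p.2.1 + ν) * (p.1 - p.2.1))))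
    (ContinuousAt.div (by fun_prop) (by fun_prop) (by simp; constructor <;> linarith)) ?_
  exact Eventually.of_forall fun x => by ring

theorem nome_isBigOPow (h : EdgeFamily ν u v l β) :
    IsBigOPow l (fun x => halfGap (β x)) 1 fun x => nome (modulus ν (β x)) :=
  ((h.nome_sub_linear_isBigOPow.mono h.tendsto_halfGap one_le_two).add h.linear_isBigOPow).congr
    fun x => by ring

/-- The sine and cosine of the limit of `2πp`. -/
def edgeSin (ν : ℝ) (β : Fin 3 → ℝ) : ℝ :=
  2 * √((center β + ν + halfGap β) * (β 0 - center β - halfGap β)) / (β 0 + ν)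

def edgeCos (ν : ℝ) (β : Fin 3 → ℝ) : ℝ := 1 - 2 * (center β + ν + halfGap β) / (β 0 + ν)

/-- The argument with sine `edgeSin` and cosine `edgeCos`. -/
def edgeAngle (ν : ℝ) (β : Fin 3 → ℝ) : ℝ := 2 * Real.arcsin (√((β 1 + ν) / (β 0 + ν)))

/-- Double-angle formulas: √((β₂+ν)/(β₁+ν)) is the sine of half the angle. -/
theorem edgeAngle_spec {β : Fin 3 → ℝ} (h : Ordered ν β) :
    Real.sin (edgeAngle ν β) = edgeSin ν β ∧ Real.cos (edgeAngle ν β) = edgeCos ν β ∧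
      2 * (√((β 1 + ν) / (β 0 + ν)) * √(1 - √((β 1 + ν) / (β 0 + ν)) ^ 2)) = edgeSin ν β ∧
      √((β 1 + ν) / (β 0 + ν)) ≤ 1 := by
  obtain ⟨h1, h2, h3⟩ := h
  have hb : 0 < β 1 + ν := by linarith
  have ha : 0 < β 0 + ν := by linarith
  have hw1 : √((β 1 + ν) / (β 0 + ν)) ≤ 1 := by
    rw [Real.sqrt_le_one, div_le_one ha]
    linarith
  have hw0 := Real.sqrt_nonneg ((β 1 + ν) / (β 0 + ν))
  have hsq := Real.sq_sqrt (div_pos hb ha).le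
  have e : 2 * (√((β 1 + ν) / (β 0 + ν)) * √(1 - √((β 1 + ν) / (β 0 + ν)) ^ 2)) =
      edgeSin ν β := by
    rw [hsq, ← Real.sqrt_mul (div_pos hb ha).le, edgeSin,
      show (β 1 + ν) / (β 0 + ν) * (1 - (β 1 + ν) / (β 0 + ν)) =
        (center β + ν + halfGap β) * (β 0 - center β - halfGap β) / (β 0 + ν) ^ 2 by
        rw [← center_add_halfGap β]
        field_simp
        ring, Real.sqrt_div' _ (sq_nonneg _), Real.sqrt_sq ha.le]
    ring
  refine ⟨?_, ?_, e, hw1⟩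
  · rw [edgeAngle, Real.sin_two_mul, Real.sin_arcsin (by linarith) hw1, Real.cos_arcsin, ← e]
    ring
  · rw [edgeAngle, Real.cos_two_mul, Real.cos_arcsin, Real.sq_sqrt, hsq, edgeCos,
      ← center_add_halfGap β]
    · ring
    · rw [hsq, sub_nonneg, div_le_one ha]
      linarith

theorem angle_isBigOPow (h : EdgeFamily ν u v l β) :
    IsBigOPow l (fun x => halfGap (β x)) 2 fun x =>
      2 * Real.pi * shiftP ν (β x) - edgeAngle ν (β x) +
        modulus ν (β x) ^ 2 / 4 * edgeSin ν (β x) := by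
  refine (h.modulus_sq_isBigOPow.pow 2).of_abs_le (C := 20) ?_
  filter_upwards [h.ordered, h.eventually_modulus (c := 3 / 40) (by norm_num)] with x hx hx'
  obtain ⟨-, -, e, hw⟩ := edgeAngle_spec hx
  have := abs_shift_angle_sub_le (Real.sqrt_nonneg _) hw hx'.2.le
  rw [abs_of_nonneg (a := (modulus ν (β x) ^ 2) ^ 2) (by positivity), ← pow_mul, ← e]
  refine le_trans (le_of_eq ?_) this
  rw [shiftP, edgeAngle]
  congr 1
  ring

theorem edgeSin_isBigOPow (h : EdgeFamily ν u v l β) :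
    IsBigOPow l (fun x => halfGap (β x)) 0 fun x => edgeSin ν (β x) := by
  have h1 := h.lower
  have h2 := h.upper
  refine h.of_eq (G := fun p =>
    2 * √((p.2.1 + ν + p.2.2) * (p.1 - p.2.1 - p.2.2)) / (p.1 + ν))
    (ContinuousAt.div (by fun_prop) (by fun_prop) (by simp; linarith)) ?_
  exact Eventually.of_forall fun x => by simp [edgeSin]

theorem edgeCos_isBigOPow (h : EdgeFamily ν u v l β) :
    IsBigOPow l (fun x => halfGap (β x)) 0 fun x => edgeCos ν (β x) := by
  have h1 := h.lower
  have h2 := h.upper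
  refine h.of_eq (G := fun p => 1 - 2 * (p.2.1 + ν + p.2.2) / (p.1 + ν))
    (ContinuousAt.sub (by fun_prop) (ContinuousAt.div (by fun_prop) (by fun_prop)
      (by simp; linarith))) ?_
  exact Eventually.of_forall fun x => by simp [edgeCos]

theorem sub_edgeAngle_isBigOPow (h : EdgeFamily ν u v l β) :
    IsBigOPow l (fun x => halfGap (β x)) 1 fun x =>
      2 * Real.pi * shiftP ν (β x) - edgeAngle ν (β x) := by
  have a1 := (h.modulus_sq_isBigOPow.mul h.edgeSin_isBigOPow (add_zero 1)).const_mul (1 / 4)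
  exact ((h.angle_isBigOPow.mono h.tendsto_halfGap one_le_two).sub a1).congr fun x => by ring

/-- First-order Taylor expansion of the sine at `edgeAngle`, from which 2πp differs by -s²/4 ·
`edgeSin` up to O(δ²). -/
theorem sin_shift_isBigOPow (h : EdgeFamily ν u v l β) :
    IsBigOPow l (fun x => halfGap (β x)) 2 fun x => Real.sin (2 * Real.pi * shiftP ν (β x)) -
      edgeSin ν (β x) * (1 - modulus ν (β x) ^ 2 * edgeCos ν (β x) / 4) := by
  have a1 := h.angle_isBigOPow.mul h.edgeCos_isBigOPow (add_zero 2)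
  have a2 : IsBigOPow l (fun x => halfGap (β x)) 2 fun x =>
      Real.sin (2 * Real.pi * shiftP ν (β x)) - edgeSin ν (β x) -
        (2 * Real.pi * shiftP ν (β x) - edgeAngle ν (β x)) * edgeCos ν (β x) := by
    refine (h.sub_edgeAngle_isBigOPow.pow 2).of_abs_le (C := 1) ?_
    filter_upwards [h.ordered] with x hx
    obtain ⟨e1, e2, -, -⟩ := edgeAngle_spec hx
    have := abs_sin_add_sub_le (edgeAngle ν (β x))
      (2 * Real.pi * shiftP ν (β x) - edgeAngle ν (β x))
    rw [add_sub_cancel, e1, e2] at this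
    rwa [one_mul, abs_of_nonneg (a := (2 * Real.pi * shiftP ν (β x) - edgeAngle ν (β x)) ^ 2)
      (sq_nonneg _)]
  exact (a2.add a1).congr fun x => by ring

theorem cos_shift_isBigOPow (h : EdgeFamily ν u v l β) :
    IsBigOPow l (fun x => halfGap (β x)) 1 fun x => Real.cos (2 * Real.pi * shiftP ν (β x)) -
      (1 - 2 * (center (β x) + ν) / (β x 0 + ν)) := by
  have h1 := h.lower
  have h2 := h.upper
  have a1 : IsBigOPow l (fun x => halfGap (β x)) 1 fun x =>
      Real.cos (2 * Real.pi * shiftP ν (β x)) - edgeCos ν (β x) := by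
    refine h.sub_edgeAngle_isBigOPow.of_abs_le (C := 1) ?_
    filter_upwards [h.ordered] with x hx
    rw [one_mul, ← (edgeAngle_spec hx).2.1]
    exact Real.abs_cos_sub_cos_le _ _
  have a2 : IsBigOPow l (fun x => halfGap (β x)) 1 fun x =>
      edgeCos ν (β x) - (1 - 2 * (center (β x) + ν) / (β x 0 + ν)) := by
    refine h.of_eq (G := fun p => -2 / (p.1 + ν))
      (ContinuousAt.div (by fun_prop) (by fun_prop) (by simp; linarith)) ?_
    exact Eventually.of_forall fun x => by
      unfold edgeCos
      ring
  exact (a1.add a2).congr fun x => by ring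

/-- √A√B = (A+B)/2 - (√A-√B)²/2, where √A - √B = O(δ). Trading the geometric for the arithmetic mean
makes the amplitude rational. -/
theorem sqrt_mul_sqrt_isBigOPow (h : EdgeFamily ν u v l β) :
    IsBigOPow l (fun x => halfGap (β x)) 2 fun x =>
      √((center (β x) + ν) * (β x 0 - center (β x))) *
        √((center (β x) + ν + halfGap (β x)) * (β x 0 - center (β x) - halfGap (β x))) -
      ((center (β x) + ν) * (β x 0 - center (β x)) +
        (center (β x) + ν + halfGap (β x)) * (β x 0 - center (β x) - halfGap (β x))) / 2 := by
  have h1 := h.lower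
  have h2 := h.upper
  have a1 : IsBigOPow l (fun x => halfGap (β x)) 1 fun x =>
      √((center (β x) + ν) * (β x 0 - center (β x))) -
        √((center (β x) + ν + halfGap (β x)) * (β x 0 - center (β x) - halfGap (β x))) := by
    refine h.of_eq (G := fun p => (2 * p.2.1 + ν - p.1 + p.2.2) /
      (√((p.2.1 + ν) * (p.1 - p.2.1)) + √((p.2.1 + ν + p.2.2) * (p.1 - p.2.1 - p.2.2))))
      (ContinuousAt.div (by fun_prop) (by fun_prop) ?_) ?_
    · have : 0 < √((v + ν) * (u - v)) := Real.sqrt_pos.2 (mul_pos h1 h2)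
      simp
      positivity
    · filter_upwards [h.ordered] with x hx
      obtain ⟨b1, b2, b3⟩ := hx.halfGap_bounds
      have c1 : 0 < (center (β x) + ν) * (β x 0 - center (β x)) :=
        mul_pos (by linarith) (by linarith)
      have c2 : 0 < (center (β x) + ν + halfGap (β x)) * (β x 0 - center (β x) - halfGap (β x)) :=
        mul_pos (by linarith) (by linarith)
      have d1 := Real.sqrt_pos.2 c1
      have d2 := Real.sqrt_pos.2 c2
      rw [div_mul_eq_mul_div, eq_div_iff (by positivity)]
      linear_combination Real.sq_sqrt c1.le - Real.sq_sqrt c2.le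
  refine ((a1.pow 2).const_mul (-1 / 2)).congr' ?_
  filter_upwards [h.ordered] with x hx
  obtain ⟨b1, b2, b3⟩ := hx.halfGap_bounds
  have c1 : 0 < (center (β x) + ν) * (β x 0 - center (β x)) :=
    mul_pos (by linarith) (by linarith)
  have c2 : 0 < (center (β x) + ν + halfGap (β x)) * (β x 0 - center (β x) - halfGap (β x)) :=
    mul_pos (by linarith) (by linarith)
  linear_combination (1 / 2) * Real.sq_sqrt c1.le + (1 / 2) * Real.sq_sqrt c2.le

end EdgeFamily

/-! ### Amplitudes of the harmonics -/

namespace EdgeFamily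
variable {ι : Type*} {ν u v : ℝ} {l : Filter ι} {β : ι → Fin 3 → ℝ}

theorem sqrt_isBigOPow (h : EdgeFamily ν u v l β) :
    IsBigOPow l (fun x => halfGap (β x)) 0
      fun x => √((center (β x) + ν) * (β x 0 - center (β x))) := by
  refine h.of_eq (G := fun p => √((p.2.1 + ν) * (p.1 - p.2.1))) (by fun_prop) ?_
  exact Eventually.of_forall fun x => by simp

theorem amplitude_leading_isBigOPow (h : EdgeFamily ν u v l β) :
    IsBigOPow l (fun x => halfGap (β x)) 3 fun x =>
      8 * (((modulus ν (β x) ^ 2 / 16 + (modulus ν (β x) ^ 2) ^ 2 / 32) *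
        (edgeSin ν (β x) * (1 - modulus ν (β x) ^ 2 * edgeCos ν (β x) / 4))) *
        √((center (β x) + ν) * (β x 0 - center (β x)))) - 2 * halfGap (β x) := by
  have h1 := h.lower
  have h2 := h.upper
  have hr := h.modulus_sq_isBigOPow
  have hR : IsBigOPow l (fun x => halfGap (β x)) 1 fun x =>
      modulus ν (β x) ^ 2 * (2 / (β x 0 + ν)) := by
    refine hr.mul (n := 0) (h.of_eq (G := fun p => 2 / (p.1 + ν))
      (ContinuousAt.div (by fun_prop) (by fun_prop) (by simp; linarith)) ?_) (add_zero 1)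
    exact Eventually.of_forall fun x => by simp
  have hfac : IsBigOPow l (fun x => halfGap (β x)) 0 fun x =>
      (1 + modulus ν (β x) ^ 2 / 2) * (1 - modulus ν (β x) ^ 2 * edgeCos ν (β x) / 4) := by
    have hone : IsBigOPow l (fun x => halfGap (β x)) 0 fun _ => (1 : ℝ) :=
      IsBigOPow.of_bounded (C := 1) fun _ => by simp
    have b1 := (hr.mono h.tendsto_halfGap zero_le_one).const_mul (1 / 2)
    have b2 := ((hr.mul h.edgeCos_isBigOPow (add_zero 1)).mono h.tendsto_halfGap
      zero_le_one).const_mul (1 / 4)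
    exact ((hone.add b1).mul (hone.sub b2) (zero_add 0)).congr fun x => by ring
  have hsum : IsBigOPow l (fun x => halfGap (β x)) 0 fun x =>
      ((center (β x) + ν) * (β x 0 - center (β x)) +
        (center (β x) + ν + halfGap (β x)) * (β x 0 - center (β x) - halfGap (β x))) / 2 := by
    refine h.of_eq (G := fun p => ((p.2.1 + ν) * (p.1 - p.2.1) +
      (p.2.1 + ν + p.2.2) * (p.1 - p.2.1 - p.2.2)) / 2) (by fun_prop) ?_
    exact Eventually.of_forall fun x => by simp
  have a1 := ((hR.mul hfac (add_zero 1)).mul h.sqrt_mul_sqrt_isBigOPow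
    (by norm_num : 1 + 2 = 3)).const_mul (1 / 2)
  have a2 := (((hR.mul ((hr.pow 2).mul h.edgeCos_isBigOPow (add_zero _))
    (by norm_num : 1 + 1 * 2 = 3)).mul hsum (add_zero 3))).const_mul (1 / 16)
  -- `a1` replaces the product of square roots by a rational expression and `a2` discards a term
  -- cubic in s²; what remains is `amplitude_algebra`.
  have a3 : IsBigOPow l (fun x => halfGap (β x)) 3 fun x =>
      modulus ν (β x) ^ 2 / (β x 0 + ν) *
        (1 + modulus ν (β x) ^ 2 * (2 - edgeCos ν (β x)) / 4) *
        (((center (β x) + ν) * (β x 0 - center (β x)) +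
        (center (β x) + ν + halfGap (β x)) * (β x 0 - center (β x) - halfGap (β x))) / 2) -
        2 * halfGap (β x) := by
    refine h.of_eq (G := fun p => (-2 * ((p.2.1 + ν) * (p.1 - p.2.1)) - (p.1 + ν) ^ 2 -
      4 * (p.1 + ν) * (p.2.1 + ν) - 4 * (p.2.1 + ν) ^ 2 -
      (7 * (p.1 + ν) + 10 * (p.2.1 + ν)) * p.2.2 - 8 * p.2.2 ^ 2) /
      (2 * ((p.2.1 + ν + p.2.2) * (p.1 - p.2.1 + p.2.2)) ^ 2))
      (ContinuousAt.div (by fun_prop) (by fun_prop) (by simp [h1.ne', h2.ne'])) ?_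
    filter_upwards [h.ordered] with x hx
    obtain ⟨b1, b2, b3⟩ := hx.halfGap_bounds
    have key := amplitude_algebra (a := β x 0 + ν) (m := center (β x) + ν) (δ := halfGap (β x))
      (D := (center (β x) + ν + halfGap (β x)) * (β x 0 - center (β x) + halfGap (β x)))
      (r := modulus ν (β x) ^ 2) (C := edgeCos ν (β x)) (by linarith)
      (mul_pos (by linarith) (by linarith)).ne' (by ring) (modulus_sq_eq hx) rfl
    rw [show β x 0 + ν - (center (β x) + ν) = β x 0 - center (β x) by ring] at key
    exact key
  refine ((a1.sub a2).add a3).congr' ?_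
  filter_upwards [h.ordered] with x hx
  obtain ⟨b1, b2, b3⟩ := hx.halfGap_bounds
  simp only [edgeSin]
  generalize edgeCos ν (β x) = C
  generalize modulus ν (β x) ^ 2 = r
  ring

/-- The amplitude of the first harmonic. -/
theorem amplitude_isBigOPow (h : EdgeFamily ν u v l β) :
    IsBigOPow l (fun x => halfGap (β x)) 3 fun x =>
      8 * (nome (modulus ν (β x)) * Real.sin (2 * Real.pi * shiftP ν (β x)) *
        (bandMean (periodDensity ν) (β x))⁻¹) - 2 * halfGap (β x) := by
  have hr := h.modulus_sq_isBigOPow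
  have hS : IsBigOPow l (fun x => halfGap (β x)) 0
      fun x => Real.sin (2 * Real.pi * shiftP ν (β x)) :=
    IsBigOPow.of_bounded fun x => Real.abs_sin_le_one _
  have hS0 := (hS.sub (h.sin_shift_isBigOPow.mono h.tendsto_halfGap zero_le_two)).congr
    (g := fun x => edgeSin ν (β x) * (1 - modulus ν (β x) ^ 2 * edgeCos ν (β x) / 4))
    fun x => by ring
  have a1 := h.nome_isBigOPow.mul_sub_mul h.sin_shift_isBigOPow (by norm_num : 1 + 2 = 3)
    h.nome_sub_isBigOPow hS0 (add_zero 3)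
  have a2 := (h.nome_isBigOPow.mul hS (add_zero 1)).mul_sub_mul h.inv_period_sub_isBigOPow
    (by norm_num : 1 + 2 = 3) a1 h.sqrt_isBigOPow (add_zero 3)
  exact ((a2.const_mul 8).add h.amplitude_leading_isBigOPow).congr fun x => by ring

/-- The amplitude of the second harmonic. -/
theorem second_amplitude_isBigOPow (h : EdgeFamily ν u v l β) :
    IsBigOPow l (fun x => halfGap (β x)) 3 fun x =>
      8 * (nome (modulus ν (β x)) ^ 2 * Real.sin (2 * (2 * Real.pi * shiftP ν (β x))) *
        (bandMean (periodDensity ν) (β x))⁻¹) -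
      (β x 0 - 2 * center (β x) - ν) /
          (2 * (center (β x) + ν) * (β x 0 - center (β x))) * halfGap (β x) ^ 2 := by
  have h1 := h.lower
  have h2 := h.upper
  have hC : IsBigOPow l (fun x => halfGap (β x)) 0
      fun x => 1 - 2 * (center (β x) + ν) / (β x 0 + ν) := by
    refine h.of_eq (G := fun p => 1 - 2 * (p.2.1 + ν) / (p.1 + ν))
      (ContinuousAt.sub (by fun_prop) (ContinuousAt.div (by fun_prop) (by fun_prop)
      (by simp; linarith))) ?_
    exact Eventually.of_forall fun x => by simp
  have a1 := h.nome_isBigOPow.mul_sub_mul h.cos_shift_isBigOPow (by norm_num : 1 + 1 = 2)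
    h.nome_sub_linear_isBigOPow hC (add_zero 2)
  have hA : IsBigOPow l (fun x => halfGap (β x)) 1 fun x =>
      8 * (nome (modulus ν (β x)) * Real.sin (2 * Real.pi * shiftP ν (β x)) *
        (bandMean (periodDensity ν) (β x))⁻¹) :=
    ((h.nome_isBigOPow.mul (IsBigOPow.of_bounded fun x => Real.abs_sin_le_one _)
      (add_zero 1)).mul h.inv_period_isBigOPow (add_zero 1)).const_mul 8
  -- By sin 2φ = 2 sin φ cos φ, the second amplitude is twice the first times nome · cos 2πp.
  have a2 := hA.mul_sub_mul a1 (by norm_num : 1 + 2 = 3)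
    (h.amplitude_isBigOPow.mono h.tendsto_halfGap (by norm_num : 2 ≤ 3))
    (h.linear_isBigOPow.mul hC (add_zero 1)) (by norm_num : 2 + 1 = 3)
  refine (a2.const_mul 2).congr' ?_
  filter_upwards [h.ordered] with x hx
  obtain ⟨b1, b2, b3⟩ := hx.halfGap_bounds
  have c1 : 0 < center (β x) + ν := by linarith
  have c2 : 0 < β x 0 - center (β x) := by linarith
  have c3 : 0 < β x 0 + ν := by linarith
  rw [Real.sin_two_mul]
  generalize (bandMean (periodDensity ν) (β x))⁻¹ = J
  generalize Real.sin (2 * Real.pi * shiftP ν (β x)) = S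
  generalize Real.cos (2 * Real.pi * shiftP ν (β x)) = C
  field_simp
  ring

/-- The amplitude of the difference between the phase and its uniformizing parameter. -/
theorem phase_amplitude_isBigOPow (h : EdgeFamily ν u v l β) :
    IsBigOPow l (fun x => halfGap (β x)) 2 fun x =>
      4 * waveNumber ν (β x) * nome (modulus ν (β x)) *
        Real.sin (2 * Real.pi * shiftP ν (β x)) - halfGap (β x) / (center (β x) + ν) := by
  have h1 := h.lower
  have h2 := h.upper
  have hm : IsBigOPow l (fun x => halfGap (β x)) 0 fun x => 1 / (2 * (center (β x) + ν)) := by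
    refine h.of_eq (G := fun p => 1 / (2 * (p.2.1 + ν)))
      (ContinuousAt.div (by fun_prop) (by fun_prop) (by simp; linarith)) ?_
    exact Eventually.of_forall fun x => by simp
  have hG : IsBigOPow l (fun x => halfGap (β x)) 2 fun x =>
      periodDensity ν (β x 0, center (β x)) * ((β x 0 - 2 * center (β x) - ν) /
          (4 * (center (β x) + ν) * (β x 0 - center (β x)))) * halfGap (β x) ^ 2 := by
    refine ((IsBigOPow.of_tendsto (h.smoothNear_period.continuousAt.tendsto.comp
      h.tendsto.tendsto_pair)).mul (n := 0) (h.of_eq (G := fun p => (p.1 - 2 * p.2.1 - ν) /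
        (4 * (p.2.1 + ν) * (p.1 - p.2.1))) (ContinuousAt.div (by fun_prop) (by fun_prop)
        (by simp [h1.ne', h2.ne'])) ?_) (add_zero 0)).mul (IsBigOPow.self_pow _ _ 2) (zero_add 2)
    exact Eventually.of_forall fun x => by simp
  have hL := ((h.length_sub_isBigOPow.mono h.tendsto_halfGap (by norm_num : 2 ≤ 4)).sub hG)
  have hq : IsBigOPow l (fun x => halfGap (β x)) 2 fun x =>
      bandMean (periodDensity ν) (β x) * (bandMean (lengthDensity ν) (β x))⁻¹ / 2 -
        1 / (2 * (center (β x) + ν)) := by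
    refine (((hL.mul h.inv_length_isBigOPow (add_zero 2)).mul hm (add_zero 2)).const_mul
      (-1)).congr' ?_
    filter_upwards [h.ordered] with x hx
    obtain ⟨b1, b2, b3⟩ := hx.halfGap_bounds
    have c1 : 0 < center (β x) + ν := by linarith
    have c2 := bandMean_lengthDensity_pos hx
    rw [add_sub_cancel_right]
    field_simp
    ring
  have hA : IsBigOPow l (fun x => halfGap (β x)) 1 fun x =>
      8 * (nome (modulus ν (β x)) * Real.sin (2 * Real.pi * shiftP ν (β x)) *
        (bandMean (periodDensity ν) (β x))⁻¹) :=
    ((h.nome_isBigOPow.mul (IsBigOPow.of_bounded fun x => Real.abs_sin_le_one _)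
      (add_zero 1)).mul h.inv_period_isBigOPow (add_zero 1)).const_mul 8
  -- The quantity is the first amplitude times J/(2L), where J and L are the averages of the period
  -- and length densities and J/L = 1/(m+ν) + O(δ²).
  have a1 := hA.mul_sub_mul (hq.mono h.tendsto_halfGap one_le_two) (by norm_num : 1 + 1 = 2)
    (h.amplitude_isBigOPow.mono h.tendsto_halfGap (by norm_num : 2 ≤ 3)) hm (add_zero 2)
  refine a1.congr' ?_
  filter_upwards [h.ordered] with x hx
  obtain ⟨b1, b2, b3⟩ := hx.halfGap_bounds
  have c1 : 0 < center (β x) + ν := by linarith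
  have c2 := bandMean_lengthDensity_pos hx
  have c3 := bandMean_periodDensity_pos hx
  rw [waveNumber_eq hx]
  change 4 * (1 / bandMean (lengthDensity ν) (β x)) * _ * _ - _ = _
  field_simp
  ring

end EdgeFamily

/-! ### Phase inversion and the expansion of the solution -/

namespace EdgeFamily
variable {ι : Type*} {ν u v : ℝ} {l : Filter ι} {β : ι → Fin 3 → ℝ} {z : ι → ℝ}

theorem eventually_nome (h : EdgeFamily ν u v l β) :
    ∀ᶠ x in l, 0 < tauIm ν (β x) ∧ nome (modulus ν (β x)) ≤ 1 / 8 := by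
  filter_upwards [(h.nome_isBigOPow.tendsto_zero h.tendsto_halfGap one_ne_zero).eventually
    (gt_mem_nhds (show (0 : ℝ) < 1 / 8 by norm_num))] with x hx
  refine ⟨?_, hx.le⟩
  -- If the imaginary part of τ were not positive, the nome would be at least 1, although it tends
  -- to zero. This avoids bounding the elliptic integrals.
  by_contra hneg
  have : 1 ≤ nome (modulus ν (β x)) := by
    refine Real.one_le_exp ?_
    change 0 ≤ -(Real.pi * tauIm ν (β x))
    nlinarith [Real.pi_pos]
  linarith

theorem waveNumber_isBigOPow (h : EdgeFamily ν u v l β) :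
    IsBigOPow l (fun x => halfGap (β x)) 0 fun x => waveNumber ν (β x) := by
  refine h.inv_length_isBigOPow.congr' ?_
  filter_upwards [h.ordered] with x hx
  rw [waveNumber_eq hx, one_div]
  rfl

/-- Eventually the uniformizing parameter is determined by the phase. -/
theorem eventually_bijective (h : EdgeFamily ν u v l β) :
    ∀ᶠ x in l, Function.Bijective (onePhaseZeta ν (β x)) := by
  have hqk := (h.nome_isBigOPow.mul h.waveNumber_isBigOPow (add_zero 1)).const_mul 100
  filter_upwards [h.eventually_nome, h.ordered,
    (hqk.tendsto_zero h.tendsto_halfGap one_ne_zero).eventually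
      (gt_mem_nhds (show (0 : ℝ) < 6 by norm_num))] with x hx hx' hx''
  refine bijective_phase (q := nome (modulus ν (β x))) hx.1 rfl hx.2 ?_ (by linarith)
  rw [waveNumber_eq hx']
  exact one_div_pos.2 (bandMean_lengthDensity_pos hx')

theorem halfGap_div_isBigOPow (h : EdgeFamily ν u v l β) :
    IsBigOPow l (fun x => halfGap (β x)) 1 fun x => halfGap (β x) / (center (β x) + ν) := by
  have h1 := h.lower
  refine h.of_eq (G := fun p => 1 / (p.2.1 + ν))
    (ContinuousAt.div (by fun_prop) (by fun_prop) (by simp; linarith)) ?_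
  exact Eventually.of_forall fun x => by ring

/-- `z` is an arbitrary function of the index, not a solution of the phase equation; this freedom
gives uniformity in the parameter later. -/
theorem parameter_sub_phase_isBigOPow (h : EdgeFamily ν u v l β) (z : ι → ℝ) :
    IsBigOPow l (fun x => halfGap (β x)) 2 fun x =>
      2 * Real.pi * z x - onePhaseZeta ν (β x) (z x) -
        halfGap (β x) / (center (β x) + ν) * Real.sin (2 * Real.pi * z x) := by
  have hS : IsBigOPow l (fun x => halfGap (β x)) 0 fun x => Real.sin (2 * Real.pi * z x) :=
    IsBigOPow.of_bounded fun x => Real.abs_sin_le_one _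
  have a1 : IsBigOPow l (fun x => halfGap (β x)) 2 fun x => logTheta ν (β x) (z x) -
      4 * nome (modulus ν (β x)) * Real.sin (2 * Real.pi * shiftP ν (β x)) *
        Real.sin (2 * Real.pi * z x) := by
    refine (h.nome_isBigOPow.pow 2).of_abs_le (C := 38) ?_
    filter_upwards [h.eventually_nome] with x hx
    rw [abs_of_nonneg (a := nome (modulus ν (β x)) ^ 2) (sq_nonneg _)]
    exact abs_logThetaRatio_sub_le hx.1 rfl hx.2 (z x)
  have a2 := h.waveNumber_isBigOPow.mul a1 (zero_add 2)
  have a3 := h.phase_amplitude_isBigOPow.mul hS (add_zero 2)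
  refine (a2.add a3).congr fun x => ?_
  rw [onePhaseZeta]
  ring

theorem parameter_sub_phase_isBigOPow_one (h : EdgeFamily ν u v l β) (z : ι → ℝ) :
    IsBigOPow l (fun x => halfGap (β x)) 1 fun x =>
      2 * Real.pi * z x - onePhaseZeta ν (β x) (z x) :=
  (((h.parameter_sub_phase_isBigOPow z).mono h.tendsto_halfGap one_le_two).add
    (h.halfGap_div_isBigOPow.mul (IsBigOPow.of_bounded fun x => Real.abs_sin_le_one _)
      (add_zero 1))).congr fun x => by ring

/-- Expand the cosine at ζ to first order. In the increment δ sin(2πz)/(m+ν), replacing 2πz by ζ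
costs only O(δ²). -/
theorem cos_parameter_isBigOPow (h : EdgeFamily ν u v l β) (z : ι → ℝ) :
    IsBigOPow l (fun x => halfGap (β x)) 2 fun x => Real.cos (2 * Real.pi * z x) -
      (Real.cos (onePhaseZeta ν (β x) (z x)) - halfGap (β x) / (center (β x) + ν) *
        Real.sin (onePhaseZeta ν (β x) (z x)) ^ 2) := by
  have hS : IsBigOPow l (fun x => halfGap (β x)) 0
      fun x => Real.sin (onePhaseZeta ν (β x) (z x)) :=
    IsBigOPow.of_bounded fun x => Real.abs_sin_le_one _
  have hd := h.parameter_sub_phase_isBigOPow_one z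
  have a1 : IsBigOPow l (fun x => halfGap (β x)) 1 fun x => Real.sin (2 * Real.pi * z x) -
      Real.sin (onePhaseZeta ν (β x) (z x)) :=
    hd.of_abs_le (C := 1) (Eventually.of_forall fun x => by
      rw [one_mul]
      exact Real.abs_sin_sub_sin_le _ _)
  have a2 := (h.parameter_sub_phase_isBigOPow z).add
    (h.halfGap_div_isBigOPow.mul a1 (by norm_num : 1 + 1 = 2))
  have a3 : IsBigOPow l (fun x => halfGap (β x)) 2 fun x => Real.cos (2 * Real.pi * z x) -
      Real.cos (onePhaseZeta ν (β x) (z x)) +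
      (2 * Real.pi * z x - onePhaseZeta ν (β x) (z x)) *
        Real.sin (onePhaseZeta ν (β x) (z x)) :=
    (hd.pow 2).of_abs_le (C := 1) (Eventually.of_forall fun x => by
      have := abs_cos_add_sub_le (onePhaseZeta ν (β x) (z x))
        (2 * Real.pi * z x - onePhaseZeta ν (β x) (z x))
      rw [add_sub_cancel] at this
      rwa [one_mul, abs_of_nonneg (a := (2 * Real.pi * z x - onePhaseZeta ν (β x) (z x)) ^ 2)
        (sq_nonneg _)])
  exact (a3.sub (a2.mul hS (add_zero 2))).congr fun x => by ring

theorem oscillation_isBigOPow (h : EdgeFamily ν u v l β) (z : ι → ℝ) :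
    IsBigOPow l (fun x => halfGap (β x)) 3 fun x =>
      2 / periodI0 ν (β x) * deriv (logTheta ν (β x)) (z x) -
      (8 * (nome (modulus ν (β x)) * Real.sin (2 * Real.pi * shiftP ν (β x)) *
          (bandMean (periodDensity ν) (β x))⁻¹) * Real.cos (2 * Real.pi * z x) -
        8 * (nome (modulus ν (β x)) ^ 2 * Real.sin (2 * (2 * Real.pi * shiftP ν (β x))) *
          (bandMean (periodDensity ν) (β x))⁻¹) * Real.cos (2 * (2 * Real.pi * z x))) := by
  have a1 : IsBigOPow l (fun x => halfGap (β x)) 3 fun x => deriv (logTheta ν (β x)) (z x) -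
      (8 * Real.pi * nome (modulus ν (β x)) * Real.sin (2 * Real.pi * shiftP ν (β x)) *
          Real.cos (2 * Real.pi * z x) -
        8 * Real.pi * nome (modulus ν (β x)) ^ 2 *
          Real.sin (2 * (2 * Real.pi * shiftP ν (β x))) *
          Real.cos (2 * (2 * Real.pi * z x))) := by
    refine (h.nome_isBigOPow.pow 3).of_abs_le (C := 320) ?_
    filter_upwards [h.eventually_nome] with x hx
    have : 0 ≤ nome (modulus ν (β x)) := (Real.exp_pos _).le
    rw [abs_of_nonneg (a := nome (modulus ν (β x)) ^ 3) (by positivity)]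
    exact abs_deriv_logThetaRatio_sub_le hx.1 rfl hx.2 (z x)
  refine ((a1.mul h.inv_period_isBigOPow (add_zero 3)).const_mul (1 / Real.pi)).congr' ?_
  filter_upwards [h.ordered] with x hx
  have c1 := bandMean_periodDensity_pos hx
  have hpi := Real.pi_pos
  rw [periodI0_eq hx]
  change 2 / (2 * Real.pi * bandMean (periodDensity ν) (β x)) * _ - _ = _
  field_simp

/-- The one-phase solution near the edge, in terms of its phase. -/
theorem onePhaseU_isBigOPow (h : EdgeFamily ν u v l β) (z : ι → ℝ) :
    IsBigOPow l (fun x => halfGap (β x)) 3 fun x => onePhaseU ν (β x) (z x) -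
      (β x 0 + 2 * halfGap (β x) * Real.cos (onePhaseZeta ν (β x) (z x)) -
        halfGap (β x) ^ 2 / 2 * ((β x 0 + ν) / ((center (β x) + ν) * (β x 0 - center (β x)))) *
          (1 - Real.cos (2 * onePhaseZeta ν (β x) (z x)))) := by
  have h1 := h.lower
  have h2 := h.upper
  have hS : ∀ φ : ι → ℝ, IsBigOPow l (fun x => halfGap (β x)) 0 fun x => Real.sin (φ x) :=
    fun φ => IsBigOPow.of_bounded fun x => Real.abs_sin_le_one _
  have hC : ∀ φ : ι → ℝ, IsBigOPow l (fun x => halfGap (β x)) 0 fun x => Real.cos (φ x) :=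
    fun φ => IsBigOPow.of_bounded fun x => Real.abs_cos_le_one _
  have hA1 := ((h.nome_isBigOPow.mul (hS fun x => 2 * Real.pi * shiftP ν (β x))
    (add_zero 1)).mul h.inv_period_isBigOPow (add_zero 1)).const_mul 8
  have hA2 := (((h.nome_isBigOPow.pow 2).mul (hS fun x => 2 * (2 * Real.pi * shiftP ν (β x)))
    (add_zero _)).mul h.inv_period_isBigOPow (add_zero _)).const_mul 8
  have hcos := ((hC fun x => onePhaseZeta ν (β x) (z x)).sub ((h.halfGap_div_isBigOPow.mul
    ((hS fun x => onePhaseZeta ν (β x) (z x)).pow 2) (add_zero 1)).mono h.tendsto_halfGap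
      zero_le_one))
  have hcos2 : IsBigOPow l (fun x => halfGap (β x)) 1 fun x =>
      Real.cos (2 * (2 * Real.pi * z x)) - Real.cos (2 * onePhaseZeta ν (β x) (z x)) :=
    (h.parameter_sub_phase_isBigOPow_one z).of_abs_le (C := 2) (Eventually.of_forall fun x => by
      refine (Real.abs_cos_sub_cos_le _ _).trans ?_
      rw [← mul_sub, abs_mul, abs_two])
  -- The amplitudes are O(δ) and O(δ²), so cos 2πz is needed up to O(δ²) and cos 4πz only up to
  -- O(δ).
  have a1 := hA1.mul_sub_mul (h.cos_parameter_isBigOPow z) (by norm_num : 1 + 2 = 3)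
    h.amplitude_isBigOPow hcos (add_zero 3)
  have a2 := hA2.mul_sub_mul hcos2 (by norm_num : 1 * 2 + 1 = 3) h.second_amplitude_isBigOPow
    (hC fun x => 2 * onePhaseZeta ν (β x) (z x)) (add_zero 3)
  have a3 := ((h.mean_isBigOPow.mono h.tendsto_halfGap (by norm_num : 3 ≤ 4)).add
    (h.oscillation_isBigOPow z)).add (a1.sub a2)
  refine a3.congr' ?_
  filter_upwards [h.ordered] with x hx
  obtain ⟨b1, b2, b3⟩ := hx.halfGap_bounds
  have c1 : 0 < center (β x) + ν := by linarith
  have c2 : 0 < β x 0 - center (β x) := by linarith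
  have hcos2 := Real.cos_two_mul (onePhaseZeta ν (β x) (z x))
  have hsq := Real.sin_sq (onePhaseZeta ν (β x) (z x))
  rw [onePhaseU, hcos2, hsq]
  generalize Real.cos (onePhaseZeta ν (β x) (z x)) = y
  generalize 2 * (β x 2 + ν) *
    (ellipticLambda (modulus ν (β x)) (rho ν (β x)) / ellipticK (modulus ν (β x))) = m
  generalize 2 / periodI0 ν (β x) * deriv (logTheta ν (β x)) (z x) = o
  generalize 8 * (nome (modulus ν (β x)) * Real.sin (2 * Real.pi * shiftP ν (β x)) *
          (bandMean (periodDensity ν) (β x))⁻¹) * Real.cos (2 * Real.pi * z x) = o1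
  generalize 8 * (nome (modulus ν (β x)) ^ 2 * Real.sin (2 * (2 * Real.pi * shiftP ν (β x))) *
          (bandMean (periodDensity ν) (β x))⁻¹) * Real.cos (2 * (2 * Real.pi * z x)) = o2
  field_simp
  ring

/-- The one-phase solution near the edge, with the coefficient of the second harmonic evaluated at
the edge. -/
theorem onePhaseU_isBigOPow_edge (h : EdgeFamily ν u v l β) (z : ι → ℝ)
    (hr : (fun x => edgeSize u v (β x)) =O[l] fun x => halfGap (β x) ^ 2) :
    IsBigOPow l (fun x => halfGap (β x)) 3 fun x => onePhaseU ν (β x) (z x) -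
      (β x 0 + 2 * halfGap (β x) * Real.cos (onePhaseZeta ν (β x) (z x)) -
        halfGap (β x) ^ 2 / 2 * ((u + ν) / ((u - v) * (v + ν))) *
          (1 - Real.cos (2 * onePhaseZeta ν (β x) (z x)))) := by
  have hF : SmoothNear (fun p : ℝ × ℝ => (p.1 + ν) / ((p.2 + ν) * (p.1 - p.2))) (u, v) :=
    (eventually_admissible (p := (u, v)) h.lower h.upper).mono fun q hq =>
      ContDiffAt.div (by fun_prop) (by fun_prop) (mul_pos hq.1 hq.2).ne'
  have a1 : IsBigOPow l (fun x => halfGap (β x)) 2 _ := (pair_isBigO h.tendsto hF).trans hr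
  have a2 : IsBigOPow l (fun x => halfGap (β x)) 0
      fun x => 1 - Real.cos (2 * onePhaseZeta ν (β x) (z x)) :=
    IsBigOPow.of_bounded (C := 2) fun x => by
      have h1 := Real.cos_le_one (2 * onePhaseZeta ν (β x) (z x))
      have h2 := Real.neg_one_le_cos (2 * onePhaseZeta ν (β x) (z x))
      rw [abs_le]
      constructor <;> linarith
  -- The coefficient differs from its edge value by O(δ²), so the change is of order δ⁴.
  have a3 := ((((IsBigOPow.self_pow l (fun x => halfGap (β x)) 2).mul a1 (by norm_num :
    2 + 2 = 4)).mul a2 (add_zero 4)).mono h.tendsto_halfGap (by norm_num : 3 ≤ 4)).const_mul (-1 / 2)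
  refine ((h.onePhaseU_isBigOPow z).add a3).congr fun x => ?_
  dsimp only
  rw [mul_comm (u - v)]
  ring

end EdgeFamily

/-- The expansion of the one-phase solution is uniform in the uniformizing parameter. -/
theorem EdgeFamily.exists_uniform_bound {ι : Type*} {ν u v : ℝ} {l : Filter ι}
    {β : ι → Fin 3 → ℝ} (h : EdgeFamily ν u v l β)
    (hr : (fun x => edgeSize u v (β x)) =O[l] fun x => halfGap (β x) ^ 2)
    {φ : ι → ℝ} (hφ : (fun x => β x 0 - φ x) =O[l] fun x => halfGap (β x) ^ 4) :
    ∃ M : ℝ, ∀ᶠ x in l, ∀ z : ℝ, |onePhaseU ν (β x) z -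
      (φ x + 2 * halfGap (β x) * Real.cos (onePhaseZeta ν (β x) z) -
        halfGap (β x) ^ 2 / 2 * ((u + ν) / ((u - v) * (v + ν))) *
          (1 - Real.cos (2 * onePhaseZeta ν (β x) z)))| ≤ M * halfGap (β x) ^ 3 := by
  -- On the product with the principal filter of all of ℝ, an eventual bound along pairs (x, z)
  -- holds for every z at once.
  have hfst : Tendsto Prod.fst (l ×ˢ 𝓟 (univ : Set ℝ)) l := tendsto_fst
  have h' : EdgeFamily ν u v (l ×ˢ 𝓟 (univ : Set ℝ)) fun p => β p.1 :=
    ⟨h.tendsto.comp hfst, hfst.eventually h.ordered, h.lower, h.upper⟩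
  have a1 := h'.onePhaseU_isBigOPow_edge (fun p => p.2) (hr.comp_tendsto hfst)
  have a2 : IsBigOPow (l ×ˢ 𝓟 (univ : Set ℝ)) (fun p => halfGap (β p.1)) 4
    fun p => β p.1 0 - φ p.1 := hφ.comp_tendsto hfst
  obtain ⟨M, hM⟩ := (a1.add (a2.mono h'.tendsto_halfGap (by norm_num : 3 ≤ 4))).bound
  refine ⟨M, ?_⟩
  filter_upwards [eventually_prod_principal_iff.1 hM, h.ordered] with x hx hx' z
  have h3 := hx z (mem_univ z)
  rw [Real.norm_eq_abs, Real.norm_eq_abs, abs_of_pos (pow_pos hx'.halfGap_bounds.1 3)] at h3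
  refine le_trans (le_of_eq ?_) h3
  congr 1
  ring

end CHOnePhase

end

/-! ### The main theorem -/

theorem mainTheorem1
    (ν : ℝ) (u₀ : SchwartzMap ℝ ℝ) (xM : ℝ) (hu₀ : CHOnePhase.IsSingleNegativeHump u₀ xM)
    (f : ℝ → ℝ) (hf : f = CHOnePhase.fMinus u₀ xM)
    (t xm u v : ℝ) (hνv : -ν < v) (hMv : u₀ xM < v) (hvu : v < u) (hu : u < 0)
    (hedge : CHOnePhase.IsLeadingEdge ν f t xm u v)
    (hslope : 3 * t + deriv f u ≠ 0)
    (hV : CHOnePhase.VFun ν f t u v ≠ 0)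
    (β : ℝ → Fin 3 → ℝ)
    (hord : ∀ᶠ x in 𝓝[>] xm, -ν < β x 2 ∧ β x 2 < β x 1 ∧ β x 1 < β x 0)
    (hhod : ∀ᶠ x in 𝓝[>] xm, CHOnePhase.SolvesHodograph ν f x t (β x))
    (hβ₁ : Tendsto (fun x => β x 0) (𝓝[>] xm) (𝓝 u))
    (hβ₂ : Tendsto (fun x => β x 1) (𝓝[>] xm) (𝓝 v))
    (hβ₃ : Tendsto (fun x => β x 2) (𝓝[>] xm) (𝓝 v)) :
    ∃ M : ℝ, ∀ᶠ x in 𝓝[>] xm,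
      |CHOnePhase.phaseXi ν f x t (β x) -
          (-2 * √((u - v) * (v + ν)) * (CHOnePhase.PhiFun f u v + 3 * t) +
            √((u - v) / (v + ν)) * (x - xm))| ≤ M * (x - xm) ^ 2 ∧
      ∀ ε > 0,
        (∃! z, CHOnePhase.IsParameter ν f (β x) x t ε z) ∧
        ∀ z, CHOnePhase.IsParameter ν f (β x) x t ε z → ∀ δ, δ = (β x 1 - β x 2) / 2 →
          |CHOnePhase.onePhaseU ν (β x) z -
              (u + (x - xm) / (3 * t + deriv f u)
                + 2 * δ * Real.cos (CHOnePhase.phaseXi ν f x t (β x) / ε)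
                - δ ^ 2 / 2 * ((u + ν) / ((u - v) * (v + ν))) *
                  (1 - Real.cos (2 * (CHOnePhase.phaseXi ν f x t (β x) / ε))))| ≤ M * δ ^ 3 := by
  have hu' : u ∈ Set.Ioo (u₀ xM) 0 := ⟨hMv.trans hvu, hu⟩
  have hv' : v ∈ Set.Ioo (u₀ xM) 0 := ⟨hMv, hvu.trans hu⟩
  have hsmooth : ∀ y ∈ Set.Ioo (u₀ xM) 0, ContDiffAt ℝ (⊤ : ℕ∞) f y := fun y hy =>
    hf ▸ CHOnePhase.contDiffAt_fMinus hu₀ hy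
  have hβ := CHOnePhase.tendstoEdge_of hβ₁ hβ₂ hβ₃
  have hadm : ∀ᶠ x in 𝓝[>] xm, CHOnePhase.Admissible ν (u₀ xM) 0 (β x) := by
    filter_upwards [hord, hβ₁.eventually (Ioo_mem_nhds hu'.1 hu'.2),
      hβ₂.eventually (Ioo_mem_nhds hv'.1 hv'.2), hβ₃.eventually (Ioo_mem_nhds hv'.1 hv'.2)]
      with x h h0 h1 h2
    exact ⟨h, fun i => by fin_cases i <;> assumption⟩
  obtain ⟨hsize, hΔ, hξ⟩ := CHOnePhase.hodograph_asymptotics hsmooth hu' hv' hνv hvu hedge hslope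
    hV hβ hadm hhod
  have hfam : CHOnePhase.EdgeFamily ν u v (𝓝[>] xm) β :=
    ⟨hβ, hord, by linarith, by linarith⟩
  obtain ⟨M₁, hM₁⟩ := hξ.bound
  obtain ⟨M₂, hM₂⟩ := hfam.exists_uniform_bound hsize
    (φ := fun x => u + (x - xm) / (3 * t + deriv f u)) (by simpa only [sub_sub] using hΔ)
  refine ⟨max M₁ M₂, ?_⟩
  filter_upwards [hM₁, hM₂, hfam.eventually_bijective, hord] with x h1 h2 hbij hx
  -- The only place where ε enters: the parameter equation fixes ζ at ξ/ε, and all bounds above hold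
  -- for every z.
  have hphase : ∀ ε z, CHOnePhase.IsParameter ν f (β x) x t ε z ↔
      CHOnePhase.onePhaseZeta ν (β x) z = CHOnePhase.phaseXi ν f x t (β x) / ε := fun ε z => by
    rw [CHOnePhase.IsParameter, CHOnePhase.phaseXi, eq_comm, div_mul_eq_mul_div]
  refine ⟨?_, fun ε _ => ⟨?_, fun z hz δ hδ => ?_⟩⟩
  · rw [Real.norm_eq_abs, Real.norm_eq_abs, abs_of_nonneg (sq_nonneg (x - xm))] at h1
    exact h1.trans (mul_le_mul_of_nonneg_right (le_max_left _ _) (sq_nonneg _))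
  · simp only [hphase]
    exact hbij.existsUnique _
  · have h3 := h2 z
    rw [(hphase ε z).1 hz, show CHOnePhase.halfGap (β x) = δ from hδ.symm] at h3
    have hδ0 : 0 < δ := by linarith [hx.2.1]
    exact h3.trans (mul_le_mul_of_nonneg_right (le_max_right _ _) (pow_pos hδ0 3).le)
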